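/- Let $K$ be a field, $\mathcal Q$ a finite quiver (paths are read from left to right), $I$ an admissible ideal of the path algebra $K\mathcal Q$, and $\Lambda=K\mathcal Q/I$ a finite-dimensional algebra. Let $g^2$ be a minimal set of uniform elements generating $I$, where $x\in K\mathcal Q$ is uniform if $x=vx=xv'$ for some vertices $v,v'$. For $A\ge 1$, the quiver $\tilde{\mathcal Q}_A$ is obtained from $\mathcal Q$ by keeping all vertices and replacing each arrow $\alpha$ by a path $\alpha_1\alpha_2\cdots\alpha_A$ of $A$ new arrows from the origin of $\alpha$ to the end of $\alpha$, which passes through $A-1$ new vertices $w_1,\dots,w_{A-1}$ (distinct for distinct arrows $\alpha$). Let $\theta^*:K\mathcal Q\to K\tilde{\mathcal Q}_A$ be the (not necessarily unital) $K$-algebra homomorphism with $v\mapsto v$ for each vertex $v$ and $\alpha\mapsto\alpha_1\alpha_2\cdots\alpha_A$ for each arrow $\alpha$. Let $\tilde I_A$ be the ideal of $K\tilde{\mathcal Q}_A$ generated by $\theta^*(g^2)$. The stretched algebra of $\Lambda$ is $\tilde\Lambda_A=K\tilde{\mathcal Q}_A/\tilde I_A$. Consider a finite-dimensional algebra $\Gamma=K\mathcal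 R/L$, with $\mathcal R$ a finite quiver and $L$ an admissible ideal generated by length homogeneous elements, with its length grading. Let $(P^n,d^n)_{n\ge 0}$ be a minimal graded projective resolution of the right $\Gamma$-module $\Gamma/\mathfrak r$, where $\mathfrak r$ is the Jacobson radical of $\Gamma$. * For $d\ge 2$, $\Gamma$ is $d$-Koszul if, for all $n\ge 0$, $P^n$ is generated in degree $\frac n2 d$ when $n$ is even, and in degree $\frac{n-1}2 d+1$ when $n$ is odd. * For $D\ge 2$ and $A\ge 1$, $\Gamma$ is $(D,A)$-stacked if, for all $n\ge 0$, $P^n$ is generated in degree $\delta(n)$, where $$\delta(n)=\begin{cases}0 & n=0,\\ 1 & n=1,\\ \frac n2 D & n\ge 2 \text{ even},\\ \frac{n-1}2 D+A & n\ge 3\text{ odd}.\end{cases}$$ (For $n$ larger than the global dimension of $\Gamma$, $P^n=0$ and the condition is empty. Both notions include that the ideal $L$ is admissible and length homogeneous and that $\Gamma$ is finite-dimensional.) **Theorem.** If $\Lambda=K\mathcal Q/I$ is $d$-Koszul for some $d\ge 2$, then for every $A\ge 1$ the stretched algebra $\tilde\Lambda_A=K\tilde{\mathcal Q}_A/\tilde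 I_A$ is a $(D,A)$-stacked algebra with $D=dA$. -/

import Mathlib

universe u v w

/-! ### Path algebras -/

/-- The path algebra `K𝒬` of a quiver with vertex type `V`: the `K`-vector space on the set of all
paths (the trivial paths at the vertices included).  Paths are read from left to right. -/
def PathAlgebra (K : Type w) [Field K] (V : Type u) [Quiver.{v} V] : Type (max u v w) :=
  (Σ a b : V, Quiver.Path a b) →₀ K

namespace PathAlgebra

variable (K : Type w) [Field K] {V : Type u} [Quiver.{v} V]

noncomputable instance : AddCommGroup (PathAlgebra K V) :=
  inferInstanceAs (AddCommGroup ((Σ a b : V, Quiver.Path a b) →₀ K))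

noncomputable instance : Module K (PathAlgebra K V) :=
  inferInstanceAs (Module K ((Σ a b : V, Quiver.Path a b) →₀ K))

/-- The coefficient of a path in an element of the path algebra. -/
def coeff {K : Type w} [Field K] (x : PathAlgebra K V) {a b : V} (p : Quiver.Path a b) : K :=
  (show (Σ a b : V, Quiver.Path a b) →₀ K from x) ⟨a, b, p⟩

/-- The basis element of the path algebra given by a path. -/
noncomputable def ofPath {a b : V} (p : Quiver.Path a b) : PathAlgebra K V :=
  (Finsupp.single ⟨a, b, p⟩ 1 : (Σ a b : V, Quiver.Path a b) →₀ K)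

/-- The linear map out of the path algebra with prescribed values on the paths. -/
noncomputable def liftPath {M : Type*} [AddCommGroup M] [Module K M]
    (f : (Σ a b : V, Quiver.Path a b) → M) : PathAlgebra K V →ₗ[K] M :=
  Finsupp.lift M K (Σ a b : V, Quiver.Path a b) f

theorem liftPath_ofPath {M : Type*} [AddCommGroup M] [Module K M]
    (f : (Σ a b : V, Quiver.Path a b) → M) {a b : V} (p : Quiver.Path a b) :
    liftPath K f (ofPath K p) = f ⟨a, b, p⟩ := by
  have h : Finsupp.lift M K (Σ a b : V, Quiver.Path a b) f (Finsupp.single ⟨a, b, p⟩ 1) =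
      f ⟨a, b, p⟩ := by simp
  exact h

open Classical in
/-- The product of two paths: concatenation if the first ends where the second starts, else `0`. -/
noncomputable def mulPath (p q : Σ a b : V, Quiver.Path a b) : PathAlgebra K V :=
  if h : q.1 = p.2.1 then ofPath K (p.2.2.comp (q.2.2.cast h rfl)) else 0

/-- The bilinear multiplication of the path algebra. -/
noncomputable def mulHom : PathAlgebra K V →ₗ[K] PathAlgebra K V →ₗ[K] PathAlgebra K V :=
  liftPath K fun p => liftPath K fun q => mulPath K p q

noncomputable instance : Mul (PathAlgebra K V) := ⟨fun x y => mulHom K x y⟩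

/-- The identity element is the sum of all trivial paths. -/
noncomputable instance [Fintype V] : One (PathAlgebra K V) :=
  ⟨∑ a : V, ofPath K (Quiver.Path.nil : Quiver.Path a a)⟩

variable {K}

theorem mul_def (x y : PathAlgebra K V) : x * y = mulHom K x y := rfl

theorem one_def [Fintype V] :
    (1 : PathAlgebra K V) = ∑ a : V, ofPath K (Quiver.Path.nil : Quiver.Path a a) := rfl

theorem ofPath_mul {a b c d : V} (p : Quiver.Path a b) (q : Quiver.Path c d) :
    ofPath K p * ofPath K q = mulPath K ⟨a, b, p⟩ ⟨c, d, q⟩ := by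
  rw [mul_def, mulHom, liftPath_ofPath, liftPath_ofPath]

theorem ofPath_mul_comp {a b c : V} (p : Quiver.Path a b) (q : Quiver.Path b c) :
    ofPath K p * ofPath K q = ofPath K (p.comp q) := by
  rw [ofPath_mul]; simp [mulPath]

theorem ofPath_mul_of_ne {a b c d : V} (p : Quiver.Path a b) (q : Quiver.Path c d) (h : c ≠ b) :
    ofPath K p * ofPath K q = 0 := by
  rw [ofPath_mul]; simp [mulPath, h]

@[elab_as_elim]
theorem induction_on {P : PathAlgebra K V → Prop} (x : PathAlgebra K V) (zero : P 0)
    (add : ∀ x y, P x → P y → P (x + y))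
    (smul : ∀ (k : K) (a b : V) (p : Quiver.Path a b), P (k • ofPath K p)) : P x := by
  refine Finsupp.induction_linear (motive := P) x zero (fun f g hf hg => add f g hf hg) ?_
  rintro ⟨a, b, p⟩ k
  have h := smul k a b p
  have e : k • ofPath K p = (Finsupp.single ⟨a, b, p⟩ k : (Σ a b : V, Quiver.Path a b) →₀ K) :=
    (Finsupp.smul_single k _ 1).trans (by simp)
  rwa [e] at h

protected theorem smul_mul (k : K) (x y : PathAlgebra K V) : (k • x) * y = k • (x * y) := by
  simp [mul_def]

protected theorem mul_smul (k : K) (x y : PathAlgebra K V) : x * (k • y) = k • (x * y) := by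
  simp [mul_def]

protected theorem add_mul' (x y z : PathAlgebra K V) : (x + y) * z = x * z + y * z := by
  simp [mul_def]

protected theorem mul_add' (x y z : PathAlgebra K V) : x * (y + z) = x * y + x * z := by
  simp [mul_def]

protected theorem zero_mul' (x : PathAlgebra K V) : 0 * x = 0 := by simp [mul_def]

protected theorem mul_zero' (x : PathAlgebra K V) : x * 0 = 0 := by simp [mul_def]

protected theorem mul_assoc' (x y z : PathAlgebra K V) : x * y * z = x * (y * z) := by
  induction x using induction_on with
  | zero => simp only [PathAlgebra.zero_mul']
  | add x x' hx hx' => simp only [PathAlgebra.add_mul', hx, hx']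
  | smul k a b p =>
    simp only [PathAlgebra.smul_mul]
    congr 1
    induction y using induction_on with
    | zero => simp only [PathAlgebra.zero_mul', PathAlgebra.mul_zero']
    | add y y' hy hy' => simp only [PathAlgebra.add_mul', PathAlgebra.mul_add', hy, hy']
    | smul k c d q =>
      simp only [PathAlgebra.smul_mul, PathAlgebra.mul_smul]
      congr 1
      induction z using induction_on with
      | zero => simp only [PathAlgebra.mul_zero']
      | add z z' hz hz' => simp only [PathAlgebra.mul_add', hz, hz']
      | smul k e f r =>
        simp only [PathAlgebra.mul_smul]
        congr 1
        by_cases h : c = b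
        · subst h
          by_cases h' : e = d
          · subst h'
            simp only [ofPath_mul_comp, Quiver.Path.comp_assoc]
          · simp only [ofPath_mul_comp, ofPath_mul_of_ne _ _ h', PathAlgebra.mul_zero']
        · by_cases h' : e = d
          · subst h'
            simp only [ofPath_mul_comp, ofPath_mul_of_ne _ _ h, PathAlgebra.zero_mul']
          · simp only [ofPath_mul_of_ne _ _ h, ofPath_mul_of_ne _ _ h', PathAlgebra.zero_mul',
              PathAlgebra.mul_zero']

noncomputable instance : NonUnitalRing (PathAlgebra K V) where
  left_distrib := PathAlgebra.mul_add'
  right_distrib := PathAlgebra.add_mul'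
  zero_mul := PathAlgebra.zero_mul'
  mul_zero := PathAlgebra.mul_zero'
  mul_assoc := PathAlgebra.mul_assoc'

protected theorem one_mul' [Fintype V] (x : PathAlgebra K V) : 1 * x = x := by
  induction x using induction_on with
  | zero => exact mul_zero _
  | add x y hx hy => rw [mul_add, hx, hy]
  | smul k a b p =>
    rw [PathAlgebra.mul_smul, one_def, Finset.sum_mul, Finset.sum_eq_single a]
    · rw [ofPath_mul_comp, Quiver.Path.nil_comp]
    · intro c _ hc
      exact ofPath_mul_of_ne _ _ hc.symm
    · simp

protected theorem mul_one' [Fintype V] (x : PathAlgebra K V) : x * 1 = x := by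
  induction x using induction_on with
  | zero => exact zero_mul _
  | add x y hx hy => rw [add_mul, hx, hy]
  | smul k a b p =>
    rw [PathAlgebra.smul_mul, one_def, Finset.mul_sum, Finset.sum_eq_single b]
    · rw [ofPath_mul_comp, Quiver.Path.comp_nil]
    · intro c _ hc
      exact ofPath_mul_of_ne _ _ hc
    · simp

noncomputable instance [Fintype V] : Ring (PathAlgebra K V) where
  __ := (inferInstance : NonUnitalRing (PathAlgebra K V))
  one_mul := PathAlgebra.one_mul'
  mul_one := PathAlgebra.mul_one'

noncomputable instance [Fintype V] : Algebra K (PathAlgebra K V) :=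
  Algebra.ofModule PathAlgebra.smul_mul PathAlgebra.mul_smul

/-- An element `x` is uniform if `x = v x = x v'` for some vertices `v`, `v'`. -/
def IsUniform (x : PathAlgebra K V) : Prop :=
  ∃ a b : V, ofPath K (Quiver.Path.nil : Quiver.Path a a) * x = x ∧
    x * ofPath K (Quiver.Path.nil : Quiver.Path b b) = x

variable (K V) in
/-- The subspace of length homogeneous elements of length `n`, spanned by the paths of
length `n`. -/
noncomputable def lengthPart (n : ℕ) : Submodule K (PathAlgebra K V) :=
  Submodule.span K {x | ∃ (a b : V) (p : Quiver.Path a b), p.length = n ∧ x = ofPath K p}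

variable [Fintype V]

/-- An ideal `I` of `K𝒬` is admissible if `Jᵐ ⊆ I ⊆ J²` for some `m ≥ 2`, where `J` is the ideal
generated by the arrows; `Jᵐ` is the span of all paths of length at least `m`. -/
def IsAdmissible (I : TwoSidedIdeal (PathAlgebra K V)) : Prop :=
  (∀ x ∈ I, ∀ (a b : V) (p : Quiver.Path a b), x.coeff p ≠ 0 → 2 ≤ p.length) ∧
  ∃ m : ℕ, 2 ≤ m ∧ ∀ (a b : V) (p : Quiver.Path a b), m ≤ p.length → ofPath K p ∈ I

/-- An ideal is length homogeneous if it is generated by length homogeneous elements. -/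
def IsLengthHomogeneous (I : TwoSidedIdeal (PathAlgebra K V)) : Prop :=
  ∃ S : Set (PathAlgebra K V), (∀ x ∈ S, ∃ n, x ∈ lengthPart K V n) ∧ TwoSidedIdeal.span S = I

/-- `g` is a minimal set of uniform elements generating the ideal `I`. -/
structure IsMinimalUniformGenerating (g : Set (PathAlgebra K V))
    (I : TwoSidedIdeal (PathAlgebra K V)) : Prop where
  uniform : ∀ x ∈ g, x.IsUniform
  span_eq : TwoSidedIdeal.span g = I
  minimal : ∀ g' : Set (PathAlgebra K V), g' ⊂ g → TwoSidedIdeal.span g' ≠ I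

/-- The algebra `K𝒬/I`. -/
abbrev QuotientAlgebra (I : TwoSidedIdeal (PathAlgebra K V)) : Type (max u v w) :=
  I.ringCon.Quotient

/-- The length `n` part of `K𝒬/I`: the image of the length `n` part of `K𝒬`. -/
noncomputable def quotientPart (I : TwoSidedIdeal (PathAlgebra K V)) (n : ℕ) :
    AddSubgroup (QuotientAlgebra I) :=
  (lengthPart K V n).toAddSubgroup.map (I.ringCon.mk' : PathAlgebra K V →+* QuotientAlgebra I)

end PathAlgebra

/-! ### Minimal graded projective resolutions

Right modules over a ring `R` are modules over `Rᵐᵒᵖ`.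
-/

/-- `Λ/𝔯` as a right `Λ`-module; the Jacobson radical `𝔯` is the radical of the right module `Λ`,
the intersection of its maximal submodules. -/
abbrev TopModule (R : Type u) [Ring R] : Type u := R ⧸ Module.jacobson Rᵐᵒᵖ R

/-- A minimal graded projective resolution
`⋯ → P 2 → P 1 → P 0 → Λ/𝔯 → 0`
of the right module `Λ/𝔯`, by finitely generated graded right modules, where `Λ` is graded by
`𝒜` and `Λ/𝔯` by the images of the `𝒜 i`. -/
structure MinimalGradedResolution (R : Type u) [Ring R] (𝒜 : ℕ → AddSubgroup R) where
  /-- the terms -/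
  P : ℕ → Type u
  [addCommGroup : ∀ n, AddCommGroup (P n)]
  [module : ∀ n, Module Rᵐᵒᵖ (P n)]
  /-- the differentials -/
  d : ∀ n, P (n + 1) →ₗ[Rᵐᵒᵖ] P n
  /-- the augmentation -/
  aug : P 0 →ₗ[Rᵐᵒᵖ] TopModule R
  /-- the gradings of the terms -/
  grading : ∀ n, ℕ → AddSubgroup (P n)
  finite : ∀ n, Module.Finite Rᵐᵒᵖ (P n)
  projective : ∀ n, Module.Projective Rᵐᵒᵖ (P n)
  isInternal : ∀ n, DirectSum.IsInternal (grading n)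
  smul_mem : ∀ (n i j : ℕ) (x : P n) (r : R), x ∈ grading n i → r ∈ 𝒜 j →
    MulOpposite.op r • x ∈ grading n (i + j)
  d_mem : ∀ (n i : ℕ) (x : P (n + 1)), x ∈ grading (n + 1) i → d n x ∈ grading n i
  aug_mem : ∀ (i : ℕ) (x : P 0), x ∈ grading 0 i →
    ∃ r ∈ 𝒜 i, aug x = (Module.jacobson Rᵐᵒᵖ R).mkQ r
  aug_surjective : Function.Surjective aug
  exact_zero : Function.Exact (d 0) aug
  exact_succ : ∀ n, Function.Exact (d (n + 1)) (d n)
  /-- minimality: the image of each differential lies in the radical -/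
  minimal : ∀ (n : ℕ) (x : P (n + 1)), d n x ∈ Module.jacobson Rᵐᵒᵖ (P n)

attribute [instance] MinimalGradedResolution.addCommGroup MinimalGradedResolution.module

/-- The `n`-th term of the resolution is generated in degree `m`. -/
def MinimalGradedResolution.GeneratedInDegree {R : Type u} [Ring R] {𝒜 : ℕ → AddSubgroup R}
    (P : MinimalGradedResolution R 𝒜) (n m : ℕ) : Prop :=
  Submodule.span Rᵐᵒᵖ (P.grading n m : Set (P.P n)) = ⊤

/-! ### `d`-Koszul and `(D, A)`-stacked algebras -/

/-- The degrees in which the resolution of a `d`-Koszul algebra is generated. -/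
def koszulDegree (d n : ℕ) : ℕ :=
  if Even n then n / 2 * d else (n - 1) / 2 * d + 1

/-- The degrees `δ(n)` in which the resolution of a `(D, A)`-stacked algebra is generated. -/
def stackedDegree (D A n : ℕ) : ℕ :=
  if n = 0 then 0
  else if n = 1 then 1
  else if Even n then n / 2 * D
  else (n - 1) / 2 * D + A

section Koszul

variable {K : Type w} [Field K] {V : Type u} [Quiver.{v} V] [Fintype V]

/-- `Λ = K𝒬/I` is a finite-dimensional algebra with `I` admissible and length homogeneous, and the
`n`-th term of the minimal graded projective resolution of `Λ/𝔯` is generated in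
degree `f n`, for every `n` (beyond the global dimension the terms are `0`). -/
structure HasPureResolution (I : TwoSidedIdeal (PathAlgebra K V)) (f : ℕ → ℕ) : Prop where
  admissible : PathAlgebra.IsAdmissible I
  finiteDimensional : FiniteDimensional K (PathAlgebra.QuotientAlgebra I)
  homogeneous : PathAlgebra.IsLengthHomogeneous I
  resolution : ∃ P : MinimalGradedResolution (PathAlgebra.QuotientAlgebra I)
    (PathAlgebra.quotientPart I), ∀ n, P.GeneratedInDegree n (f n)

/-- `K𝒬/I` is a (finite-dimensional) `d`-Koszul algebra, for `d ≥ 2`. -/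
def IsKoszul (I : TwoSidedIdeal (PathAlgebra K V)) (d : ℕ) : Prop :=
  HasPureResolution I (koszulDegree d)

/-- `K𝒬/I` is a `(D, A)`-stacked algebra. -/
def IsStacked (I : TwoSidedIdeal (PathAlgebra K V)) (D A : ℕ) : Prop :=
  2 ≤ D ∧ 1 ≤ A ∧ HasPureResolution I (stackedDegree D A)

end Koszul

/-! ### The stretched algebra -/

/-- The vertices of the stretched quiver: those of the original quiver and, for each arrow `α`,
new vertices `w₁, …, w_{A-1}`; here `Sum.inr ⟨a, b, α, i⟩` is `w_{i+1}`. -/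
def StretchedVertex (V : Type u) [Quiver.{v} V] (A : ℕ) : Type (max u v) :=
  V ⊕ (Σ (a b : V) (_ : a ⟶ b), Fin (A - 1))

namespace StretchedVertex

variable {V : Type u} [Quiver.{v} V] {A : ℕ}

instance [Fintype V] [∀ a b : V, Fintype (a ⟶ b)] : Fintype (StretchedVertex V A) :=
  inferInstanceAs (Fintype (V ⊕ (Σ (a b : V) (_ : a ⟶ b), Fin (A - 1))))

/-- The inclusion of the old vertices. -/
def old (a : V) : StretchedVertex V A := Sum.inl a

/-- The vertices on the path replacing `α`: `on α 0` is the origin of `α`, `on α j` is `w_j` for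
`1 ≤ j ≤ A - 1`, and `on α A` is the end of `α`. -/
def on {a b : V} (α : a ⟶ b) : ℕ → StretchedVertex V A
  | 0 => old a
  | j + 1 => if h : j < A - 1 then Sum.inr ⟨a, b, α, ⟨j, h⟩⟩ else old b

/-- The arrows of the stretched quiver: for each arrow `α` and `0 ≤ j < A`, the arrow
`α_{j+1}` from `on α j` to `on α (j + 1)`. -/
inductive Arrow : StretchedVertex V A → StretchedVertex V A → Type (max u v)
  | mk {a b : V} (α : a ⟶ b) (j : ℕ) (hj : j < A) : Arrow (on α j) (on α (j + 1))

instance : Quiver.{max u v} (StretchedVertex V A) := ⟨Arrow⟩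

theorem on_last (hA : 1 ≤ A) {a b : V} (α : a ⟶ b) : (on α A : StretchedVertex V A) = old b := by
  cases A with
  | zero => omega
  | succ n => simp [on]

/-- The path `α₁ α₂ ⋯ α_j`. -/
def initialPath {a b : V} (α : a ⟶ b) :
    ∀ j : ℕ, j ≤ A → Quiver.Path (old a : StretchedVertex V A) (on α j)
  | 0, _ => Quiver.Path.nil
  | j + 1, hj => (initialPath α j (Nat.le_of_succ_le hj)).cons (Arrow.mk α j hj)

/-- The path `α₁ α₂ ⋯ α_A`. -/
def arrowPath (hA : 1 ≤ A) {a b : V} (α : a ⟶ b) :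
    Quiver.Path (old a : StretchedVertex V A) (old b) :=
  (initialPath α A le_rfl).cast rfl (on_last hA α)

/-- The path obtained from a path by replacing each arrow `α` by `α₁ α₂ ⋯ α_A`. -/
def stretchPath (hA : 1 ≤ A) {a : V} :
    ∀ {b : V}, Quiver.Path a b → Quiver.Path (old a : StretchedVertex V A) (old b)
  | _, .nil => .nil
  | _, .cons p α => (stretchPath hA p).comp (arrowPath hA α)

theorem stretchPath_comp (hA : 1 ≤ A) {a b c : V} (p : Quiver.Path a b) (q : Quiver.Path b c) :
    (stretchPath hA (p.comp q) : Quiver.Path (old a : StretchedVertex V A) (old c)) =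
      (stretchPath hA p).comp (stretchPath hA q) := by
  induction q with
  | nil => rfl
  | cons q α ih =>
    rw [Quiver.Path.comp_cons, stretchPath, stretchPath, ih, Quiver.Path.comp_assoc]

end StretchedVertex

section Stretched

variable {K : Type w} [Field K] {V : Type u} [Quiver.{v} V] {A : ℕ}

/-- The linear map underlying `θ*`. -/
noncomputable def thetaLinear (hA : 1 ≤ A) :
    PathAlgebra K V →ₗ[K] PathAlgebra K (StretchedVertex V A) :=
  PathAlgebra.liftPath K fun p => PathAlgebra.ofPath K (StretchedVertex.stretchPath hA p.2.2)

theorem thetaLinear_ofPath (hA : 1 ≤ A) {a b : V} (p : Quiver.Path a b) :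
    thetaLinear hA (PathAlgebra.ofPath K p) =
      PathAlgebra.ofPath K (StretchedVertex.stretchPath (A := A) hA p) := by
  rw [thetaLinear, PathAlgebra.liftPath_ofPath]

theorem thetaLinear_mul (hA : 1 ≤ A) (x y : PathAlgebra K V) :
    thetaLinear hA (x * y) =
      (thetaLinear hA x * thetaLinear hA y : PathAlgebra K (StretchedVertex V A)) := by
  induction x using PathAlgebra.induction_on with
  | zero => simp
  | add x x' hx hx' => simp only [add_mul, map_add, hx, hx']
  | smul k a b p =>
    simp only [PathAlgebra.smul_mul, map_smul]
    congr 1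
    induction y using PathAlgebra.induction_on with
    | zero => simp
    | add y y' hy hy' => simp only [mul_add, map_add, hy, hy']
    | smul k c d q =>
      simp only [PathAlgebra.mul_smul, map_smul]
      congr 1
      by_cases h : c = b
      · subst h
        simp only [PathAlgebra.ofPath_mul_comp, thetaLinear_ofPath,
          StretchedVertex.stretchPath_comp]
      · have h' : (StretchedVertex.old c : StretchedVertex V A) ≠ StretchedVertex.old b :=
          fun e => h (Sum.inl.inj e)
        simp only [thetaLinear_ofPath, PathAlgebra.ofPath_mul_of_ne _ _ h,
          PathAlgebra.ofPath_mul_of_ne _ _ h', map_zero]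

/-- The `K`-algebra homomorphism `θ* : K𝒬 → K𝒬̃` (which need not preserve the identity) with
`v ↦ v` for each vertex `v` and `α ↦ α₁ α₂ ⋯ α_A` for each arrow `α`. -/
noncomputable def theta (hA : 1 ≤ A) :
    PathAlgebra K V →ₙₐ[K] PathAlgebra K (StretchedVertex V A) where
  toFun := thetaLinear hA
  map_smul' := map_smul (thetaLinear hA)
  map_zero' := map_zero (thetaLinear hA)
  map_add' := map_add (thetaLinear hA)
  map_mul' := thetaLinear_mul hA

/-- The ideal `Ĩ` of the path algebra of the stretched quiver generated by `θ*(g)`; the stretched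
algebra of `K𝒬/⟨g⟩` is `K𝒬̃/Ĩ`. -/
noncomputable def stretchedIdeal [Fintype V] [∀ a b : V, Fintype (a ⟶ b)] (hA : 1 ≤ A)
    (g : Set (PathAlgebra K V)) : TwoSidedIdeal (PathAlgebra K (StretchedVertex V A)) :=
  TwoSidedIdeal.span (theta hA '' g)

end Stretched

/-! Write R for the original algebra, S for the stretched one, and e for the sum of the old vertices
in S. The map `theta` identifies R with the corner eSe. Every path of the stretched quiver starting
at an old vertex is, uniquely, a stretched path followed by an incomplete stretched arrow. So eS is
the direct sum, over all vertices v, of pieces R·(base of v)·τ_v, where τ_v is the path `tail`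
leading to v inside its stretched arrow. In particular eS is projective as a left R-module, and the
functor F sending M to M ⊗ eS is exact. It sends R to eS, a direct summand of S, so it preserves
finitely generated projectives. A generator of degree k becomes one of degree A·k, and τ_v adds its
length, which is less than A.

The tensor product is avoided. Right multiplication on eS is recorded by a matrix representation Φ
of S over R (`pathRep`, `quotRep`), and F(M) is the module `RowModule` of rows over M fixed by the
idempotent matrix Φ(1). What is needed of Φ is axiomatized in `CornerData` and `IsGradedCorner`.

Applying F to a minimal resolution P of R/rad does not give a resolution of S/rad: F(P 0) = eS
misses the new vertices, and P 1, the cover of rad R by arrows, becomes a module generated in degree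
A instead of 1. These two terms are therefore replaced by S and its own `arrowModule`, while all
higher terms are F(P n). By `exists_presentation` the resolution P may be assumed to end in the
standard cover of rad R. The comparison map `stretchArrow` from F(`arrowModule I`) to the arrow
module of S divides θ*(α)·x by the initial arrow of the path replacing α. Two facts make the glued
complex exact: `stretchArrow` is injective, and every relation among the arrows of S comes from a
relation among the arrows of R (`exists_stretchArrow_eq`). Both rest on `leftDiv_mem_ideal`:
generators of the stretched ideal start at old vertices, so an arrow leaving a new vertex can be
cancelled from the left modulo this ideal.

For n ≥ 2 the n-th term is generated in degree A times the Koszul degree, which is δ(n) for D = dA;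
the first two terms are generated in degrees 0 and 1. These degrees increase strictly because d ≥ 2,
so each differential sends generators to degrees above those of the generators of its target, hence
into the radical. This gives minimality. -/

open MulOpposite

/-! ### Graded abelian groups and modules -/

/-- The maps `p i` are the projections onto the pieces of a grading indexed by `ℕ`. -/
structure IsGradingProj {M : Type*} [AddCommGroup M] (g : ℕ → AddSubgroup M)
    (p : ℕ → M →+ M) : Prop where
  mem : ∀ i x, p i x ∈ g i
  same : ∀ i, ∀ x ∈ g i, p i x = x
  ne : ∀ i j, i ≠ j → ∀ x ∈ g i, p j x = 0
  sum : ∀ x, ∃ N, ∀ n, N ≤ n → ∑ i ∈ Finset.range n, p i x = x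

/-- The projections read off the components of a finite sum, which gives injectivity; the condition
`sum` gives surjectivity. All gradings below are shown to be internal through this criterion. -/
theorem IsGradingProj.isInternal {M : Type*} [AddCommGroup M] {g : ℕ → AddSubgroup M}
    {p : ℕ → M →+ M} (h : IsGradingProj g p) : DirectSum.IsInternal g := by
  have key : ∀ (f : DirectSum ℕ fun i => g i) (i : ℕ),
      p i (DirectSum.coeAddMonoidHom g f) = f i := by
    intro f i
    induction f using DirectSum.induction_on with
    | zero => simp
    | of j x =>
      rw [DirectSum.coeAddMonoidHom_of]
      by_cases hij : j = i
      · subst hij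
        rw [DirectSum.of_eq_same, h.same _ _ x.2]
      · rw [DirectSum.of_eq_of_ne _ _ _ (Ne.symm hij), h.ne _ _ hij _ x.2]
        rfl
    | add x y hx hy => rw [map_add, map_add, hx, hy, DirectSum.add_apply, AddSubgroup.coe_add]
  refine ⟨fun a b hab => ?_, fun x => ?_⟩
  · ext i
    rw [← key a, ← key b, hab]
  · obtain ⟨N, hN⟩ := h.sum x
    refine ⟨∑ i ∈ Finset.range N, DirectSum.of (fun i => g i) i ⟨p i x, h.mem i x⟩, ?_⟩
    rw [map_sum]
    simpa only [DirectSum.coeAddMonoidHom_of] using hN N le_rfl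

theorem DirectSum.IsInternal.exists_isGradingProj {M : Type*} [AddCommGroup M]
    {g : ℕ → AddSubgroup M} (h : DirectSum.IsInternal g) : ∃ p, IsGradingProj g p := by
  classical
  let _ := h.chooseDecomposition
  refine ⟨fun i => (g i).subtype.comp ((DFinsupp.evalAddMonoidHom i).comp
    (DirectSum.decomposeAddEquiv g).toAddMonoidHom), ⟨fun i x => ?_, fun i x hx => ?_,
    fun i j hij x hx => ?_, fun x => ?_⟩⟩
  · exact Subtype.prop _
  · exact DirectSum.decompose_of_mem_same g hx
  · exact DirectSum.decompose_of_mem_ne g hx hij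
  · refine ⟨(DirectSum.decompose g x).support.sup id + 1, fun n hn => ?_⟩
    conv_rhs => rw [← DirectSum.sum_support_decompose g x]
    symm
    refine Finset.sum_subset (fun i hi => ?_) (fun i _ hi => ?_)
    · have := Finset.le_sup (f := id) hi
      simp only [id_eq] at this
      rw [Finset.mem_range]; omega
    · rw [DFinsupp.notMem_support_iff] at hi
      rw [hi]; rfl

/-- Since σ is injective, only the component of degree i can contribute in degree σ(i). It is used
for degree preserving maps and for multiplication by a homogeneous element. -/
theorem IsGradingProj.map_proj {M N : Type*} [AddCommGroup M] [AddCommGroup N]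
    {g : ℕ → AddSubgroup M} {p : ℕ → M →+ M} (hp : IsGradingProj g p)
    {g' : ℕ → AddSubgroup N} {q : ℕ → N →+ N} (hq : IsGradingProj g' q)
    (f : M →+ N) (σ : ℕ → ℕ) (hσ : Function.Injective σ)
    (hf : ∀ i, ∀ x ∈ g i, f x ∈ g' (σ i)) (i : ℕ) (x : M) :
    q (σ i) (f x) = f (p i x) := by
  obtain ⟨N, hN⟩ := hp.sum x
  have h := hN (N + i + 1) (by omega)
  conv_lhs => rw [← h]
  rw [map_sum, map_sum, Finset.sum_eq_single i]
  · exact hq.same _ _ (hf _ _ (hp.mem _ _))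
  · intro j _ hj
    exact hq.ne _ _ (fun e => hj (hσ e)) _ (hf _ _ (hp.mem _ _))
  · intro hi
    exact absurd (Finset.mem_range.2 (by omega)) hi

/-- An isomorphism that respects degrees has an inverse that respects degrees; this is what the
lemma is for. -/
theorem IsGradingProj.inverse_mem {M N : Type*} [AddCommGroup M] [AddCommGroup N]
    {g : ℕ → AddSubgroup M} {p : ℕ → M →+ M} (hp : IsGradingProj g p)
    {g' : ℕ → AddSubgroup N} {q : ℕ → N →+ N} (hq : IsGradingProj g' q)
    (f : M →+ N) (hf : ∀ i, ∀ x ∈ g i, f x ∈ g' i) (inj : Function.Injective f) (i : ℕ) (x : M)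
    (hx : f x ∈ g' i) : x ∈ g i := by
  have h := hp.map_proj hq f id Function.injective_id hf i x
  rw [id, hq.same _ _ hx] at h
  rw [inj h]
  exact hp.mem _ _

/-- A right ring action is determined by homogeneous elements in the following sense: the
projection of `x r` for homogeneous `r`. -/
theorem IsGradingProj.proj_op_smul {R M : Type*} [Ring R] [AddCommGroup M] [Module Rᵐᵒᵖ M]
    {g : ℕ → AddSubgroup M} {p : ℕ → M →+ M} (hp : IsGradingProj g p) {𝒜 : ℕ → AddSubgroup R}
    (smul_mem : ∀ (i j : ℕ) (x : M) (r : R), x ∈ g i → r ∈ 𝒜 j → MulOpposite.op r • x ∈ g (i + j))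
    {j : ℕ} {r : R} (hr : r ∈ 𝒜 j) (i : ℕ) (x : M) :
    p (i + j) (MulOpposite.op r • x) = MulOpposite.op r • p i x :=
  hp.map_proj hp (DistribSMul.toAddMonoidHom M (MulOpposite.op r)) (· + j)
    (add_left_injective j) (fun i x hx => smul_mem i j x r hx hr) i x

/-- In a graded module generated in degree `m` the elements of degree `i` are sums of products
of elements of degree `m` with ring elements of degree `i - m`. -/
theorem mem_closure_of_generated {R M : Type*} [Ring R] [AddCommGroup M] [Module Rᵐᵒᵖ M]
    {g : ℕ → AddSubgroup M} {p : ℕ → M →+ M} (hp : IsGradingProj g p) {𝒜 : ℕ → AddSubgroup R}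
    {q : ℕ → R →+ R} (hq : IsGradingProj 𝒜 q)
    (smul_mem : ∀ (i j : ℕ) (x : M) (r : R), x ∈ g i → r ∈ 𝒜 j → MulOpposite.op r • x ∈ g (i + j))
    {m : ℕ} (gen : Submodule.span Rᵐᵒᵖ (g m : Set M) = ⊤) {i : ℕ} {x : M} (hx : x ∈ g i) :
    x ∈ AddSubgroup.closure
      {z | ∃ j, m + j = i ∧ ∃ r ∈ 𝒜 j, ∃ y ∈ g m, z = MulOpposite.op r • y} := by
  -- The generalization to all multiples of x is what lets the induction over the span pass through
  -- scalar multiplication, since the scalars there need not be homogeneous.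
  suffices H : ∀ (x : M) (r : R), p i (MulOpposite.op r • x) ∈ AddSubgroup.closure
      {z | ∃ j, m + j = i ∧ ∃ r ∈ 𝒜 j, ∃ y ∈ g m, z = MulOpposite.op r • y} by
    have := H x 1
    rwa [MulOpposite.op_one, one_smul, hp.same _ _ hx] at this
  intro x
  have hx : x ∈ Submodule.span Rᵐᵒᵖ (g m : Set M) := gen ▸ Submodule.mem_top
  induction hx using Submodule.span_induction with
  | mem y hy =>
    intro r
    obtain ⟨N, hN⟩ := hq.sum r
    rw [← hN N le_rfl, Finset.op_sum, Finset.sum_smul, map_sum]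
    refine AddSubgroup.sum_mem _ fun k _ => ?_
    have hk := smul_mem m k y (q k r) hy (hq.mem _ _)
    by_cases h : m + k = i
    · rw [← h, hp.same _ _ hk]
      exact AddSubgroup.subset_closure ⟨k, rfl, q k r, hq.mem _ _, y, hy, rfl⟩
    · rw [hp.ne _ _ h _ hk]
      exact zero_mem _
  | zero => intro r; rw [smul_zero, map_zero]; exact zero_mem _
  | add x y _ _ hx hy => intro r; rw [smul_add, map_add]; exact add_mem (hx r) (hy r)
  | smul a x _ hx =>
    intro r
    obtain ⟨a, rfl⟩ := MulOpposite.op_surjective a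
    rw [smul_smul, ← MulOpposite.op_mul]
    exact hx _

/-! ### Nakayama-type lemmas -/

/-- The map r ↦ x·r is a homomorphism of right modules, and homomorphisms send radicals into
radicals. -/
theorem op_smul_mem_jacobson {R M : Type*} [Ring R] [AddCommGroup M] [Module Rᵐᵒᵖ M] {r : R}
    (hr : r ∈ Module.jacobson Rᵐᵒᵖ R) (x : M) :
    MulOpposite.op r • x ∈ Module.jacobson Rᵐᵒᵖ M := by
  let f : R →ₗ[Rᵐᵒᵖ] M :=
    { toFun := fun r => MulOpposite.op r • x
      map_add' := fun a b => by rw [MulOpposite.op_add, add_smul]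
      map_smul' := fun a b => by
        rw [RingHom.id_apply, smul_smul]
        rfl }
  exact Module.le_comap_jacobson f hr

/-- Such an element is a sum of generators times ring elements of positive degree i - m, which lie
in the radical. This is the criterion used for minimality. -/
theorem mem_jacobson_of_generated {R M : Type*} [Ring R] [AddCommGroup M] [Module Rᵐᵒᵖ M]
    {g : ℕ → AddSubgroup M} (hg : DirectSum.IsInternal g) {𝒜 : ℕ → AddSubgroup R}
    (h𝒜 : DirectSum.IsInternal 𝒜)
    (smul_mem : ∀ (i j : ℕ) (x : M) (r : R), x ∈ g i → r ∈ 𝒜 j → MulOpposite.op r • x ∈ g (i + j))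
    (hjac : ∀ j, 0 < j → ∀ r ∈ 𝒜 j, r ∈ Module.jacobson Rᵐᵒᵖ R)
    {m : ℕ} (gen : Submodule.span Rᵐᵒᵖ (g m : Set M) = ⊤) {i : ℕ} (hi : m < i) {x : M}
    (hx : x ∈ g i) : x ∈ Module.jacobson Rᵐᵒᵖ M := by
  obtain ⟨p, hp⟩ := hg.exists_isGradingProj
  obtain ⟨q, hq⟩ := h𝒜.exists_isGradingProj
  have h := mem_closure_of_generated hp hq smul_mem gen hx
  clear hx
  induction h using AddSubgroup.closure_induction with
  | mem z hz =>
    obtain ⟨j, hj, r, hr, y, -, rfl⟩ := hz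
    exact op_smul_mem_jacobson (hjac j (by omega) r hr) y
  | zero => exact zero_mem _
  | add x y _ _ hx hy => exact add_mem hx hy
  | neg x _ hx => exact neg_mem hx

/-- Nakayama's lemma for the radical defined by maximal submodules: a proper submodule of a finitely
generated module lies in a maximal one, which also contains the radical. -/
theorem eq_top_of_sup_jacobson {R M : Type*} [Ring R] [AddCommGroup M] [Module R M]
    [Module.Finite R M] (N : Submodule R M) (h : N ⊔ Module.jacobson R M = ⊤) : N = ⊤ := by
  by_contra hN
  obtain ⟨m, hm, hle⟩ := (eq_top_or_exists_le_coatom N).resolve_left hN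
  have : Module.jacobson R M ≤ m := sInf_le hm
  exact hm.1 (top_le_iff.1 (h ▸ sup_le hle this))

theorem surjective_of_sup_jacobson {R M N : Type*} [Ring R] [AddCommGroup M] [Module R M]
    [AddCommGroup N] [Module R N] [Module.Finite R N] (f : M →ₗ[R] N)
    (h : ∀ x, ∃ y, x - f y ∈ Module.jacobson R N) : Function.Surjective f := by
  rw [← LinearMap.range_eq_top]
  refine eq_top_of_sup_jacobson _ (top_le_iff.1 fun x _ => ?_)
  obtain ⟨y, hy⟩ := h x
  have : x = f y + (x - f y) := by abel
  rw [this]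
  exact add_mem (Submodule.mem_sup_left ⟨y, rfl⟩) (Submodule.mem_sup_right hy)

/-- A surjection onto a projective module whose kernel lies in the radical is injective. -/
theorem injective_of_ker_le_jacobson {R M N : Type*} [Ring R] [AddCommGroup M] [Module R M]
    [AddCommGroup N] [Module R N] [Module.Finite R M] [Module.Projective R N] (f : M →ₗ[R] N)
    (surj : Function.Surjective f) (h : ∀ x, f x = 0 → x ∈ Module.jacobson R M) :
    Function.Injective f := by
  obtain ⟨s, hs⟩ := Module.projective_lifting_property f LinearMap.id surj
  have hs' : ∀ y, f (s y) = y := fun y => LinearMap.congr_fun hs y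
  -- A section s of f hits everything modulo the kernel of f, hence modulo the radical, so s is onto
  -- and f is its inverse.
  have : Function.Surjective s := surjective_of_sup_jacobson s fun x =>
    ⟨f x, h _ (by rw [map_sub, hs', sub_self])⟩
  rw [injective_iff_map_eq_zero]
  intro x hx
  obtain ⟨y, rfl⟩ := this x
  rw [hs'] at hx
  rw [hx, map_zero]

/-! ### Row vectors over a right module -/

section RowVector

variable {R : Type*} [Ring R] {W : Type*} [Fintype W] {M : Type*} [AddCommGroup M] [Module Rᵐᵒᵖ M]

/-- The right action of matrices over `R` on row vectors with entries in a right `R`-module. -/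
def rowMul (f : W → M) (X : Matrix W W R) : W → M := fun v => ∑ u, op (X u v) • f u

theorem rowMul_rowMul (f : W → M) (X Y : Matrix W W R) :
    rowMul (rowMul f X) Y = rowMul f (X * Y) := by
  funext v
  simp only [rowMul, Matrix.mul_apply, Finset.smul_sum, Finset.op_sum, Finset.sum_smul, smul_smul,
    op_mul]
  exact Finset.sum_comm

theorem rowMul_add (f : W → M) (X Y : Matrix W W R) :
    rowMul f (X + Y) = rowMul f X + rowMul f Y := by
  funext v
  simp [rowMul, add_smul, Finset.sum_add_distrib]

theorem add_rowMul (f g : W → M) (X : Matrix W W R) :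
    rowMul (f + g) X = rowMul f X + rowMul g X := by
  funext v
  simp [rowMul, smul_add, Finset.sum_add_distrib]

theorem rowMul_zero (f : W → M) : rowMul f (0 : Matrix W W R) = 0 := by
  funext v
  simp [rowMul]

theorem zero_rowMul (X : Matrix W W R) : rowMul (0 : W → M) X = 0 := by
  funext v
  simp [rowMul]

theorem neg_rowMul (f : W → M) (X : Matrix W W R) : rowMul (-f) X = -rowMul f X := by
  funext v
  simp [rowMul]

theorem map_rowMul {N : Type*} [AddCommGroup N] [Module Rᵐᵒᵖ N] (h : M →ₗ[Rᵐᵒᵖ] N) (f : W → M)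
    (X : Matrix W W R) (v : W) : h (rowMul f X v) = rowMul (fun u => h (f u)) X v := by
  simp [rowMul]

end RowVector

/-! ### The functor on right modules given by a matrix representation -/

/-- For a homomorphism `Φ` from `S` to matrices over `R` which need not preserve the identity, and
a right `R`-module `M`, the right `S`-module of row vectors over `M` fixed by `Φ 1`. -/
def RowModule {R S W : Type*} [Ring R] [Ring S] [Fintype W] (Φ : S →ₙ+* Matrix W W R)
    (M : Type*) [AddCommGroup M] [Module Rᵐᵒᵖ M] : AddSubgroup (W → M) where
  carrier := {f | rowMul f (Φ 1) = f}
  zero_mem' := zero_rowMul _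
  add_mem' {f g} hf hg := by
    rw [Set.mem_ofPred_eq] at *
    rw [add_rowMul, hf, hg]
  neg_mem' {f} hf := by
    rw [Set.mem_ofPred_eq] at *
    rw [neg_rowMul, hf]

namespace RowModule

variable {R S W : Type*} [Ring R] [Ring S] [Fintype W] {Φ : S →ₙ+* Matrix W W R}
  {M : Type*} [AddCommGroup M] [Module Rᵐᵒᵖ M] {N : Type*} [AddCommGroup N] [Module Rᵐᵒᵖ N]
  {L : Type*} [AddCommGroup L] [Module Rᵐᵒᵖ L]

theorem rowMul_mem (f : W → M) (x : S) : rowMul f (Φ x) ∈ RowModule Φ M := by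
  change rowMul _ _ = _
  rw [rowMul_rowMul, ← map_mul, mul_one]

instance : Module Sᵐᵒᵖ (RowModule Φ M) where
  smul x f := ⟨rowMul f.1 (Φ x.unop), rowMul_mem _ _⟩
  one_smul f := Subtype.ext f.2
  mul_smul x y f := Subtype.ext (by
    change rowMul _ _ = rowMul (rowMul _ _) _
    rw [rowMul_rowMul, ← map_mul, unop_mul])
  smul_zero x := Subtype.ext (zero_rowMul _)
  smul_add x f g := Subtype.ext (add_rowMul _ _ _)
  add_smul x y f := Subtype.ext (by
    change rowMul _ _ = _
    rw [unop_add, map_add, rowMul_add]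
    rfl)
  zero_smul f := Subtype.ext (by
    change rowMul _ _ = _
    rw [unop_zero, map_zero, rowMul_zero]
    rfl)

theorem coe_op_smul (x : S) (f : RowModule Φ M) : (op x • f).1 = rowMul f.1 (Φ x) := rfl

variable (Φ) in
/-- The functor on morphisms. -/
def map (h : M →ₗ[Rᵐᵒᵖ] N) : RowModule Φ M →ₗ[Sᵐᵒᵖ] RowModule Φ N where
  toFun f := ⟨fun v => h (f.1 v), by
    change rowMul _ _ = _
    funext v
    rw [← map_rowMul]
    exact congrArg h (congrFun f.2 v)⟩
  map_add' f g := Subtype.ext (funext fun v => map_add h _ _)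
  map_smul' x f := Subtype.ext (funext fun v => map_rowMul h _ _ _)

theorem map_apply (h : M →ₗ[Rᵐᵒᵖ] N) (f : RowModule Φ M) (v : W) :
    (map Φ h f).1 v = h (f.1 v) := rfl

/-- Entrywise preimages need not form a fixed row. Multiplying them by the idempotent Φ(1) corrects
this without changing their image, which is fixed already. -/
theorem exists_map_eq {h : M →ₗ[Rᵐᵒᵖ] N} (f : RowModule Φ N) (hf : ∀ v, ∃ m, h m = f.1 v) :
    ∃ m, map Φ h m = f := by
  choose m hm using hf
  refine ⟨⟨rowMul m (Φ 1), rowMul_mem _ _⟩, Subtype.ext (funext fun v => ?_)⟩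
  rw [map_apply, map_rowMul]
  simp only [hm]
  exact congrFun f.2 v

theorem map_exact {h : M →ₗ[Rᵐᵒᵖ] N} {k : N →ₗ[Rᵐᵒᵖ] L} (ex : Function.Exact h k) :
    Function.Exact (map Φ h) (map Φ k) := by
  intro f
  refine ⟨fun hf => exists_map_eq f fun v => (ex _).1 ?_, ?_⟩
  · exact congrFun (congrArg Subtype.val hf) v
  · rintro ⟨m, rfl⟩
    exact Subtype.ext (funext fun v => ex.apply_apply_eq_zero _)

end RowModule

/-! ### Corners: the functor F preserves finitely generated projective modules. -/

/-- `R` as a right module over itself, in its two guises. -/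
def opLinearEquiv' (R : Type*) [Ring R] : Rᵐᵒᵖ ≃ₗ[Rᵐᵒᵖ] R where
  toFun := unop
  invFun := op
  map_add' _ _ := rfl
  map_smul' _ _ := rfl
  left_inv _ := rfl
  right_inv _ := rfl

instance finite_right_self (R : Type*) [Ring R] : Module.Finite Rᵐᵒᵖ R :=
  Module.Finite.equiv (opLinearEquiv' R)

instance projective_right_self (R : Type*) [Ring R] : Module.Projective Rᵐᵒᵖ R :=
  Module.Projective.of_equiv (opLinearEquiv' R)

instance projective_pi_right_self (R : Type*) [Ring R] (n : Type*) [Fintype n] :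
    Module.Projective Rᵐᵒᵖ (n → R) :=
  Module.Projective.of_equiv (LinearEquiv.piCongrRight fun _ : n => opLinearEquiv' R)

/-- A matrix representation `Φ` of `S` over `R`, together with an embedding `θ` of `R` as a
corner `e S e`, such that `M ↦ RowModule Φ M` is the functor `M ↦ M ⊗ e S`. -/
structure CornerData (R S W : Type*) [Ring R] [Ring S] [Fintype W] where
  Φ : S →ₙ+* Matrix W W R
  θ : R →ₙ+* S
  τ : W → S
  κ : W → R
  -- The τ v generate eS over R, and Φ x is the matrix of right multiplication by x on them. The row
  -- κ represents e itself: in the application κ v is the vertex v if v is old and 0 if v is new,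
  -- and the remaining fields say how Φ acts on this row.
  sum_theta_mul : ∀ x u, ∑ v, θ (Φ x u v) * τ v = τ u * x
  rep_theta : ∀ r u v, Φ (θ r) u v = κ u * r * κ v
  sum_rep_tau : ∀ v w, ∑ u, κ u * Φ (τ v) u w = Φ 1 v w
  sum_sq : ∑ u, κ u * κ u = 1
  rep_one : ∀ v, ∑ u, κ u * Φ 1 u v = κ v

namespace CornerData

variable {R S W : Type*} [Ring R] [Ring S] [Fintype W] (C : CornerData R S W)
  {M : Type*} [AddCommGroup M] [Module Rᵐᵒᵖ M] {N : Type*} [AddCommGroup N] [Module Rᵐᵒᵖ N]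

/-- The embedding of `M` in its image under the functor. -/
def incl (y : M) : RowModule C.Φ M :=
  ⟨fun v => op (C.κ v) • y, by
    change rowMul _ _ = _
    funext v
    rw [rowMul]
    simp only [smul_smul, ← op_mul]
    rw [← Finset.sum_smul, ← Finset.op_sum, C.rep_one]⟩

theorem incl_apply (y : M) (v : W) : (C.incl y).1 v = op (C.κ v) • y := rfl

theorem op_theta_smul_incl (r : R) (y : M) : op (C.θ r) • C.incl y = C.incl (op r • y) := by
  apply Subtype.ext
  rw [RowModule.coe_op_smul]
  funext v
  rw [rowMul]
  simp only [incl_apply, smul_smul, ← op_mul, C.rep_theta]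
  rw [← Finset.sum_smul, ← Finset.op_sum]
  simp only [← mul_assoc]
  rw [← Finset.sum_mul, ← Finset.sum_mul, C.sum_sq, one_mul]

theorem op_tau_smul_incl (v : W) (y : M) (w : W) :
    (op (C.τ v) • C.incl y).1 w = op (C.Φ 1 v w) • y := by
  rw [RowModule.coe_op_smul, rowMul]
  simp only [incl_apply, smul_smul, ← op_mul]
  rw [← Finset.sum_smul, ← Finset.op_sum, C.sum_rep_tau]

theorem coe_sum {ι : Type*} (s : Finset ι) (f : ι → RowModule C.Φ M) (w : W) :
    (∑ v ∈ s, f v).1 w = ∑ v ∈ s, (f v).1 w := by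
  rw [AddSubgroup.val_finsetSum, Finset.sum_apply]

/-- The decomposition of M ⊗ eS: the entry of a row at v is the coefficient of τ v. Hence the
elements y ⊗ e, given by `incl`, generate the module. -/
theorem sum_tau_smul_incl (f : RowModule C.Φ M) : ∑ v, op (C.τ v) • C.incl (f.1 v) = f := by
  apply Subtype.ext
  funext w
  rw [coe_sum]
  simp only [op_tau_smul_incl]
  exact congrFun f.2 w

/-- The isomorphism of the image of `R` with `e S`. -/
def toRing : RowModule C.Φ R →ₗ[Sᵐᵒᵖ] S where
  toFun f := ∑ v, C.θ (f.1 v) * C.τ v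
  map_add' f g := by
    simp only [AddSubgroup.coe_add, Pi.add_apply, map_add, add_mul, Finset.sum_add_distrib]
  map_smul' x f := by
    obtain ⟨x, rfl⟩ := op_surjective x
    rw [RowModule.coe_op_smul, RingHom.id_apply, op_smul_eq_mul, Finset.sum_mul]
    simp only [rowMul, op_smul_eq_mul, map_sum, map_mul, Finset.sum_mul, mul_assoc]
    rw [Finset.sum_comm]
    refine Finset.sum_congr rfl fun u _ => ?_
    rw [← Finset.mul_sum, C.sum_theta_mul]

theorem toRing_apply (f : RowModule C.Φ R) : C.toRing f = ∑ v, C.θ (f.1 v) * C.τ v := rfl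

/-- So `ofRing`, the map x ↦ e·x, is a left inverse of `toRing`. Hence F(R) is a direct summand of
S, and `toRing` is injective. -/
theorem toRing_smul_incl_one (f : RowModule C.Φ R) : op (C.toRing f) • C.incl (1 : R) = f := by
  conv_rhs => rw [← C.sum_tau_smul_incl f]
  rw [toRing_apply, Finset.op_sum, Finset.sum_smul]
  refine Finset.sum_congr rfl fun v _ => ?_
  rw [op_mul, mul_smul, op_theta_smul_incl, op_smul_eq_mul, one_mul]

/-- The retraction of `toRing`. -/
def ofRing : S →ₗ[Sᵐᵒᵖ] RowModule C.Φ R where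
  toFun x := op x • C.incl (1 : R)
  map_add' x y := by rw [op_add, add_smul]
  map_smul' x y := by
    rw [RingHom.id_apply, smul_smul]
    rfl

/-- M is a summand of a finite free module over R, and F(R) is a summand of S; applying F to the
first splitting and composing gives the second. -/
theorem exists_retract [Module.Finite Rᵐᵒᵖ M] [Module.Projective Rᵐᵒᵖ M] :
    ∃ (n : ℕ) (f : RowModule C.Φ M →ₗ[Sᵐᵒᵖ] (Fin n → S))
      (g : (Fin n → S) →ₗ[Sᵐᵒᵖ] RowModule C.Φ M), g ∘ₗ f = LinearMap.id := by
  obtain ⟨n, q, s, -, -, hqs⟩ := Module.Finite.exists_comp_eq_id_of_projective Rᵐᵒᵖ M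
  have hqs' : ∀ m, q (s m) = m := fun m => LinearMap.congr_fun hqs m
  refine ⟨n, LinearMap.pi fun k =>
      C.toRing ∘ₗ RowModule.map C.Φ ((opLinearEquiv' R).toLinearMap ∘ₗ LinearMap.proj k ∘ₗ s),
    ∑ k : Fin n, RowModule.map C.Φ (q ∘ₗ LinearMap.single Rᵐᵒᵖ (fun _ => Rᵐᵒᵖ) k ∘ₗ
      (opLinearEquiv' R).symm.toLinearMap) ∘ₗ
      C.ofRing ∘ₗ LinearMap.proj k, ?_⟩
  ext1 f
  have h1 : ∀ x : RowModule C.Φ R, C.ofRing (C.toRing x) = x := C.toRing_smul_incl_one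
  simp only [LinearMap.comp_apply, LinearMap.sum_apply, LinearMap.pi_apply, LinearMap.proj_apply,
    h1, LinearMap.id_apply]
  apply Subtype.ext
  funext v
  rw [coe_sum]
  simp only [RowModule.map_apply, LinearMap.comp_apply, LinearMap.proj_apply,
    LinearEquiv.coe_coe, LinearEquiv.symm_apply_apply]
  rw [← map_sum]
  simp only [LinearMap.coe_single]
  rw [Finset.univ_sum_single]
  exact hqs' _

theorem finite_row [Module.Finite Rᵐᵒᵖ M] [Module.Projective Rᵐᵒᵖ M] :
    Module.Finite Sᵐᵒᵖ (RowModule C.Φ M) := by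
  obtain ⟨n, f, g, h⟩ := C.exists_retract (M := M)
  exact Module.Finite.of_surjective g fun x => ⟨f x, LinearMap.congr_fun h x⟩

theorem projective_row [Module.Finite Rᵐᵒᵖ M] [Module.Projective Rᵐᵒᵖ M] :
    Module.Projective Sᵐᵒᵖ (RowModule C.Φ M) := by
  obtain ⟨n, f, g, h⟩ := C.exists_retract (M := M)
  exact Module.Projective.of_split f g h

end CornerData

/-! ### The grading -/

/-- Compatibility of `C` with gradings of `R` and `S` when degrees are multiplied by `A`. -/
structure IsGradedCorner {R S W : Type*} [Ring R] [Ring S] [Fintype W] (C : CornerData R S W)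
    (𝒜 : ℕ → AddSubgroup R) (ℬ : ℕ → AddSubgroup S) (A : ℕ) (len : W → ℕ) : Prop where
  len_lt : ∀ v, len v < A
  -- Comparison of degrees in τ_u·x = Σ θ(Φ(x)_{uv})·τ_v, where θ multiplies degrees by A and τ_v
  -- has degree `len v`. By `len_lt` the pair (k, `len v`) is quotient and remainder of the total
  -- degree on division by A.
  rep : ∀ j, ∀ x ∈ ℬ j, ∀ u v, (∃ k, A * k + len v = len u + j ∧ C.Φ x u v ∈ 𝒜 k) ∨ C.Φ x u v = 0
  theta : ∀ k, ∀ r ∈ 𝒜 k, C.θ r ∈ ℬ (A * k)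
  tau : ∀ v, C.τ v ∈ ℬ (len v)
  kappa : ∀ v, C.κ v ∈ 𝒜 0
  kappa_ne : ∀ v, len v ≠ 0 → C.κ v = 0

namespace CornerData

variable {R S W : Type*} [Ring R] [Ring S] [Fintype W] (C : CornerData R S W)
  {M : Type*} [AddCommGroup M] [Module Rᵐᵒᵖ M] {N : Type*} [AddCommGroup N] [Module Rᵐᵒᵖ N]

/-- The pieces of the grading of row vectors. -/
def rowGrading (A : ℕ) (len : W → ℕ) (g : ℕ → AddSubgroup M) (i : ℕ) :
    AddSubgroup (RowModule C.Φ M) where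
  carrier := {f | ∀ v, f.1 v ∈ if i % A = len v then g (i / A) else ⊥}
  zero_mem' _ := zero_mem _
  add_mem' hf hg v := add_mem (hf v) (hg v)
  neg_mem' hf v := neg_mem (hf v)

variable {C} {𝒜 : ℕ → AddSubgroup R} {ℬ : ℕ → AddSubgroup S} {A : ℕ} {len : W → ℕ}
  {g : ℕ → AddSubgroup M}

theorem mod_div_of_add {k l i : ℕ} (hl : l < A) (h : A * k + l = i) : i % A = l ∧ i / A = k := by
  subst h
  exact ⟨by rw [Nat.mul_add_mod, Nat.mod_eq_of_lt hl],
    by rw [Nat.mul_add_div (by omega), Nat.div_eq_of_lt hl, add_zero]⟩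

theorem op_smul_mem_rowGrading (hC : IsGradedCorner C 𝒜 ℬ A len)
    (smul_mem : ∀ (i j : ℕ) (x : M) (r : R), x ∈ g i → r ∈ 𝒜 j → op r • x ∈ g (i + j))
    (i j : ℕ) (f : RowModule C.Φ M) (x : S) (hf : f ∈ C.rowGrading A len g i) (hx : x ∈ ℬ j) :
    op x • f ∈ C.rowGrading A len g (i + j) := by
  intro v
  refine AddSubgroup.sum_mem _ fun u _ => ?_
  change op (C.Φ x u v) • f.1 u ∈ _
  have hu := hf u
  split_ifs at hu with h
  · obtain ⟨k, hk, hr⟩ | h0 := hC.rep j x hx u v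
    · have e : A * (i / A + k) + len v = i + j := by
        have := Nat.div_add_mod i A
        rw [mul_add]; omega
      obtain ⟨e1, e2⟩ := mod_div_of_add (hC.len_lt v) e
      rw [if_pos e1, e2]
      exact smul_mem _ _ _ _ hu hr
    · rw [h0, op_zero, zero_smul]
      exact zero_mem _
  · rw [AddSubgroup.mem_bot.1 hu, smul_zero]
    exact zero_mem _

theorem map_mem_rowGrading {g' : ℕ → AddSubgroup N} (h : M →ₗ[Rᵐᵒᵖ] N)
    (hh : ∀ i, ∀ x ∈ g i, h x ∈ g' i) (i : ℕ) (f : RowModule C.Φ M)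
    (hf : f ∈ C.rowGrading A len g i) : RowModule.map C.Φ h f ∈ C.rowGrading A len g' i := by
  intro v
  have hv := hf v
  rw [RowModule.map_apply]
  split_ifs at hv ⊢ with e
  · exact hh _ _ hv
  · rw [AddSubgroup.mem_bot.1 hv, map_zero]
    exact zero_mem _

/-- Both lengths are less than A, so an equation A·k + len v = len u forces k = 0. Thus Φ(1)
preserves degrees and joins only positions of equal length. -/
theorem rep_one_apply (hC : IsGradedCorner C 𝒜 ℬ A len) (h1 : (1 : S) ∈ ℬ 0) (u v : W) :
    (C.Φ 1 u v ∈ 𝒜 0 ∧ len u = len v) ∨ C.Φ 1 u v = 0 := by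
  obtain ⟨k, hk, hr⟩ | h0 := hC.rep 0 1 h1 u v
  · have hu := hC.len_lt u
    rcases Nat.eq_zero_or_pos k with rfl | hk'
    · exact Or.inl ⟨hr, by omega⟩
    · have := Nat.le_mul_of_pos_right A hk'
      omega
  · exact Or.inr h0

/-- The projection to degree i projects the entries in positions of length i mod A to degree i / A
and kills the others. It keeps rows fixed by Φ(1), because the entries of Φ(1) have degree 0 and
respect lengths. -/
theorem isInternal_rowGrading (hC : IsGradedCorner C 𝒜 ℬ A len) (h1 : (1 : S) ∈ ℬ 0)
    (smul_mem : ∀ (i j : ℕ) (x : M) (r : R), x ∈ g i → r ∈ 𝒜 j → op r • x ∈ g (i + j))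
    (hg : DirectSum.IsInternal g) : DirectSum.IsInternal (C.rowGrading A len g) := by
  obtain ⟨p, hp⟩ := hg.exists_isGradingProj
  have hp0 : ∀ i, ∀ r ∈ 𝒜 0, ∀ x, p i (op r • x) = op r • p i x := fun i r hr x => by
    simpa using hp.proj_op_smul smul_mem hr i x
  let P : ℕ → RowModule C.Φ M →+ RowModule C.Φ M := fun i =>
    { toFun := fun f => ⟨fun v => if i % A = len v then p (i / A) (f.1 v) else 0, by
        change rowMul _ _ = _
        funext v
        have hv := congrFun f.2 v
        have e : (if i % A = len v then p (i / A) (f.1 v) else 0) =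
            ∑ u, if i % A = len v then p (i / A) (op (C.Φ 1 u v) • f.1 u) else 0 := by
          conv_lhs => rw [← hv, rowMul, map_sum]
          split_ifs <;> simp
        rw [e, rowMul]
        refine Finset.sum_congr rfl fun u _ => ?_
        obtain ⟨hr, e⟩ | h0 := rep_one_apply hC h1 u v
        · rw [hp0 _ _ hr, e]
          split_ifs <;> simp
        · simp [h0]⟩
      map_zero' := by
        apply Subtype.ext; funext v; simp
      map_add' := fun f f' => by
        apply Subtype.ext; funext v
        simp only [AddSubgroup.coe_add, Pi.add_apply, map_add]
        split_ifs <;> simp }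
  have hP : ∀ i f v, (P i f).1 v = if i % A = len v then p (i / A) (f.1 v) else 0 :=
    fun _ _ _ => rfl
  refine IsGradingProj.isInternal (p := P) ⟨fun i f v => ?_, fun i f hf => ?_,
    fun i j hij f hf => ?_, fun f => ?_⟩
  · rw [hP]
    split_ifs
    · exact hp.mem _ _
    · exact zero_mem _
  · apply Subtype.ext; funext v
    have hv := hf v
    rw [hP]
    split_ifs at hv ⊢
    · exact hp.same _ _ hv
    · exact (AddSubgroup.mem_bot.1 hv).symm
  · apply Subtype.ext; funext v
    have hv := hf v
    rw [hP]
    change _ = (0 : M)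
    split_ifs with e1
    · split_ifs at hv with e2
      · refine hp.ne _ _ (fun e => hij ?_) _ hv
        rw [← Nat.div_add_mod i A, ← Nat.div_add_mod j A, e, e1, e2]
      · rw [AddSubgroup.mem_bot.1 hv, map_zero]
    · rfl
  · choose N hN using fun v => hp.sum (f.1 v)
    refine ⟨A * (∑ v, N v), fun n hn => ?_⟩
    apply Subtype.ext; funext v
    rw [coe_sum]
    simp only [hP]
    rw [← Finset.sum_filter]
    have hv := hC.len_lt v
    have hNv : N v ≤ ∑ v, N v := Finset.single_le_sum (fun _ _ => Nat.zero_le _) (Finset.mem_univ v)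
    -- The number (n + (A - 1 - len v)) / A counts the k with A·k + len v < n, that is, the
    -- components of the entry at v that occur among the degrees below n.
    conv_rhs => rw [← hN v ((n + (A - 1 - len v)) / A) (by
      rw [Nat.le_div_iff_mul_le (by omega), mul_comm]
      have := Nat.mul_le_mul_left A hNv
      omega)]
    refine Finset.sum_bij' (fun i _ => i / A) (fun k _ => A * k + len v) ?_ ?_ ?_ ?_ ?_
    · intro i hi
      rw [Finset.mem_filter, Finset.mem_range] at hi
      rw [Finset.mem_range, Nat.lt_iff_add_one_le, Nat.le_div_iff_mul_le (by omega)]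
      have := Nat.div_add_mod i A
      rw [add_mul, mul_comm]
      omega
    · intro k hk
      rw [Finset.mem_range, Nat.lt_iff_add_one_le, Nat.le_div_iff_mul_le (by omega), add_mul,
        mul_comm] at hk
      rw [Finset.mem_filter, Finset.mem_range]
      exact ⟨by omega, (mod_div_of_add hv rfl).1⟩
    · intro i hi
      rw [Finset.mem_filter, Finset.mem_range] at hi
      have := Nat.div_add_mod i A
      omega
    · intro k hk
      exact (mod_div_of_add hv rfl).2
    · intro i hi
      rfl

theorem incl_mem_rowGrading (hC : IsGradedCorner C 𝒜 ℬ A len)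
    (smul_mem : ∀ (i j : ℕ) (x : M) (r : R), x ∈ g i → r ∈ 𝒜 j → op r • x ∈ g (i + j))
    {k : ℕ} {y : M} (hy : y ∈ g k) : C.incl y ∈ C.rowGrading A len g (A * k) := by
  intro v
  rw [incl_apply]
  have hA := hC.len_lt v
  rw [Nat.mul_mod_right, Nat.mul_div_cancel_left k (by omega)]
  split_ifs with e
  · exact smul_mem k 0 _ _ hy (hC.kappa v)
  · rw [hC.kappa_ne v (Ne.symm e), op_zero, zero_smul]
    exact zero_mem _

/-- The elements y ⊗ e generate, and e has degree 0; so y of degree m gives a generator of degree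
A·m. -/
theorem span_rowGrading (hC : IsGradedCorner C 𝒜 ℬ A len)
    (smul_mem : ∀ (i j : ℕ) (x : M) (r : R), x ∈ g i → r ∈ 𝒜 j → op r • x ∈ g (i + j))
    {m : ℕ} (gen : Submodule.span Rᵐᵒᵖ (g m : Set M) = ⊤) :
    Submodule.span Sᵐᵒᵖ (C.rowGrading A len g (A * m) : Set (RowModule C.Φ M)) = ⊤ := by
  have key : ∀ y : M, C.incl y ∈
      Submodule.span Sᵐᵒᵖ (C.rowGrading A len g (A * m) : Set (RowModule C.Φ M)) := by
    intro y
    have hy : y ∈ Submodule.span Rᵐᵒᵖ (g m : Set M) := gen ▸ Submodule.mem_top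
    induction hy using Submodule.span_induction with
    | mem y hy => exact Submodule.subset_span (incl_mem_rowGrading hC smul_mem hy)
    | zero =>
      have : C.incl (0 : M) = 0 := Subtype.ext (funext fun v => smul_zero _)
      rw [this]; exact zero_mem _
    | add x y _ _ hx hy =>
      have : C.incl (x + y) = C.incl x + C.incl y := Subtype.ext (funext fun v => smul_add _ _ _)
      rw [this]; exact add_mem hx hy
    | smul a x _ hx =>
      obtain ⟨a, rfl⟩ := op_surjective a
      rw [← op_theta_smul_incl]
      exact Submodule.smul_mem _ _ hx
  refine top_le_iff.1 fun f _ => ?_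
  rw [← C.sum_tau_smul_incl f]
  exact Submodule.sum_mem _ fun v _ => Submodule.smul_mem _ _ (key _)

end CornerData

namespace PathAlgebra

variable {K : Type w} [Field K] {V : Type u} [Quiver.{v} V]

/-! ### Trivial paths, arrows and left division by an arrow -/

variable (K) in
/-- The trivial path at a vertex. -/
noncomputable def vert (a : V) : PathAlgebra K V := ofPath K (Quiver.Path.nil : Quiver.Path a a)

variable (K) in
/-- An arrow as an element of the path algebra. -/
noncomputable def arr (s : Σ a b : V, a ⟶ b) : PathAlgebra K V := ofPath K s.2.2.toPath

theorem ofPath_cons {a b c : V} (p : Quiver.Path a b) (α : b ⟶ c) :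
    ofPath K (p.cons α) = ofPath K p * arr K ⟨b, c, α⟩ := by
  rw [arr, ofPath_mul_comp]
  rfl

theorem vert_mul_ofPath {a b : V} (p : Quiver.Path a b) : vert K a * ofPath K p = ofPath K p := by
  rw [vert, ofPath_mul_comp, Quiver.Path.nil_comp]

theorem ofPath_mul_vert {a b : V} (p : Quiver.Path a b) : ofPath K p * vert K b = ofPath K p := by
  rw [vert, ofPath_mul_comp, Quiver.Path.comp_nil]

theorem vert_mul_ofPath_of_ne {a b c : V} (p : Quiver.Path a b) (h : c ≠ a) :
    vert K c * ofPath K p = 0 :=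
  ofPath_mul_of_ne _ _ h.symm

theorem ofPath_mul_vert_of_ne {a b c : V} (p : Quiver.Path a b) (h : c ≠ b) :
    ofPath K p * vert K c = 0 :=
  ofPath_mul_of_ne _ _ h

theorem vert_mul_vert (a : V) : vert K a * vert K a = vert K a := vert_mul_ofPath _

theorem vert_mul_arr (s : Σ a b : V, a ⟶ b) : vert K s.1 * arr K s = arr K s := vert_mul_ofPath _

theorem arr_mul_vert (s : Σ a b : V, a ⟶ b) : arr K s * vert K s.2.1 = arr K s := ofPath_mul_vert _

theorem one_eq_sum_vert [Fintype V] : (1 : PathAlgebra K V) = ∑ a : V, vert K a := rfl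

open Classical in
/-- The quotient of a path by an initial arrow, `0` if the path does not start with it. -/
noncomputable def leftDivPath (s : Σ a b : V, a ⟶ b) {a : V} :
    ∀ {b : V}, Quiver.Path a b → PathAlgebra K V
  | _, .nil => 0
  | _, .cons (b := c) (c := d) p β =>
    -- Paths grow at their right end, so the initial arrow is the one appended to a path of length
    -- 0.
    if p.length = 0 then (if (⟨c, d, β⟩ : Σ a b : V, a ⟶ b) = s then vert K s.2.1 else 0)
    else leftDivPath s p * arr K ⟨c, d, β⟩

/-- Left division by an arrow. -/
noncomputable def leftDiv (s : Σ a b : V, a ⟶ b) : PathAlgebra K V →ₗ[K] PathAlgebra K V :=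
  liftPath K fun p => leftDivPath s p.2.2

theorem leftDiv_ofPath (s : Σ a b : V, a ⟶ b) {a b : V} (p : Quiver.Path a b) :
    leftDiv s (ofPath K p) = leftDivPath s p :=
  liftPath_ofPath _ _ _

theorem leftDivPath_mul_vert (s : Σ a b : V, a ⟶ b) {a b : V} (p : Quiver.Path a b) :
    leftDivPath s p * vert K b = leftDivPath s p := by
  cases p with
  | nil => exact zero_mul _
  | cons p β =>
    rw [leftDivPath]
    split_ifs with h1 h2
    · subst h2; exact vert_mul_vert _
    · exact zero_mul _
    · rw [mul_assoc]
      congr 1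
      exact arr_mul_vert ⟨_, _, β⟩

theorem vert_mul_leftDivPath (s : Σ a b : V, a ⟶ b) {a b : V} (p : Quiver.Path a b) :
    vert K s.2.1 * leftDivPath s p = leftDivPath s p := by
  induction p with
  | nil => exact mul_zero _
  | cons p β ih =>
    rw [leftDivPath]
    split_ifs with h1 h2
    · exact vert_mul_vert _
    · exact mul_zero _
    · rw [← mul_assoc, ih]

theorem vert_mul_leftDiv (s : Σ a b : V, a ⟶ b) (x : PathAlgebra K V) :
    vert K s.2.1 * leftDiv s x = leftDiv s x := by
  induction x using induction_on with
  | zero => rw [map_zero, mul_zero]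
  | add x y hx hy => rw [map_add, mul_add, hx, hy]
  | smul k a b p => rw [map_smul, PathAlgebra.mul_smul, leftDiv_ofPath, vert_mul_leftDivPath]

theorem leftDivPath_comp (s : Σ a b : V, a ⟶ b) {a b c : V} (p : Quiver.Path a b)
    (hp : 0 < p.length) (q : Quiver.Path b c) :
    (leftDivPath s (p.comp q) : PathAlgebra K V) = leftDivPath s p * ofPath K q := by
  induction q with
  | nil => rw [Quiver.Path.comp_nil]; exact (leftDivPath_mul_vert s p).symm
  | cons q β ih =>
    rw [Quiver.Path.comp_cons, leftDivPath, if_neg (by rw [Quiver.Path.length_comp]; omega), ih,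
      ofPath_cons, mul_assoc]

-- The vertex factor has to stay: the terms of x that do not start at the end of the arrow are lost
-- in the product.
open Classical in
theorem leftDiv_arr_mul (s t : Σ a b : V, a ⟶ b) (x : PathAlgebra K V) :
    leftDiv s (arr K t * x) = if t = s then vert K s.2.1 * x else 0 := by
  obtain ⟨a, b, β⟩ := t
  have h1 : (leftDivPath s β.toPath : PathAlgebra K V) =
      if (⟨a, b, β⟩ : Σ a b : V, a ⟶ b) = s then vert K s.2.1 else 0 := by
    rw [Quiver.Hom.toPath, leftDivPath, if_pos (by rfl)]
  induction x using induction_on with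
  | zero => simp
  | add x y hx hy => rw [mul_add, map_add, hx, hy]; split_ifs <;> simp [mul_add]
  | smul k c d q =>
    rw [PathAlgebra.mul_smul, map_smul, PathAlgebra.mul_smul]
    by_cases hc : c = b
    · subst hc
      rw [arr, ofPath_mul_comp, leftDiv_ofPath, leftDivPath_comp _ _ (by simp), h1]
      split_ifs <;> simp
    · rw [arr, ofPath_mul_of_ne _ _ hc, map_zero, smul_zero]
      split_ifs with h
      · subst h
        rw [vert_mul_ofPath_of_ne _ (Ne.symm hc), smul_zero]
      · rfl

theorem sum_arr_mul_leftDivPath [Fintype (Σ a b : V, a ⟶ b)] {a b : V} (p : Quiver.Path a b)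
    (hp : 0 < p.length) : ∑ s, arr K s * leftDivPath s p = ofPath K p := by
  classical
  induction p with
  | nil => exact absurd hp (lt_irrefl 0)
  | cons p β ih =>
    rename_i c d
    rcases Nat.eq_zero_or_pos p.length with h | h
    · have e := Quiver.Path.eq_of_length_zero p h
      subst e
      have := Quiver.Path.eq_nil_of_length_zero p h
      subst this
      simp only [leftDivPath, Quiver.Path.length_nil, if_true]
      rw [Finset.sum_eq_single ⟨a, d, β⟩]
      · rw [if_pos rfl, arr_mul_vert]; rfl
      · intro t _ ht
        rw [if_neg (Ne.symm ht), mul_zero]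
      · intro h; exact absurd (Finset.mem_univ _) h
    · simp only [leftDivPath, if_neg h.ne', ← mul_assoc]
      rw [← Finset.sum_mul, ih h, ← ofPath_cons]

open Classical in
/-- The coefficient of a trivial path. -/
noncomputable def vertCoeff (a : V) : PathAlgebra K V →ₗ[K] K :=
  liftPath K fun p => if p.2.2.length = 0 ∧ p.1 = a then 1 else 0

open Classical in
theorem vertCoeff_ofPath (c : V) {a b : V} (p : Quiver.Path a b) :
    vertCoeff c (ofPath K p) = if p.length = 0 ∧ a = c then 1 else 0 :=
  liftPath_ofPath _ _ _

/-- A product of paths is trivial only if both factors are, so this coefficient is a character of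
the path algebra, the one of the simple module at c. -/
theorem vertCoeff_mul (c : V) (x y : PathAlgebra K V) :
    vertCoeff c (x * y) = vertCoeff c x * vertCoeff c y := by
  classical
  induction x using induction_on with
  | zero => simp
  | add x x' hx hx' => rw [add_mul, map_add, hx, hx', map_add, add_mul]
  | smul k a b p =>
    rw [PathAlgebra.smul_mul, map_smul, map_smul, smul_mul_assoc]
    congr 1
    induction y using induction_on with
    | zero => simp
    | add y y' hy hy' => rw [mul_add, map_add, hy, hy', map_add, mul_add]
    | smul k a' b' q =>
      rw [PathAlgebra.mul_smul, map_smul, map_smul, mul_smul_comm]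
      congr 1
      by_cases h : a' = b
      · subst h
        rw [ofPath_mul_comp]
        simp only [vertCoeff_ofPath, Quiver.Path.length_comp]
        by_cases hp : p.length = 0
        · have := Quiver.Path.eq_of_length_zero p hp
          subst this
          by_cases ha : a = c <;> simp [hp, ha]
        · simp [hp]
      · rw [ofPath_mul_of_ne _ _ h, map_zero]
        simp only [vertCoeff_ofPath]
        by_cases hp : p.length = 0 ∧ a = c
        · have := Quiver.Path.eq_of_length_zero p hp.1
          subst this
          rw [if_neg (c := q.length = 0 ∧ a' = c) (fun h' => h (h'.2.trans hp.2.symm)), mul_zero]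
        · rw [if_neg hp, zero_mul]

theorem vertCoeff_vert (a : V) : vertCoeff a (vert K a) = 1 := by
  classical
  rw [vert, vertCoeff_ofPath, if_pos ⟨rfl, rfl⟩]

theorem vertCoeff_one [Fintype V] (a : V) : vertCoeff a (1 : PathAlgebra K V) = 1 := by
  classical
  rw [one_eq_sum_vert, map_sum, Finset.sum_eq_single a]
  · exact vertCoeff_vert a
  · intro b _ hb
    rw [vert, vertCoeff_ofPath, if_neg (by simp [hb])]
  · simp

/-- Each path of positive length is its initial arrow times the remaining path, and the other paths
are the vertices. -/
theorem sum_arr_mul_leftDiv_add [Fintype V] [Fintype (Σ a b : V, a ⟶ b)] (x : PathAlgebra K V) :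
    ∑ s, arr K s * leftDiv s x + ∑ a, vertCoeff a x • vert K a = x := by
  classical
  induction x using induction_on with
  | zero => simp
  | add x y hx hy =>
    conv_rhs => rw [← hx, ← hy]
    simp only [map_add, mul_add, add_smul, Finset.sum_add_distrib]
    abel
  | smul k a b p =>
    simp only [map_smul, PathAlgebra.mul_smul, smul_eq_mul, mul_smul, ← Finset.smul_sum,
      ← smul_add]
    congr 1
    simp only [leftDiv_ofPath, vertCoeff_ofPath]
    rcases Nat.eq_zero_or_pos p.length with h | h
    · have e := Quiver.Path.eq_of_length_zero p h
      subst e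
      have := Quiver.Path.eq_nil_of_length_zero p h
      subst this
      simp [leftDivPath]
      rfl
    · rw [sum_arr_mul_leftDivPath _ h]
      simp [h.ne']

theorem sum_arr_mul_leftDiv [Fintype V] [Fintype (Σ a b : V, a ⟶ b)] {x : PathAlgebra K V}
    (hx : ∀ a, vertCoeff a x = 0) : ∑ s, arr K s * leftDiv s x = x := by
  conv_rhs => rw [← sum_arr_mul_leftDiv_add x]
  simp [hx]

/-! ### Length -/

variable (K V) in
/-- The span of the paths of length at least `n`. -/
noncomputable def lengthGE (n : ℕ) : Submodule K (PathAlgebra K V) :=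
  Submodule.span K {x | ∃ (a b : V) (p : Quiver.Path a b), n ≤ p.length ∧ x = ofPath K p}

theorem ofPath_mem_lengthPart {a b : V} (p : Quiver.Path a b) :
    ofPath K p ∈ lengthPart K V p.length :=
  Submodule.subset_span ⟨a, b, p, rfl, rfl⟩

theorem ofPath_mem_lengthGE {n : ℕ} {a b : V} (p : Quiver.Path a b) (h : n ≤ p.length) :
    ofPath K p ∈ lengthGE K V n :=
  Submodule.subset_span ⟨a, b, p, h, rfl⟩

theorem vert_mem_lengthPart (a : V) : vert K a ∈ lengthPart K V 0 :=
  ofPath_mem_lengthPart (Quiver.Path.nil : Quiver.Path a a)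

theorem arr_mem_lengthPart (s : Σ a b : V, a ⟶ b) : arr K s ∈ lengthPart K V 1 :=
  ofPath_mem_lengthPart s.2.2.toPath

theorem lengthPart_le_lengthGE {n m : ℕ} (h : m ≤ n) : lengthPart K V n ≤ lengthGE K V m := by
  refine Submodule.span_mono ?_
  rintro x ⟨a, b, p, hp, rfl⟩
  exact ⟨a, b, p, hp ▸ h, rfl⟩

theorem lengthGE_zero : lengthGE K V 0 = ⊤ := by
  refine top_le_iff.1 fun x _ => ?_
  induction x using induction_on with
  | zero => exact zero_mem _
  | add x y hx hy => exact add_mem (hx trivial) (hy trivial)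
  | smul k a b p => exact Submodule.smul_mem _ _ (ofPath_mem_lengthGE p (Nat.zero_le _))

theorem lengthPart_mul {i j : ℕ} {x y : PathAlgebra K V} (hx : x ∈ lengthPart K V i)
    (hy : y ∈ lengthPart K V j) : x * y ∈ lengthPart K V (i + j) := by
  induction hx using Submodule.span_induction with
  | mem x hx =>
    obtain ⟨a, b, p, rfl, rfl⟩ := hx
    induction hy using Submodule.span_induction with
    | mem y hy =>
      obtain ⟨c, d, q, rfl, rfl⟩ := hy
      by_cases h : c = b
      · subst h
        rw [ofPath_mul_comp, ← Quiver.Path.length_comp]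
        exact ofPath_mem_lengthPart _
      · rw [ofPath_mul_of_ne _ _ h]
        exact zero_mem _
    | zero => rw [mul_zero]; exact zero_mem _
    | add y z _ _ hy hz => rw [mul_add]; exact add_mem hy hz
    | smul k y _ hy => rw [PathAlgebra.mul_smul]; exact Submodule.smul_mem _ _ hy
  | zero => rw [zero_mul]; exact zero_mem _
  | add y z _ _ hy hz => rw [add_mul]; exact add_mem hy hz
  | smul k y _ hy => rw [PathAlgebra.smul_mul]; exact Submodule.smul_mem _ _ hy

theorem lengthGE_mul {i j : ℕ} {x y : PathAlgebra K V} (hx : x ∈ lengthGE K V i)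
    (hy : y ∈ lengthGE K V j) : x * y ∈ lengthGE K V (i + j) := by
  induction hx using Submodule.span_induction with
  | mem x hx =>
    obtain ⟨a, b, p, hp, rfl⟩ := hx
    induction hy using Submodule.span_induction with
    | mem y hy =>
      obtain ⟨c, d, q, hq, rfl⟩ := hy
      by_cases h : c = b
      · subst h
        rw [ofPath_mul_comp]
        exact ofPath_mem_lengthGE _ (by rw [Quiver.Path.length_comp]; omega)
      · rw [ofPath_mul_of_ne _ _ h]
        exact zero_mem _
    | zero => rw [mul_zero]; exact zero_mem _
    | add y z _ _ hy hz => rw [mul_add]; exact add_mem hy hz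
    | smul k y _ hy => rw [PathAlgebra.mul_smul]; exact Submodule.smul_mem _ _ hy
  | zero => rw [zero_mul]; exact zero_mem _
  | add y z _ _ hy hz => rw [add_mul]; exact add_mem hy hz
  | smul k y _ hy => rw [PathAlgebra.smul_mul]; exact Submodule.smul_mem _ _ hy

theorem lengthGE_mul_right {n : ℕ} {x : PathAlgebra K V} (hx : x ∈ lengthGE K V n)
    (y : PathAlgebra K V) : x * y ∈ lengthGE K V n := by
  have hy : y ∈ lengthGE K V 0 := lengthGE_zero (K := K) (V := V) ▸ Submodule.mem_top
  have := lengthGE_mul hx hy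
  rwa [add_zero] at this

theorem lengthGE_mul_left {n : ℕ} {x : PathAlgebra K V} (hx : x ∈ lengthGE K V n)
    (y : PathAlgebra K V) : y * x ∈ lengthGE K V n := by
  have hy : y ∈ lengthGE K V 0 := lengthGE_zero (K := K) (V := V) ▸ Submodule.mem_top
  have := lengthGE_mul hy hx
  rwa [zero_add] at this

theorem mem_lengthGE_iff {n : ℕ} {x : PathAlgebra K V} : x ∈ lengthGE K V n ↔
    ∀ (a b : V) (p : Quiver.Path a b), x.coeff p ≠ 0 → n ≤ p.length := by
  have hset : {x : PathAlgebra K V | ∃ (a b : V) (p : Quiver.Path a b), n ≤ p.length ∧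
      x = ofPath K p} = (fun q : (Σ a b : V, Quiver.Path a b) =>
        (Finsupp.single q 1 : (Σ a b : V, Quiver.Path a b) →₀ K)) '' {q | n ≤ q.2.2.length} := by
    ext y
    constructor
    · rintro ⟨a, b, p, h, rfl⟩
      exact ⟨⟨a, b, p⟩, h, rfl⟩
    · rintro ⟨⟨a, b, p⟩, h, rfl⟩
      exact ⟨a, b, p, h, rfl⟩
  have h : lengthGE K V n = Finsupp.supported K K
      {q : (Σ a b : V, Quiver.Path a b) | n ≤ q.2.2.length} := by
    rw [Finsupp.supported_eq_span_single, lengthGE, hset]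
    rfl
  rw [h]
  constructor
  · intro hx a b p hp
    exact hx (Finsupp.mem_support_iff.2 hp)
  · intro hx q hq
    exact hx q.1 q.2.1 q.2.2 (Finsupp.mem_support_iff.1 hq)

theorem vertCoeff_eq_zero_of_mem_lengthGE {x : PathAlgebra K V} (hx : x ∈ lengthGE K V 1) (a : V) :
    vertCoeff a x = 0 := by
  classical
  induction hx using Submodule.span_induction with
  | mem x hx =>
    obtain ⟨b, c, p, hp, rfl⟩ := hx
    rw [vertCoeff_ofPath, if_neg (by omega)]
  | zero => exact map_zero _
  | add x y _ _ hx hy => rw [map_add, hx, hy, add_zero]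
  | smul k x _ hx => rw [map_smul, hx, smul_zero]

theorem lengthGE_anti {m n : ℕ} (h : m ≤ n) : lengthGE K V n ≤ lengthGE K V m := by
  refine Submodule.span_mono ?_
  rintro x ⟨a, b, p, hp, rfl⟩
  exact ⟨a, b, p, h.trans hp, rfl⟩

theorem mem_lengthGE_one [Fintype V] [Fintype (Σ a b : V, a ⟶ b)] {x : PathAlgebra K V}
    (hx : ∀ a, vertCoeff a x = 0) : x ∈ lengthGE K V 1 := by
  rw [← sum_arr_mul_leftDiv hx]
  refine Submodule.sum_mem _ fun s _ => ?_
  exact lengthGE_mul_right (lengthPart_le_lengthGE le_rfl (arr_mem_lengthPart s)) _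

theorem leftDivPath_mem_lengthPart (s : Σ a b : V, a ⟶ b) {a b : V} (p : Quiver.Path a b) :
    (leftDivPath s p : PathAlgebra K V) ∈ lengthPart K V (p.length - 1) := by
  induction p with
  | nil =>
    rw [leftDivPath]
    exact zero_mem _
  | cons p β ih =>
    rw [leftDivPath, Quiver.Path.length_cons, Nat.add_sub_cancel]
    split_ifs with h1 h2
    · rw [h1]
      exact vert_mem_lengthPart s.2.1
    · exact zero_mem _
    · have := lengthPart_mul ih (arr_mem_lengthPart (K := K) ⟨_, _, β⟩)
      rwa [Nat.sub_add_cancel (by omega)] at this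

theorem leftDiv_mem_lengthPart (s : Σ a b : V, a ⟶ b) {n : ℕ} {x : PathAlgebra K V}
    (hx : x ∈ lengthPart K V n) : leftDiv s x ∈ lengthPart K V (n - 1) := by
  induction hx using Submodule.span_induction with
  | mem x hx =>
    obtain ⟨a, b, p, rfl, rfl⟩ := hx
    rw [leftDiv_ofPath]
    exact leftDivPath_mem_lengthPart s p
  | zero => rw [map_zero]; exact zero_mem _
  | add x y _ _ hx hy => rw [map_add]; exact add_mem hx hy
  | smul k x _ hx => rw [map_smul]; exact Submodule.smul_mem _ _ hx

theorem leftDiv_mem_lengthGE (s : Σ a b : V, a ⟶ b) {n : ℕ} {x : PathAlgebra K V}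
    (hx : x ∈ lengthGE K V (n + 1)) : leftDiv s x ∈ lengthGE K V n := by
  induction hx using Submodule.span_induction with
  | mem x hx =>
    obtain ⟨a, b, p, hp, rfl⟩ := hx
    rw [leftDiv_ofPath]
    exact lengthPart_le_lengthGE (by omega) (leftDivPath_mem_lengthPart s p)
  | zero => rw [map_zero]; exact zero_mem _
  | add x y _ _ hx hy => rw [map_add]; exact add_mem hx hy
  | smul k x _ hx => rw [map_smul]; exact Submodule.smul_mem _ _ hx

/-- The length condition is essential: a trivial path in x would let the initial arrow of a product
come from y. -/
theorem leftDiv_mul (s : Σ a b : V, a ⟶ b) {x : PathAlgebra K V} (hx : x ∈ lengthGE K V 1)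
    (y : PathAlgebra K V) : leftDiv s (x * y) = leftDiv s x * y := by
  induction hx using Submodule.span_induction with
  | mem x hx =>
    obtain ⟨a, b, p, hp, rfl⟩ := hx
    rw [leftDiv_ofPath]
    induction y using induction_on with
    | zero => simp
    | add x y hx hy => rw [mul_add, mul_add, map_add, hx, hy]
    | smul k c d q =>
      rw [PathAlgebra.mul_smul, PathAlgebra.mul_smul, map_smul]
      congr 1
      by_cases h : c = b
      · subst h
        rw [ofPath_mul_comp, leftDiv_ofPath, leftDivPath_comp _ _ hp]
      · rw [ofPath_mul_of_ne _ _ h, map_zero, ← leftDivPath_mul_vert, mul_assoc,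
          vert_mul_ofPath_of_ne _ (Ne.symm h), mul_zero]
  | zero => rw [zero_mul, map_zero, zero_mul]
  | add x y _ _ hx hy => rw [add_mul, map_add, map_add, hx, hy, add_mul]
  | smul k x _ hx => rw [PathAlgebra.smul_mul, map_smul, map_smul, hx, PathAlgebra.smul_mul]

/-- The projection to the paths of length `n`. -/
noncomputable def lengthProj (n : ℕ) : PathAlgebra K V →ₗ[K] PathAlgebra K V :=
  liftPath K fun p => if p.2.2.length = n then ofPath K p.2.2 else 0

theorem lengthProj_ofPath (n : ℕ) {a b : V} (p : Quiver.Path a b) :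
    lengthProj n (ofPath K p) = if p.length = n then ofPath K p else 0 :=
  liftPath_ofPath _ _ _

theorem isGradingProj_lengthProj : IsGradingProj (fun n => (lengthPart K V n).toAddSubgroup)
    (fun n => (lengthProj n : PathAlgebra K V →ₗ[K] _).toAddMonoidHom) where
  mem i x := by
    change lengthProj i x ∈ lengthPart K V i
    induction x using induction_on with
    | zero => rw [map_zero]; exact zero_mem _
    | add x y hx hy => rw [map_add]; exact add_mem hx hy
    | smul k a b p =>
      rw [map_smul, lengthProj_ofPath]
      refine Submodule.smul_mem _ _ ?_
      split_ifs with h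
      · exact h ▸ ofPath_mem_lengthPart p
      · exact zero_mem _
  same i x hx := by
    change lengthProj i x = x
    change x ∈ lengthPart K V i at hx
    induction hx using Submodule.span_induction with
    | mem x hx =>
      obtain ⟨a, b, p, hp, rfl⟩ := hx
      rw [lengthProj_ofPath, if_pos hp]
    | zero => exact map_zero _
    | add x y _ _ hx hy => rw [map_add, hx, hy]
    | smul k x _ hx => rw [map_smul, hx]
  ne i j hij x hx := by
    change lengthProj j x = 0
    change x ∈ lengthPart K V i at hx
    induction hx using Submodule.span_induction with
    | mem x hx =>
      obtain ⟨a, b, p, hp, rfl⟩ := hx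
      rw [lengthProj_ofPath, if_neg (by omega)]
    | zero => exact map_zero _
    | add x y _ _ hx hy => rw [map_add, hx, hy, add_zero]
    | smul k x _ hx => rw [map_smul, hx, smul_zero]
  sum x := by
    change ∃ N, ∀ n, N ≤ n → ∑ i ∈ Finset.range n, lengthProj i x = x
    induction x using induction_on with
    | zero => exact ⟨0, fun n _ => by simp⟩
    | add x y hx hy =>
      obtain ⟨N, hN⟩ := hx
      obtain ⟨N', hN'⟩ := hy
      refine ⟨N + N', fun n hn => ?_⟩
      simp only [map_add, Finset.sum_add_distrib]
      rw [hN n (by omega), hN' n (by omega)]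
    | smul k a b p =>
      refine ⟨p.length + 1, fun n hn => ?_⟩
      simp only [map_smul, lengthProj_ofPath]
      rw [← Finset.smul_sum, Finset.sum_ite_eq, if_pos (Finset.mem_range.2 (by omega))]

/-! ### Ideals and quotients -/

variable [Fintype V]

theorem smul_mem_ideal {I : TwoSidedIdeal (PathAlgebra K V)} (k : K) {x : PathAlgebra K V}
    (hx : x ∈ I) : k • x ∈ I := by
  have : k • x = (k • (1 : PathAlgebra K V)) * x := by rw [PathAlgebra.smul_mul, one_mul]
  rw [this]
  exact I.mul_mem_left _ _ hx

theorem sum_mem_ideal {I : TwoSidedIdeal (PathAlgebra K V)} {ι : Type*} (s : Finset ι)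
    (f : ι → PathAlgebra K V) (h : ∀ i ∈ s, f i ∈ I) : ∑ i ∈ s, f i ∈ I :=
  sum_mem h

/-- Additively the ideal is spanned by scalar multiples of p·s·q with p, q paths and s a homogeneous
generator. These are homogeneous, so a projection either keeps or kills them. -/
theorem IsLengthHomogeneous.lengthProj_mem {I : TwoSidedIdeal (PathAlgebra K V)}
    (hI : IsLengthHomogeneous I) {x : PathAlgebra K V} (hx : x ∈ I) (n : ℕ) :
    lengthProj n x ∈ I := by
  obtain ⟨S, hS, rfl⟩ := hI
  have hS' : ∀ s ∈ S, s ∈ TwoSidedIdeal.span S := fun s hs => TwoSidedIdeal.subset_span hs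
  have hP := isGradingProj_lengthProj (K := K) (V := V)
  rw [TwoSidedIdeal.mem_span_iff_mem_addSubgroup_closure] at hx
  induction hx using AddSubgroup.closure_induction with
  | mem z hz =>
    obtain ⟨z, ⟨a, -, s, hs, rfl⟩, b, -, rfl⟩ := hz
    change lengthProj n (a * s * b) ∈ _
    induction a using induction_on with
    | zero => simp only [zero_mul, map_zero]; exact zero_mem _
    | add a a' ha ha' => rw [add_mul, add_mul, map_add]; exact add_mem ha ha'
    | smul k c d p =>
      rw [PathAlgebra.smul_mul, PathAlgebra.smul_mul, map_smul]
      refine smul_mem_ideal k ?_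
      induction b using induction_on with
      | zero => simp only [mul_zero, map_zero]; exact zero_mem _
      | add a a' ha ha' => rw [mul_add, map_add]; exact add_mem ha ha'
      | smul k c' d' q =>
        rw [PathAlgebra.mul_smul, map_smul]
        refine smul_mem_ideal k ?_
        obtain ⟨m, hm⟩ := hS s hs
        have h := lengthPart_mul (lengthPart_mul (ofPath_mem_lengthPart (K := K) p) hm)
          (ofPath_mem_lengthPart (K := K) q)
        by_cases e : p.length + m + q.length = n
        · have := hP.same n _ (e ▸ h)
          change lengthProj n _ = _ at this
          rw [this]
          exact TwoSidedIdeal.mul_mem_right _ _ _ (TwoSidedIdeal.mul_mem_left _ _ _ (hS' s hs))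
        · have := hP.ne _ n e _ h
          change lengthProj n _ = _ at this
          rw [this]
          exact zero_mem _
  | zero => rw [map_zero]; exact zero_mem _
  | add x y _ _ hx hy => rw [map_add]; exact add_mem hx hy
  | neg x _ hx => rw [map_neg]; exact neg_mem hx

/-- The quotient map. -/
noncomputable def toQuot (I : TwoSidedIdeal (PathAlgebra K V)) :
    PathAlgebra K V →+* QuotientAlgebra I := I.ringCon.mk'

theorem toQuot_surjective (I : TwoSidedIdeal (PathAlgebra K V)) :
    Function.Surjective (toQuot I) := I.ringCon.mk'_surjective

theorem toQuot_eq_zero {I : TwoSidedIdeal (PathAlgebra K V)} {x : PathAlgebra K V} :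
    toQuot I x = 0 ↔ x ∈ I := I.ringCon.eq

theorem toQuot_mem_quotientPart (I : TwoSidedIdeal (PathAlgebra K V)) {n : ℕ}
    {y : PathAlgebra K V} (hy : y ∈ lengthPart K V n) : toQuot I y ∈ quotientPart I n :=
  ⟨y, hy, rfl⟩

/-- The additive map on the quotient induced by a map vanishing on the ideal. -/
noncomputable def descend (I : TwoSidedIdeal (PathAlgebra K V)) {N : Type*} [AddCommGroup N]
    (f : PathAlgebra K V →+ N) (hf : ∀ x ∈ I, f x = 0) : QuotientAlgebra I →+ N :=
  (toQuot I : PathAlgebra K V →+ QuotientAlgebra I).liftOfSurjective (toQuot_surjective I)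
    ⟨f, fun x hx => hf x (toQuot_eq_zero.1 hx)⟩

theorem descend_toQuot (I : TwoSidedIdeal (PathAlgebra K V)) {N : Type*} [AddCommGroup N]
    (f : PathAlgebra K V →+ N) (hf : ∀ x ∈ I, f x = 0) (x : PathAlgebra K V) :
    descend I f hf (toQuot I x) = f x :=
  AddMonoidHom.liftOfRightInverse_comp_apply _ _ _ _ _

theorem isInternal_quotientPart {I : TwoSidedIdeal (PathAlgebra K V)}
    (hI : IsLengthHomogeneous I) : DirectSum.IsInternal (quotientPart I) := by
  have hP := isGradingProj_lengthProj (K := K) (V := V)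
  refine IsGradingProj.isInternal (p := fun n => descend I
    ((toQuot I : PathAlgebra K V →+ QuotientAlgebra I).comp
      (lengthProj n : PathAlgebra K V →ₗ[K] _).toAddMonoidHom)
    (fun x hx => toQuot_eq_zero.2 (hI.lengthProj_mem hx n))) ⟨fun i x => ?_, ?_, ?_, fun x => ?_⟩
  · obtain ⟨x, rfl⟩ := toQuot_surjective I x
    have e := descend_toQuot I ((toQuot I : PathAlgebra K V →+ QuotientAlgebra I).comp
      (lengthProj i : PathAlgebra K V →ₗ[K] _).toAddMonoidHom)
      (fun x hx => toQuot_eq_zero.2 (hI.lengthProj_mem hx i)) x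
    exact e ▸ toQuot_mem_quotientPart I (hP.mem i x)
  · rintro i _ ⟨x, hx, rfl⟩
    exact (descend_toQuot _ _ _ _).trans (congrArg (toQuot I) (hP.same i x hx))
  · rintro i j hij _ ⟨x, hx, rfl⟩
    exact (descend_toQuot _ _ _ _).trans
      ((congrArg (toQuot I) (hP.ne i j hij x hx)).trans (map_zero _))
  · obtain ⟨x, rfl⟩ := toQuot_surjective I x
    obtain ⟨N, hN⟩ := hP.sum x
    refine ⟨N, fun n hn => ?_⟩
    conv_rhs => rw [← hN n hn, map_sum]
    exact Finset.sum_congr rfl fun i _ => descend_toQuot _ _ _ _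

theorem quotientPart_mul {I : TwoSidedIdeal (PathAlgebra K V)} {i j : ℕ} {x y : QuotientAlgebra I}
    (hx : x ∈ quotientPart I i) (hy : y ∈ quotientPart I j) : x * y ∈ quotientPart I (i + j) := by
  obtain ⟨x, hx, rfl⟩ := hx
  obtain ⟨y, hy, rfl⟩ := hy
  exact ⟨x * y, lengthPart_mul hx hy, map_mul (toQuot I) _ _⟩

theorem one_mem_quotientPart (I : TwoSidedIdeal (PathAlgebra K V)) :
    (1 : QuotientAlgebra I) ∈ quotientPart I 0 := by
  refine ⟨1, ?_, map_one (toQuot I)⟩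
  change (1 : PathAlgebra K V) ∈ lengthPart K V 0
  rw [one_eq_sum_vert]
  exact Submodule.sum_mem _ fun a _ => vert_mem_lengthPart a

theorem IsAdmissible.le_lengthGE {I : TwoSidedIdeal (PathAlgebra K V)} (hI : IsAdmissible I)
    {x : PathAlgebra K V} (hx : x ∈ I) : x ∈ lengthGE K V 2 :=
  mem_lengthGE_iff.2 (hI.1 x hx)

end PathAlgebra

namespace PathAlgebra

variable {K : Type w} [Field K] {V : Type u} [Quiver.{v} V] [Fintype V]

/-! ### Admissible ideals -/

theorem IsAdmissible.exists_lengthGE_le {I : TwoSidedIdeal (PathAlgebra K V)}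
    (hI : IsAdmissible I) : ∃ m, 2 ≤ m ∧ ∀ x ∈ lengthGE K V m, x ∈ I := by
  obtain ⟨m, hm, h⟩ := hI.2
  refine ⟨m, hm, fun x hx => ?_⟩
  induction hx using Submodule.span_induction with
  | mem x hx =>
    obtain ⟨a, b, p, hp, rfl⟩ := hx
    exact h a b p hp
  | zero => exact zero_mem _
  | add x y _ _ hx hy => exact add_mem hx hy
  | smul k x _ hx => exact smul_mem_ideal k hx

theorem pow_mem_lengthGE {x : PathAlgebra K V} (hx : x ∈ lengthGE K V 1) (n : ℕ) :
    x ^ n ∈ lengthGE K V n := by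
  induction n with
  | zero => rw [lengthGE_zero]; exact Submodule.mem_top
  | succ n ih => rw [pow_succ]; exact lengthGE_mul ih hx

theorem IsAdmissible.isNilpotent_toQuot {I : TwoSidedIdeal (PathAlgebra K V)}
    (hI : IsAdmissible I) {x : PathAlgebra K V} (hx : x ∈ lengthGE K V 1) :
    IsNilpotent (toQuot I x) := by
  obtain ⟨m, -, hm⟩ := hI.exists_lengthGE_le
  exact ⟨m, by rw [← map_pow]; exact toQuot_eq_zero.2 (hm _ (pow_mem_lengthGE hx m))⟩

/-- The arrow ideal is nilpotent modulo I, so 1 - x·r is a unit for every r. If a maximal right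
ideal missed x, it would contain such a unit. -/
theorem toQuot_mem_jacobson {I : TwoSidedIdeal (PathAlgebra K V)} (hI : IsAdmissible I)
    {x : PathAlgebra K V} (hx : x ∈ lengthGE K V 1) :
    toQuot I x ∈ Module.jacobson (QuotientAlgebra I)ᵐᵒᵖ (QuotientAlgebra I) := by
  refine Submodule.mem_sInf.2 fun m hm => ?_
  by_contra hxm
  have hlt : m < m ⊔ Submodule.span (QuotientAlgebra I)ᵐᵒᵖ {toQuot I x} := by
    refine lt_of_le_of_ne le_sup_left fun e => hxm ?_
    rw [e]
    exact Submodule.mem_sup_right (Submodule.mem_span_singleton_self _)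
  have h1 : (1 : QuotientAlgebra I) ∈ m ⊔ Submodule.span (QuotientAlgebra I)ᵐᵒᵖ {toQuot I x} := by
    rw [hm.2 _ hlt]
    exact Submodule.mem_top
  obtain ⟨y, hy, z, hz, hyz⟩ := Submodule.mem_sup.1 h1
  obtain ⟨r, rfl⟩ := Submodule.mem_span_singleton.1 hz
  obtain ⟨r, rfl⟩ := op_surjective r
  obtain ⟨r, rfl⟩ := toQuot_surjective I r
  rw [op_smul_eq_mul, ← map_mul] at hyz
  have hu := (hI.isNilpotent_toQuot (lengthGE_mul_right hx r)).isUnit_one_sub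
  rw [← hyz, add_sub_cancel_right] at hu
  obtain ⟨t, ht⟩ := hu.exists_right_inv
  apply hm.1
  refine top_le_iff.1 fun s _ => ?_
  have : s = op (t * s) • y := by rw [op_smul_eq_mul, ← mul_assoc, ht, one_mul]
  rw [this]
  exact Submodule.smul_mem _ _ hy

theorem vertCoeff_eq_zero_of_mem {I : TwoSidedIdeal (PathAlgebra K V)} (hI : IsAdmissible I)
    {x : PathAlgebra K V} (hx : x ∈ I) (a : V) : vertCoeff a x = 0 :=
  vertCoeff_eq_zero_of_mem_lengthGE (lengthGE_anti one_le_two (hI.le_lengthGE hx)) a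

/-- The coefficient at a descends to a character of the quotient, and the kernel of a character with
values in a field is a maximal right ideal. -/
theorem vertCoeff_eq_zero_of_mem_jacobson {I : TwoSidedIdeal (PathAlgebra K V)}
    (hI : IsAdmissible I) {x : PathAlgebra K V}
    (hx : toQuot I x ∈ Module.jacobson (QuotientAlgebra I)ᵐᵒᵖ (QuotientAlgebra I)) (a : V) :
    vertCoeff a x = 0 := by
  let ε : QuotientAlgebra I →+ K := descend I (vertCoeff a : PathAlgebra K V →ₗ[K] K).toAddMonoidHom
    (fun x hx => vertCoeff_eq_zero_of_mem hI hx a)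
  have hε : ∀ x, ε (toQuot I x) = vertCoeff a x := fun x =>
    descend_toQuot I (vertCoeff a : PathAlgebra K V →ₗ[K] K).toAddMonoidHom _ x
  have hmul : ∀ x y, ε (x * y) = ε x * ε y := by
    intro x y
    obtain ⟨x, rfl⟩ := toQuot_surjective I x
    obtain ⟨y, rfl⟩ := toQuot_surjective I y
    rw [← map_mul, hε, hε, hε, vertCoeff_mul]
  let N : Submodule (QuotientAlgebra I)ᵐᵒᵖ (QuotientAlgebra I) :=
    { carrier := {y | ε y = 0}
      zero_mem' := map_zero ε
      add_mem' := fun {y z} hy hz => by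
        rw [Set.mem_ofPred_eq] at *
        rw [map_add, hy, hz, add_zero]
      smul_mem' := fun r y hy => by
        obtain ⟨r, rfl⟩ := op_surjective r
        rw [Set.mem_ofPred_eq] at *
        rw [op_smul_eq_mul, hmul, hy, zero_mul] }
  have hN : ∀ y, y ∈ N ↔ ε y = 0 := fun y => Iff.rfl
  have h1 : ε 1 = 1 := by rw [← map_one (toQuot I), hε, vertCoeff_one]
  have hco : IsCoatom N := by
    refine ⟨fun e => ?_, fun P hP => ?_⟩
    · have : (1 : QuotientAlgebra I) ∈ N := e ▸ Submodule.mem_top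
      rw [hN, h1] at this
      exact one_ne_zero this
    · obtain ⟨y, hyP, hyN⟩ := SetLike.exists_of_lt hP
      have hy : ε y ≠ 0 := hyN
      have h2 : (1 : QuotientAlgebra I) ∈ P := by
        -- Dividing y by its value under the character makes it congruent to 1 modulo the kernel N.
        have h3 : 1 - op (toQuot I ((ε y)⁻¹ • 1)) • y ∈ N := by
          rw [hN, map_sub, h1, op_smul_eq_mul, hmul, hε, map_smul, vertCoeff_one, smul_eq_mul,
            mul_one, mul_inv_cancel₀ hy, sub_self]
        have := add_mem (hP.le h3) (P.smul_mem (op (toQuot I ((ε y)⁻¹ • 1))) hyP)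
        rwa [sub_add_cancel] at this
      refine top_le_iff.1 fun s _ => ?_
      have := P.smul_mem (op s) h2
      rwa [op_smul_eq_mul, one_mul] at this
  have : toQuot I x ∈ N := Submodule.mem_sInf.1 hx N hco
  rwa [hN, hε] at this

theorem quotientPart_le_jacobson {I : TwoSidedIdeal (PathAlgebra K V)} (hI : IsAdmissible I)
    (j : ℕ) (hj : 0 < j) (r : QuotientAlgebra I) (hr : r ∈ quotientPart I j) :
    r ∈ Module.jacobson (QuotientAlgebra I)ᵐᵒᵖ (QuotientAlgebra I) := by
  obtain ⟨y, hy, rfl⟩ := hr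
  exact toQuot_mem_jacobson hI (lengthPart_le_lengthGE hj hy)

/-! ### Finite dimensionality -/

variable [∀ a b : V, Fintype (a ⟶ b)]

theorem fg_lengthPart (n : ℕ) : (lengthPart K V n).FG := by
  induction n with
  | zero =>
    have : lengthPart K V 0 = Submodule.span K (Set.range fun a : V => vert K a) := by
      apply le_antisymm
      · refine Submodule.span_le.2 ?_
        rintro _ ⟨a, b, p, hp, rfl⟩
        have e := Quiver.Path.eq_of_length_zero p hp
        subst e
        have := Quiver.Path.eq_nil_of_length_zero p hp
        subst this
        exact Submodule.subset_span ⟨a, rfl⟩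
      · refine Submodule.span_le.2 ?_
        rintro _ ⟨a, rfl⟩
        exact vert_mem_lengthPart a
    rw [this]
    exact Submodule.fg_span (Set.finite_range _)
  | succ n ih =>
    have : lengthPart K V (n + 1) ≤
        lengthPart K V n * Submodule.span K (Set.range fun s : Σ a b : V, a ⟶ b => arr K s) := by
      refine Submodule.span_le.2 ?_
      rintro _ ⟨a, b, p, hp, rfl⟩
      cases p with
      | nil => exact absurd hp (by simp)
      | cons p β =>
        rw [ofPath_cons]
        refine Submodule.mul_mem_mul ?_ (Submodule.subset_span ⟨⟨_, _, β⟩, rfl⟩)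
        have hp' : p.length = n := by simpa using hp
        exact hp' ▸ ofPath_mem_lengthPart p
    have hfg := ih.mul (Submodule.fg_span (R := K)
      (Set.finite_range fun s : Σ a b : V, a ⟶ b => arr K s))
    have : FiniteDimensional K _ := Module.Finite.iff_fg.2 hfg
    exact Module.Finite.iff_fg.1 (Submodule.finiteDimensional_of_le ‹_›)

/-- Only paths of length less than m survive in the quotient, and a finite quiver has finitely many
of them. -/
theorem IsAdmissible.finiteDimensional {I : TwoSidedIdeal (PathAlgebra K V)}
    (hI : IsAdmissible I) : FiniteDimensional K (QuotientAlgebra I) := by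
  obtain ⟨m, -, hm⟩ := hI.exists_lengthGE_le
  let f : PathAlgebra K V →ₗ[K] QuotientAlgebra I := (I.ringCon.mkₐ K).toLinearMap
  have hf : ∀ x, f x = toQuot I x := fun x => rfl
  let T : Submodule K (PathAlgebra K V) := ⨆ i : Fin m, lengthPart K V i
  have hT : T.FG := Submodule.fg_iSup _ fun i => fg_lengthPart _
  have key : ∀ x, f x ∈ T.map f := by
    intro x
    induction x using induction_on with
    | zero => rw [map_zero]; exact zero_mem _
    | add x y hx hy => rw [map_add]; exact add_mem hx hy
    | smul k a b p =>
      rw [map_smul]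
      refine Submodule.smul_mem _ _ ?_
      by_cases h : p.length < m
      · exact ⟨_, Submodule.mem_iSup_of_mem (⟨p.length, h⟩ : Fin m) (ofPath_mem_lengthPart p), rfl⟩
      · rw [hf, toQuot_eq_zero.2 (hm _ (ofPath_mem_lengthGE p (not_lt.1 h)))]
        exact zero_mem _
  have htop : T.map f = ⊤ := by
    refine top_le_iff.1 fun x _ => ?_
    obtain ⟨x, rfl⟩ := toQuot_surjective I x
    exact key x
  exact ⟨htop ▸ hT.map f⟩

/-! ### The projective cover of the radical -/

/-- The direct sum over the arrows `s` of the projective modules `e Λ`, where `e` is the end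
of `s`. -/
def arrowModule (I : TwoSidedIdeal (PathAlgebra K V)) :
    Submodule (QuotientAlgebra I)ᵐᵒᵖ ((Σ a b : V, a ⟶ b) → QuotientAlgebra I) where
  carrier := {f | ∀ s, toQuot I (vert K s.2.1) * f s = f s}
  zero_mem' s := mul_zero _
  add_mem' {f g} hf hg s := by
    rw [Pi.add_apply, mul_add, hf, hg]
  smul_mem' r f hf s := by
    obtain ⟨r, rfl⟩ := op_surjective r
    rw [Pi.smul_apply, op_smul_eq_mul, ← mul_assoc, hf]

variable {I : TwoSidedIdeal (PathAlgebra K V)}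

/-- The map from the projective cover of the radical to the algebra. -/
noncomputable def arrowMap (I : TwoSidedIdeal (PathAlgebra K V)) :
    arrowModule I →ₗ[(QuotientAlgebra I)ᵐᵒᵖ] QuotientAlgebra I where
  toFun f := ∑ s, toQuot I (arr K s) * f.1 s
  map_add' f g := by
    simp only [Submodule.coe_add, Pi.add_apply, mul_add, Finset.sum_add_distrib]
  map_smul' r f := by
    obtain ⟨r, rfl⟩ := op_surjective r
    simp only [Submodule.coe_smul, Pi.smul_apply, op_smul_eq_mul, RingHom.id_apply, Finset.sum_mul,
      mul_assoc]

theorem arrowMap_apply (f : arrowModule I) :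
    arrowMap I f = ∑ s, toQuot I (arr K s) * f.1 s := rfl

/-- The element of the arrow module given by left division. -/
noncomputable def divVector (I : TwoSidedIdeal (PathAlgebra K V)) (x : PathAlgebra K V) :
    arrowModule I :=
  ⟨fun s => toQuot I (leftDiv s x), fun s => by rw [← map_mul, vert_mul_leftDiv]⟩

theorem arrowMap_divVector {x : PathAlgebra K V} (hx : x ∈ lengthGE K V 1) :
    arrowMap I (divVector I x) = toQuot I x := by
  conv_rhs => rw [← sum_arr_mul_leftDiv fun a => vertCoeff_eq_zero_of_mem_lengthGE hx a]
  rw [map_sum, arrowMap_apply]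
  simp only [map_mul]
  rfl

/-- Every element of the arrow module is given by left division. -/
theorem exists_divVector (f : arrowModule I) : ∃ x ∈ lengthGE K V 1, divVector I x = f ∧
    toQuot I x = arrowMap I f := by
  classical
  choose F hF using fun s => toQuot_surjective I (f.1 s)
  have hx : ∑ s, arr K s * F s ∈ lengthGE K V 1 := Submodule.sum_mem _ fun s _ =>
    lengthGE_mul_right (lengthPart_le_lengthGE le_rfl (arr_mem_lengthPart s)) _
  refine ⟨_, hx, ?_, ?_⟩
  · apply Subtype.ext
    funext s
    change toQuot I (leftDiv s (∑ s, arr K s * F s)) = _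
    rw [map_sum]
    simp only [leftDiv_arr_mul]
    rw [Finset.sum_ite_eq' , if_pos (Finset.mem_univ _), map_mul, hF]
    exact f.2 s
  · rw [map_sum, arrowMap_apply]
    simp only [map_mul, hF]

/-- The radical is the image of the arrow ideal, because `vertCoeff` vanishes on representatives of
radical elements; and left division writes the arrow ideal as a sum of multiples of arrows. -/
theorem range_arrowMap (hI : IsAdmissible I) (x : QuotientAlgebra I) :
    x ∈ Module.jacobson (QuotientAlgebra I)ᵐᵒᵖ (QuotientAlgebra I) ↔ ∃ f, arrowMap I f = x := by
  constructor
  · intro hx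
    obtain ⟨x, rfl⟩ := toQuot_surjective I x
    exact ⟨divVector I x, arrowMap_divVector
      (mem_lengthGE_one (vertCoeff_eq_zero_of_mem_jacobson hI hx))⟩
  · rintro ⟨f, rfl⟩
    obtain ⟨x, hx, -, e⟩ := exists_divVector f
    rw [← e]
    exact toQuot_mem_jacobson hI hx

/-- The generator of the arrow module at an arrow. -/
noncomputable def arrowGen (I : TwoSidedIdeal (PathAlgebra K V)) (s : Σ a b : V, a ⟶ b) :
    arrowModule I := divVector I (arr K s)

open Classical in
theorem arrowGen_apply (s t : Σ a b : V, a ⟶ b) :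
    (arrowGen I s).1 t = if s = t then toQuot I (vert K s.2.1) else 0 := by
  change toQuot I (leftDiv t (arr K s)) = _
  rw [← mul_one (arr K s), leftDiv_arr_mul]
  split_ifs with h
  · rw [mul_one, h]
  · rw [map_zero]

theorem arrowModule_val_sum {ι : Type*} (T : Finset ι) (f : ι → arrowModule I)
    (t : Σ a b : V, a ⟶ b) : (∑ i ∈ T, f i).1 t = ∑ i ∈ T, (f i).1 t := by
  have : (∑ i ∈ T, f i).1 = ∑ i ∈ T, (f i).1 := map_sum (arrowModule I).subtype _ _
  rw [this, Finset.sum_apply]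

theorem sum_smul_arrowGen (f : arrowModule I) : ∑ s, op (f.1 s) • arrowGen I s = f := by
  classical
  apply Subtype.ext
  funext t
  rw [arrowModule_val_sum, Finset.sum_eq_single t]
  · rw [Submodule.coe_smul, Pi.smul_apply, arrowGen_apply, if_pos rfl, op_smul_eq_mul]
    exact f.2 t
  · intro s _ hs
    rw [Submodule.coe_smul, Pi.smul_apply, arrowGen_apply, if_neg hs, smul_zero]
  · intro h; exact absurd (Finset.mem_univ _) h

/-- A relation among the arrows comes from an element of I, and I consists of combinations of paths
of length at least 2. After division by an arrow the coefficients still have length at least 1, so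
they are radical. -/
theorem mem_jacobson_of_arrowMap_eq_zero (hI : IsAdmissible I) (f : arrowModule I)
    (hf : arrowMap I f = 0) : f ∈ Module.jacobson (QuotientAlgebra I)ᵐᵒᵖ (arrowModule I) := by
  obtain ⟨x, -, e, hx⟩ := exists_divVector f
  rw [hf, toQuot_eq_zero] at hx
  rw [← sum_smul_arrowGen f]
  refine Submodule.sum_mem _ fun s _ => op_smul_mem_jacobson ?_ _
  rw [← e]
  exact toQuot_mem_jacobson hI (leftDiv_mem_lengthGE s (hI.le_lengthGE hx))

/-- The retraction of free modules onto the arrow module. -/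
noncomputable def arrowProj (I : TwoSidedIdeal (PathAlgebra K V)) :
    ((Σ a b : V, a ⟶ b) → QuotientAlgebra I) →ₗ[(QuotientAlgebra I)ᵐᵒᵖ] arrowModule I where
  toFun f := ⟨fun s => toQuot I (vert K s.2.1) * f s, fun s => by
    rw [← mul_assoc, ← map_mul, vert_mul_vert]⟩
  map_add' f g := Subtype.ext (funext fun s => mul_add _ _ _)
  map_smul' r f := by
    obtain ⟨r, rfl⟩ := op_surjective r
    exact Subtype.ext (funext fun s => (mul_assoc _ _ _).symm)

theorem arrowProj_coe (f : arrowModule I) : arrowProj I f.1 = f :=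
  Subtype.ext (funext fun s => f.2 s)

instance finite_arrowModule : Module.Finite (QuotientAlgebra I)ᵐᵒᵖ (arrowModule I) :=
  Module.Finite.of_surjective (arrowProj I) fun f => ⟨f.1, arrowProj_coe f⟩

instance projective_arrowModule : Module.Projective (QuotientAlgebra I)ᵐᵒᵖ (arrowModule I) :=
  Module.Projective.of_split (arrowModule I).subtype (arrowProj I)
    (LinearMap.ext fun f => arrowProj_coe f)

/-- The grading of the arrow module, with generators in degree `1`. -/
noncomputable def arrowGrading (I : TwoSidedIdeal (PathAlgebra K V)) (i : ℕ) :
    AddSubgroup (arrowModule I) where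
  carrier := {f | ∀ s, f.1 s ∈ if i = 0 then ⊥ else quotientPart I (i - 1)}
  zero_mem' _ := zero_mem _
  add_mem' hf hg s := add_mem (hf s) (hg s)
  neg_mem' hf s := neg_mem (hf s)

theorem arrowGrading_smul_mem (i j : ℕ) (f : arrowModule I) (r : QuotientAlgebra I)
    (hf : f ∈ arrowGrading I i) (hr : r ∈ quotientPart I j) :
    op r • f ∈ arrowGrading I (i + j) := by
  intro s
  have hs := hf s
  rw [Submodule.coe_smul, Pi.smul_apply, op_smul_eq_mul]
  split_ifs at hs with h
  · rw [AddSubgroup.mem_bot.1 hs, zero_mul]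
    exact zero_mem _
  · rw [if_neg (by omega)]
    have := quotientPart_mul hs hr
    rwa [show i - 1 + j = i + j - 1 by omega] at this

theorem arrowMap_mem (i : ℕ) (f : arrowModule I) (hf : f ∈ arrowGrading I i) :
    arrowMap I f ∈ quotientPart I i := by
  rw [arrowMap_apply]
  refine AddSubgroup.sum_mem _ fun s _ => ?_
  have hs := hf s
  split_ifs at hs with h
  · rw [AddSubgroup.mem_bot.1 hs, mul_zero]
    exact zero_mem _
  · have := quotientPart_mul (toQuot_mem_quotientPart I (arr_mem_lengthPart s)) hs
    rwa [show 1 + (i - 1) = i by omega] at this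

theorem isInternal_arrowGrading (hI : IsLengthHomogeneous I) :
    DirectSum.IsInternal (arrowGrading I) := by
  obtain ⟨q, hq⟩ := (isInternal_quotientPart hI).exists_isGradingProj
  have hq0 : ∀ i a x, q i (toQuot I (vert K a) * x) = toQuot I (vert K a) * q i x := by
    intro i a x
    have h0 := toQuot_mem_quotientPart I (vert_mem_lengthPart (K := K) a)
    have := hq.map_proj hq (AddMonoidHom.mulLeft (toQuot I (vert K a))) id Function.injective_id
      (fun i x hx => by simpa using quotientPart_mul h0 hx) i x
    exact this
  let P : ℕ → arrowModule I →+ arrowModule I := fun i =>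
    { toFun := fun f => ⟨fun s => if i = 0 then 0 else q (i - 1) (f.1 s), fun s => by
        split_ifs
        · exact mul_zero _
        · rw [← hq0, f.2 s]⟩
      map_zero' := by
        apply Subtype.ext; funext s; simp
      map_add' := fun f g => by
        apply Subtype.ext; funext s
        simp only [Submodule.coe_add, Pi.add_apply, map_add]
        split_ifs <;> simp }
  have hP : ∀ i f s, (P i f).1 s = if i = 0 then 0 else q (i - 1) (f.1 s) := fun _ _ _ => rfl
  refine IsGradingProj.isInternal (p := P) ⟨fun i f s => ?_, fun i f hf => ?_,
    fun i j hij f hf => ?_, fun f => ?_⟩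
  · rw [hP]
    split_ifs
    · exact zero_mem _
    · exact hq.mem _ _
  · apply Subtype.ext; funext s
    have hs := hf s
    rw [hP]
    split_ifs at hs ⊢
    · exact (AddSubgroup.mem_bot.1 hs).symm
    · exact hq.same _ _ hs
  · apply Subtype.ext; funext s
    have hs := hf s
    rw [hP]
    change _ = (0 : QuotientAlgebra I)
    split_ifs with hj
    · rfl
    · split_ifs at hs with hi
      · rw [AddSubgroup.mem_bot.1 hs, map_zero]
      · exact hq.ne _ _ (by omega) _ hs
  · choose N hN using fun s => hq.sum (f.1 s)
    refine ⟨(∑ s, N s) + 1, fun n hn => ?_⟩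
    apply Subtype.ext; funext s
    rw [arrowModule_val_sum]
    have hs : N s ≤ ∑ s, N s := Finset.single_le_sum (fun _ _ => Nat.zero_le _) (Finset.mem_univ s)
    obtain ⟨n, rfl⟩ := Nat.exists_eq_add_of_le' (show 1 ≤ n by omega)
    rw [Finset.sum_range_succ']
    simp only [hP, Nat.add_sub_cancel, if_true, Nat.add_eq_zero_iff, one_ne_zero, and_false,
      if_false, add_zero]
    exact hN s n (by omega)

theorem arrowGen_mem (s : Σ a b : V, a ⟶ b) : arrowGen I s ∈ arrowGrading I 1 := by
  classical
  intro t
  rw [if_neg one_ne_zero, arrowGen_apply]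
  split_ifs
  · exact toQuot_mem_quotientPart I (vert_mem_lengthPart _)
  · exact zero_mem _

theorem span_arrowGrading (I : TwoSidedIdeal (PathAlgebra K V)) :
    Submodule.span (QuotientAlgebra I)ᵐᵒᵖ (arrowGrading I 1 : Set (arrowModule I)) = ⊤ := by
  refine top_le_iff.1 fun f _ => ?_
  rw [← sum_smul_arrowGen f]
  exact Submodule.sum_mem _ fun s _ =>
    Submodule.smul_mem _ _ (Submodule.subset_span (arrowGen_mem s))

theorem span_quotientPart_zero (I : TwoSidedIdeal (PathAlgebra K V)) :
    Submodule.span (QuotientAlgebra I)ᵐᵒᵖ (quotientPart I 0 : Set (QuotientAlgebra I)) = ⊤ := by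
  refine top_le_iff.1 fun f _ => ?_
  have := Submodule.smul_mem (Submodule.span (QuotientAlgebra I)ᵐᵒᵖ _) (op f)
    (Submodule.subset_span (s := (quotientPart I 0 : Set (QuotientAlgebra I)))
      (one_mem_quotientPart I))
  rwa [op_smul_eq_mul, one_mul] at this

end PathAlgebra

namespace MinimalGradedResolution

/-! ### The first two terms of a minimal graded resolution -/

attribute [instance] MinimalGradedResolution.finite MinimalGradedResolution.projective

open PathAlgebra

variable {K : Type w} [Field K] {V : Type u} [Quiver.{v} V] [Fintype V]
  [∀ a b : V, Fintype (a ⟶ b)] {I : TwoSidedIdeal (PathAlgebra K V)}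

/-- The linear map from the ring given by an element of a right module. -/
def ofElement {R M : Type*} [Ring R] [AddCommGroup M] [Module Rᵐᵒᵖ M] (x : M) : R →ₗ[Rᵐᵒᵖ] M where
  toFun r := op r • x
  map_add' a b := by rw [op_add, add_smul]
  map_smul' a b := by
    rw [RingHom.id_apply, smul_smul]
    rfl

theorem ofElement_apply {R M : Type*} [Ring R] [AddCommGroup M] [Module Rᵐᵒᵖ M] (x : M) (r : R) :
    ofElement x r = op r • x := rfl

/-- The components of positive degree of a preimage of 1 map into the radical, that is, to 0 in the
top, so the component of degree 0 is a preimage too. -/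
theorem exists_generator (hI : IsAdmissible I)
    (P : MinimalGradedResolution (QuotientAlgebra I) (quotientPart I)) :
    ∃ x ∈ P.grading 0 0, P.aug x = (Module.jacobson (QuotientAlgebra I)ᵐᵒᵖ _).mkQ 1 := by
  obtain ⟨p, hp⟩ := (P.isInternal 0).exists_isGradingProj
  obtain ⟨x, hx⟩ := P.aug_surjective ((Module.jacobson (QuotientAlgebra I)ᵐᵒᵖ _).mkQ 1)
  refine ⟨p 0 x, hp.mem _ _, ?_⟩
  obtain ⟨N, hN⟩ := hp.sum x
  rw [← hx]
  conv_rhs => rw [← hN (N + 1) (by omega), map_sum]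
  rw [Finset.sum_eq_single 0]
  · intro i _ hi
    obtain ⟨r, hr, e⟩ := P.aug_mem i _ (hp.mem i x)
    rw [e, Submodule.mkQ_apply, Submodule.Quotient.mk_eq_zero]
    exact quotientPart_le_jacobson hI i (Nat.pos_of_ne_zero hi) r hr
  · intro h
    exact absurd (Finset.mem_range.2 (by omega)) h

theorem aug_op_smul (P : MinimalGradedResolution (QuotientAlgebra I) (quotientPart I))
    {x : P.P 0} (hx : P.aug x = (Module.jacobson (QuotientAlgebra I)ᵐᵒᵖ _).mkQ 1)
    (r : QuotientAlgebra I) :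
    P.aug (op r • x) = (Module.jacobson (QuotientAlgebra I)ᵐᵒᵖ _).mkQ r := by
  rw [map_smul, hx, ← map_smul, op_smul_eq_mul, one_mul]

/-- This identifies P 0 with the algebra. By minimality the kernel of the augmentation is radical,
so Nakayama gives surjectivity; the kernel of the map is radical as well and P 0 is projective, so
the map is injective. -/
theorem bijective_ofElement (P : MinimalGradedResolution (QuotientAlgebra I) (quotientPart I))
    {x : P.P 0} (hx : P.aug x = (Module.jacobson (QuotientAlgebra I)ᵐᵒᵖ _).mkQ 1) :
    Function.Bijective (ofElement (R := QuotientAlgebra I) x) := by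
  have surj : Function.Surjective (ofElement (R := QuotientAlgebra I) x) := by
    refine surjective_of_sup_jacobson _ fun y => ?_
    obtain ⟨r, hr⟩ := Submodule.mkQ_surjective _ (P.aug y)
    refine ⟨r, ?_⟩
    obtain ⟨z, hz⟩ := (P.exact_zero (y - ofElement x r)).1 (by
      rw [map_sub, ofElement_apply, aug_op_smul P hx, hr, sub_self])
    rw [← hz]
    exact P.minimal 0 z
  refine ⟨injective_of_ker_le_jacobson _ surj fun r hr => ?_, surj⟩
  have := aug_op_smul P hx r
  rw [← ofElement_apply, hr, map_zero, eq_comm, Submodule.mkQ_apply,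
    Submodule.Quotient.mk_eq_zero] at this
  exact this

theorem exists_arrow_lift (hI : IsAdmissible I)
    (P : MinimalGradedResolution (QuotientAlgebra I) (quotientPart I)) {x : P.P 0}
    (h0 : x ∈ P.grading 0 0) (hx : P.aug x = (Module.jacobson (QuotientAlgebra I)ᵐᵒᵖ _).mkQ 1)
    (s : Σ a b : V, a ⟶ b) :
    ∃ y ∈ P.grading 1 1, P.d 0 y = op (toQuot I (arr K s)) • x := by
  have hs := toQuot_mem_quotientPart I (arr_mem_lengthPart (K := K) s)
  have hdeg := P.smul_mem 0 0 1 x _ h0 hs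
  obtain ⟨y, hy⟩ := (P.exact_zero (op (toQuot I (arr K s)) • x)).1 (by
    rw [aug_op_smul P hx, Submodule.mkQ_apply, Submodule.Quotient.mk_eq_zero]
    exact quotientPart_le_jacobson hI 1 one_pos _ hs)
  obtain ⟨p, hp⟩ := (P.isInternal 1).exists_isGradingProj
  obtain ⟨q, hq⟩ := (P.isInternal 0).exists_isGradingProj
  refine ⟨p 1 y, hp.mem _ _, ?_⟩
  have := hp.map_proj hq (P.d 0).toAddMonoidHom id Function.injective_id (P.d_mem 0) 1 y
  change q 1 (P.d 0 y) = P.d 0 (p 1 y) at this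
  rw [← this, hy]
  exact hq.same _ _ hdeg

/-- A minimal graded resolution can be made to end in the standard presentation of the radical. -/
theorem exists_presentation (hI : IsAdmissible I) (hh : IsLengthHomogeneous I)
    (P : MinimalGradedResolution (QuotientAlgebra I) (quotientPart I)) :
    ∃ D : P.P 2 →ₗ[(QuotientAlgebra I)ᵐᵒᵖ] arrowModule I,
      (∀ i, ∀ y ∈ P.grading 2 i, D y ∈ arrowGrading I i) ∧ Function.Exact (P.d 2) D ∧
      Function.Exact D (arrowMap I) := by
  obtain ⟨x, h0, hx⟩ := exists_generator hI P
  have hbij := bijective_ofElement P hx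
  choose y hy1 hy using exists_arrow_lift hI P h0 hx
  -- ψ sends the generator at s to the lift y s of the arrow s. It will be an isomorphism onto P 1
  -- compatible with the maps to the algebra, and D is the differential P 2 → P 1 followed by its
  -- inverse.
  let ψ : arrowModule I →ₗ[(QuotientAlgebra I)ᵐᵒᵖ] P.P 1 :=
    { toFun := fun f => ∑ s, op (f.1 s) • y s
      map_add' := fun f g => by
        simp only [Submodule.coe_add, Pi.add_apply, op_add, add_smul, Finset.sum_add_distrib]
      map_smul' := fun r f => by
        obtain ⟨r, rfl⟩ := op_surjective r
        simp only [Submodule.coe_smul, Pi.smul_apply, op_smul_eq_mul, op_mul, mul_smul,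
          RingHom.id_apply, Finset.smul_sum] }
  have hψ : ∀ f, ψ f = ∑ s, op (f.1 s) • y s := fun f => rfl
  have hd : ∀ f, P.d 0 (ψ f) = ofElement x (arrowMap I f) := by
    intro f
    rw [hψ, map_sum, arrowMap_apply, map_sum]
    refine Finset.sum_congr rfl fun s _ => ?_
    rw [map_smul, hy, ofElement_apply, op_mul, mul_smul]
  have hsurj : Function.Surjective ψ := by
    refine surjective_of_sup_jacobson _ fun z => ?_
    obtain ⟨r, hr⟩ := hbij.2 (P.d 0 z)
    have hr' : r ∈ Module.jacobson (QuotientAlgebra I)ᵐᵒᵖ (QuotientAlgebra I) := by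
      have := aug_op_smul P hx r
      rw [← ofElement_apply, hr, P.exact_zero.apply_apply_eq_zero, eq_comm, Submodule.mkQ_apply,
        Submodule.Quotient.mk_eq_zero] at this
      exact this
    obtain ⟨f, rfl⟩ := (range_arrowMap hI r).1 hr'
    refine ⟨f, ?_⟩
    -- The difference z - ψ f is a cycle, hence a boundary, hence in the radical by minimality;
    -- Nakayama applies.
    obtain ⟨t, ht⟩ := (P.exact_succ 0 (z - ψ f)).1 (by rw [map_sub, hd, hr, sub_self])
    rw [← ht]
    exact P.minimal 1 t
  have hinj : Function.Injective ψ := by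
    refine injective_of_ker_le_jacobson ψ hsurj fun f hf => ?_
    refine mem_jacobson_of_arrowMap_eq_zero hI f (hbij.1 ?_)
    rw [← hd, hf, map_zero, map_zero]
  have hgr : ∀ i, ∀ f ∈ arrowGrading I i, ψ f ∈ P.grading 1 i := by
    intro i f hf
    rw [hψ]
    refine AddSubgroup.sum_mem _ fun s _ => ?_
    have hs := hf s
    split_ifs at hs with h
    · rw [AddSubgroup.mem_bot.1 hs, op_zero, zero_smul]
      exact zero_mem _
    · have := P.smul_mem 1 1 (i - 1) _ _ (hy1 s) hs
      rwa [show 1 + (i - 1) = i by omega] at this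
  let e := LinearEquiv.ofBijective ψ ⟨hinj, hsurj⟩
  have he : ∀ z, ψ (e.symm z) = z := fun z => e.apply_symm_apply z
  refine ⟨e.symm.toLinearMap ∘ₗ P.d 1, fun i z hz => ?_, fun z => ?_, fun f => ?_⟩
  · obtain ⟨p, hp⟩ := (isInternal_arrowGrading hh).exists_isGradingProj
    obtain ⟨q, hq⟩ := (P.isInternal 1).exists_isGradingProj
    refine hp.inverse_mem hq ψ.toAddMonoidHom hgr hinj i _ ?_
    change ψ (e.symm (P.d 1 z)) ∈ _
    rw [he]
    exact P.d_mem 1 i z hz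
  · rw [← P.exact_succ 1 z]
    exact e.symm.map_eq_zero_iff
  · have h1 : arrowMap I f = 0 ↔ P.d 0 (ψ f) = 0 := by
      rw [hd, ← map_zero (ofElement (R := QuotientAlgebra I) x), hbij.1.eq_iff]
    rw [h1, P.exact_succ 0 (ψ f)]
    constructor
    · rintro ⟨z, hz⟩
      exact ⟨z, hinj ((he _).trans hz)⟩
    · rintro ⟨z, rfl⟩
      exact ⟨z, (he _).symm⟩

end MinimalGradedResolution

open PathAlgebra

namespace PathAlgebra

variable {K : Type w} [Field K] {V : Type u} [Quiver.{v} V]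

theorem ofPath_cast {a b a' b' : V} (h : a = a') (h' : b = b') (p : Quiver.Path a b) :
    ofPath K (p.cast h h') = ofPath K p := by
  subst h h'
  rfl

theorem leftDivPath_eq_zero (s : Σ a b : V, a ⟶ b) {a b : V} (p : Quiver.Path a b) (h : a ≠ s.1) :
    (leftDivPath s p : PathAlgebra K V) = 0 := by
  induction p with
  | nil => rw [leftDivPath]
  | cons p β ih =>
    rw [leftDivPath]
    split_ifs with h1 h2
    · exfalso
      have e := Quiver.Path.eq_of_length_zero p h1
      subst h2
      exact h e
    · rfl
    · rw [ih, zero_mul]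

theorem leftDiv_vert_mul_of_ne (s : Σ a b : V, a ⟶ b) {c : V} (h : c ≠ s.1)
    (x : PathAlgebra K V) : leftDiv s (vert K c * x) = 0 := by
  induction x using induction_on with
  | zero => rw [mul_zero, map_zero]
  | add x y hx hy => rw [mul_add, map_add, hx, hy, add_zero]
  | smul k a b p =>
    rw [PathAlgebra.mul_smul, map_smul]
    by_cases hc : c = a
    · subst hc
      rw [vert_mul_ofPath, leftDiv_ofPath, leftDivPath_eq_zero s p h, smul_zero]
    · rw [vert_mul_ofPath_of_ne _ hc, map_zero, smul_zero]

end PathAlgebra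

namespace StretchedVertex

variable {V : Type u} [Quiver.{v} V] {A : ℕ}

/-! ### Collapsing the stretched quiver -/

/-- The origin of the arrow on which a vertex lies. -/
def base : StretchedVertex V A → V
  | Sum.inl a => a
  | Sum.inr x => x.1

/-- The distance to the origin of the arrow on which a vertex lies. -/
def level : StretchedVertex V A → ℕ
  | Sum.inl _ => 0
  | Sum.inr x => x.2.2.2.1 + 1

theorem on_succ {a b : V} (α : a ⟶ b) {j : ℕ} (h : j < A - 1) :
    (on α (j + 1) : StretchedVertex V A) = Sum.inr ⟨a, b, α, ⟨j, h⟩⟩ := dif_pos h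

theorem base_on {a b : V} (α : a ⟶ b) {j : ℕ} (h : j < A) :
    base (on α j : StretchedVertex V A) = a := by
  cases j with
  | zero => rfl
  | succ j => rw [on_succ α (by omega)]; rfl

theorem level_on {a b : V} (α : a ⟶ b) {j : ℕ} (h : j < A) :
    level (on α j : StretchedVertex V A) = j := by
  cases j with
  | zero => rfl
  | succ j => rw [on_succ α (by omega)]; rfl

theorem level_lt (hA : 1 ≤ A) (v : StretchedVertex V A) : level v < A := by
  rcases v with a | ⟨a, b, α, i⟩
  · exact hA
  · have := i.2
    change i.1 + 1 < A
    omega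

theorem eq_old_of_level {v : StretchedVertex V A} (h : level v = 0) : v = old (base v) := by
  rcases v with a | ⟨a, b, α, i⟩
  · rfl
  · exact absurd h (Nat.succ_ne_zero _)

theorem eq_on_last (hA : 1 ≤ A) {a b : V} (α : a ⟶ b) {j : ℕ} (hj : j < A) (h : ¬ j + 1 < A) :
    (on α (j + 1) : StretchedVertex V A) = old b := by
  have : j + 1 = A := by omega
  rw [this, on_last hA]

variable (K : Type w) [Field K]

/-- The collapse of an arrow of the stretched quiver: the last arrow on the path replacing `α`
is mapped to `α`, the others to a trivial path. -/
noncomputable def collapseArrow : ∀ {u v : StretchedVertex V A}, (u ⟶ v) → PathAlgebra K V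
  | _, _, Arrow.mk (a := a) (b := b) α j _ => if j + 1 < A then vert K a else arr K ⟨a, b, α⟩

/-- The collapse of a path of the stretched quiver. -/
noncomputable def collapse {u : StretchedVertex V A} :
    ∀ {v : StretchedVertex V A}, Quiver.Path u v → PathAlgebra K V
  | _, .nil => vert K (base u)
  | _, .cons p α => collapse p * collapseArrow K α

/-- The path from the origin of the arrow on which a vertex lies to this vertex. -/
noncomputable def tail : StretchedVertex V A → PathAlgebra K (StretchedVertex V A)
  | Sum.inl a => vert K (old a)
  | Sum.inr ⟨_, _, α, i⟩ => ofPath K (initialPath α (i.1 + 1) (by have := i.2; omega))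

/-- The idempotent at an old vertex, and `0` at a new one. -/
noncomputable def oldIdem : StretchedVertex V A → PathAlgebra K V
  | Sum.inl a => vert K a
  | Sum.inr _ => 0

variable {K}

theorem oldIdem_old (a : V) : oldIdem K (old a : StretchedVertex V A) = vert K a := rfl

theorem tail_on {a b : V} (α : a ⟶ b) {j : ℕ} (h : j < A) :
    tail K (on α j : StretchedVertex V A) = ofPath K (initialPath α j h.le) := by
  cases j with
  | zero => rfl
  | succ j => exact congrArg (tail K) (on_succ α (by omega))

theorem tail_mul_vert (v : StretchedVertex V A) : tail K v * vert K v = tail K v := by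
  rcases v with a | ⟨a, b, α, i⟩
  · exact vert_mul_vert _
  · have h : i.1 + 1 < A := by have := i.2; omega
    have e := on_succ (A := A) α i.2
    have := ofPath_mul_vert (K := K) (initialPath α (i.1 + 1) h.le)
    rw [← tail_on α h] at this
    rwa [e] at this

theorem length_initialPath {a b : V} (α : a ⟶ b) (j : ℕ) (h : j ≤ A) :
    (initialPath (A := A) α j h).length = j := by
  induction j with
  | zero => rfl
  | succ j ih => exact congrArg (· + 1) (ih _)

theorem tail_mem_lengthPart (v : StretchedVertex V A) :
    tail K v ∈ lengthPart K (StretchedVertex V A) (level v) := by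
  rcases v with a | ⟨a, b, α, i⟩
  · exact vert_mem_lengthPart _
  · have := ofPath_mem_lengthPart (K := K)
      (initialPath (A := A) α (i.1 + 1) (by have := i.2; omega))
    rw [length_initialPath] at this
    exact this

theorem collapseArrow_mul_vert (hA : 1 ≤ A) {u v : StretchedVertex V A} (α : u ⟶ v) :
    collapseArrow K α * vert K (base v) = collapseArrow K α := by
  rcases α with ⟨α, j, hj⟩
  rw [collapseArrow]
  split_ifs with h
  · rw [base_on α h]; exact vert_mul_vert _
  · rw [eq_on_last hA α hj h]
    exact arr_mul_vert ⟨_, _, α⟩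

theorem collapse_mul_vert (hA : 1 ≤ A) {u v : StretchedVertex V A} (p : Quiver.Path u v) :
    collapse K p * vert K (base v) = collapse K p := by
  cases p with
  | nil => exact vert_mul_vert _
  | cons p α => rw [collapse, mul_assoc, collapseArrow_mul_vert hA]

theorem collapse_comp (hA : 1 ≤ A) {u v z : StretchedVertex V A} (p : Quiver.Path u v)
    (q : Quiver.Path v z) : collapse K (p.comp q) = collapse K p * collapse K q := by
  induction q with
  | nil => rw [Quiver.Path.comp_nil, collapse, collapse_mul_vert hA]
  | cons q α ih => rw [Quiver.Path.comp_cons, collapse, ih, mul_assoc, collapse]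

theorem collapse_cast {u v u' v' : StretchedVertex V A} (h : u = u') (h' : v = v')
    (p : Quiver.Path u v) : collapse K (p.cast h h') = collapse K p := by
  subst h h'
  rfl

theorem collapse_initialPath_of_lt {a b : V} (α : a ⟶ b) (j : ℕ) (h : j < A) :
    collapse K (initialPath (A := A) α j h.le) = vert K a := by
  induction j with
  | zero => rfl
  | succ j ih =>
    rw [initialPath, collapse, ih (by omega), collapseArrow, if_pos h]
    exact vert_mul_vert a

theorem collapse_arrowPath (hA : 1 ≤ A) {a b : V} (α : a ⟶ b) :
    collapse K (arrowPath hA α) = arr K ⟨a, b, α⟩ := by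
  rw [arrowPath, collapse_cast]
  obtain ⟨n, rfl⟩ := Nat.exists_eq_add_of_le' hA
  rw [initialPath, collapse, collapse_initialPath_of_lt α n (by omega), collapseArrow,
    if_neg (by omega)]
  exact vert_mul_arr ⟨a, b, α⟩

theorem collapse_stretchPath (hA : 1 ≤ A) {a b : V} (p : Quiver.Path a b) :
    collapse K (stretchPath hA p) = ofPath K p := by
  induction p with
  | nil => rfl
  | cons p α ih => rw [stretchPath, collapse_comp hA, ih, collapse_arrowPath, ofPath_cons]

theorem length_cast {u v u' v' : V} (h : u = u') (h' : v = v') (p : Quiver.Path u v) :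
    (p.cast h h').length = p.length := by
  subst h h'
  rfl

theorem length_stretchPath (hA : 1 ≤ A) {a b : V} (p : Quiver.Path a b) :
    (stretchPath hA p).length = A * p.length := by
  induction p with
  | nil => rfl
  | cons p α ih =>
    rw [stretchPath, Quiver.Path.length_comp, ih, Quiver.Path.length_cons, arrowPath, length_cast,
      length_initialPath, mul_add, mul_one]

theorem collapseArrow_mem (hA : 1 ≤ A) {u v : StretchedVertex V A} (α : u ⟶ v) :
    ∃ k, A * k + level v = level u + 1 ∧ collapseArrow K α ∈ lengthPart K V k := by
  rcases α with ⟨α, j, hj⟩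
  rw [level_on α hj, collapseArrow]
  split_ifs with h
  · exact ⟨0, by rw [level_on α h]; omega, vert_mem_lengthPart _⟩
  · refine ⟨1, ?_, arr_mem_lengthPart ⟨_, _, α⟩⟩
    rw [eq_on_last hA α hj h]
    change A * 1 + 0 = _
    omega

/-- Each arrow either raises the level by one and collapses to a vertex, or completes a stretched
arrow: then the level drops from A - 1 to 0 and the collapse gains one arrow. -/
theorem collapse_mem (hA : 1 ≤ A) {u v : StretchedVertex V A} (p : Quiver.Path u v) :
    ∃ k, A * k + level v = level u + p.length ∧ collapse K p ∈ lengthPart K V k := by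
  induction p with
  | nil => exact ⟨0, by simp, vert_mem_lengthPart _⟩
  | cons p α ih =>
    obtain ⟨k, hk, h⟩ := ih
    obtain ⟨l, hl, h'⟩ := collapseArrow_mem (K := K) hA α
    refine ⟨k + l, ?_, lengthPart_mul h h'⟩
    rw [Quiver.Path.length_cons, mul_add]
    omega

theorem theta_ofPath (hA : 1 ≤ A) {a b : V} (p : Quiver.Path a b) :
    theta hA (ofPath K p) = ofPath K (stretchPath (A := A) hA p) :=
  thetaLinear_ofPath hA p

theorem theta_vert (hA : 1 ≤ A) (a : V) :
    theta hA (vert K a) = vert K (old a : StretchedVertex V A) :=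
  theta_ofPath hA _

theorem theta_arr (hA : 1 ≤ A) {a b : V} (α : a ⟶ b) :
    theta hA (arr K ⟨a, b, α⟩) = ofPath K (initialPath (A := A) α A le_rfl) := by
  rw [arr, theta_ofPath]
  change ofPath K (Quiver.Path.nil.comp (arrowPath hA α)) = _
  rw [Quiver.Path.nil_comp, arrowPath, ofPath_cast]

/-- Appending an arrow to the incomplete stretched arrow `tail K u` either gives a longer incomplete
one, or completes it to θ*(α). Collapsing the last arrow, and no other, to α matches this. -/
theorem theta_collapseArrow_mul (hA : 1 ≤ A) {u v : StretchedVertex V A} (α : u ⟶ v) :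
    theta hA (collapseArrow K α) * tail K v = tail K u * arr K ⟨u, v, α⟩ := by
  rcases α with ⟨α, j, hj⟩
  have e : ofPath K (initialPath (A := A) α (j + 1) hj) =
      tail K (on α j) * arr K ⟨on α j, on α (j + 1), Arrow.mk α j hj⟩ := by
    rw [tail_on α hj, ← ofPath_cons]
    rfl
  rw [← e, collapseArrow]
  split_ifs with h
  · rw [tail_on α h, theta_vert, vert_mul_ofPath]
  · have h1 : j + 1 = A := by omega
    have h3 : tail K (on α (j + 1) : StretchedVertex V A) = vert K (old _) :=
      congrArg (tail K) (eq_on_last hA α hj h)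
    rw [theta_arr, h3]
    subst h1
    have h2 := ofPath_mul_vert (K := K) (initialPath (A := j + 1) α (j + 1) le_rfl)
    have h4 : vert K (on α (j + 1) : StretchedVertex V (j + 1)) = vert K (old _) :=
      congrArg (vert K) (on_last hA α)
    rw [h4] at h2
    exact h2

/-- This is the normal form behind the decomposition of eS: a path preceded by its initial tail is a
stretched path followed by the final tail. -/
theorem theta_collapse_mul (hA : 1 ≤ A) {u v : StretchedVertex V A} (p : Quiver.Path u v) :
    theta hA (collapse K p) * tail K v = tail K u * ofPath K p := by
  induction p with
  | nil =>
    change theta hA (vert K (base u)) * tail K u = tail K u * vert K u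
    rw [tail_mul_vert, theta_vert]
    rcases u with a | ⟨a, b, α, i⟩
    · exact vert_mul_vert _
    · exact vert_mul_ofPath _
  | cons p α ih =>
    rw [collapse, map_mul, mul_assoc, theta_collapseArrow_mul, ← mul_assoc, ih, mul_assoc,
      ofPath_cons]

theorem theta_mem_lengthPart (hA : 1 ≤ A) {n : ℕ} {x : PathAlgebra K V}
    (hx : x ∈ lengthPart K V n) : theta hA x ∈ lengthPart K (StretchedVertex V A) (A * n) := by
  induction hx using Submodule.span_induction with
  | mem x hx =>
    obtain ⟨a, b, p, rfl, rfl⟩ := hx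
    rw [theta_ofPath, ← length_stretchPath hA]
    exact ofPath_mem_lengthPart _
  | zero => rw [map_zero]; exact zero_mem _
  | add x y _ _ hx hy => rw [map_add]; exact add_mem hx hy
  | smul k x _ hx => rw [map_smul]; exact Submodule.smul_mem _ _ hx

theorem theta_mem_lengthGE (hA : 1 ≤ A) {n : ℕ} {x : PathAlgebra K V}
    (hx : x ∈ lengthGE K V n) : theta hA x ∈ lengthGE K (StretchedVertex V A) n := by
  induction hx using Submodule.span_induction with
  | mem x hx =>
    obtain ⟨a, b, p, hp, rfl⟩ := hx
    rw [theta_ofPath]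
    refine ofPath_mem_lengthGE _ ?_
    rw [length_stretchPath]
    exact hp.trans (Nat.le_mul_of_pos_left _ hA)
  | zero => rw [map_zero]; exact zero_mem _
  | add x y _ _ hx hy => rw [map_add]; exact add_mem hx hy
  | smul k x _ hx => rw [map_smul]; exact Submodule.smul_mem _ _ hx

theorem vert_mul_theta_of_level (hA : 1 ≤ A) {u : StretchedVertex V A} (hu : level u ≠ 0)
    (x : PathAlgebra K V) : vert K u * theta hA x = 0 := by
  induction x using induction_on with
  | zero => rw [map_zero, mul_zero]
  | add x y hx hy => rw [map_add, mul_add, hx, hy, add_zero]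
  | smul k a b p =>
    rw [map_smul, PathAlgebra.mul_smul, theta_ofPath, vert_mul_ofPath_of_ne, smul_zero]
    rintro rfl
    exact hu rfl

/-! ### The matrix representation -/

open Classical in
/-- The matrix representation of the stretched path algebra. -/
noncomputable def pathRep : PathAlgebra K (StretchedVertex V A) →ₗ[K]
    Matrix (StretchedVertex V A) (StretchedVertex V A) (PathAlgebra K V) :=
  liftPath K fun p => Matrix.single p.1 p.2.1 (collapse K p.2.2)

open Classical in
theorem pathRep_ofPath {u v : StretchedVertex V A} (p : Quiver.Path u v) :
    pathRep (ofPath K p) = Matrix.single u v (collapse K p) :=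
  liftPath_ofPath _ _ _

/-- A stretched path joins old vertices and collapses back to the path it came from, so only entries
at old positions can be nonzero. -/
theorem pathRep_theta (hA : 1 ≤ A) (x : PathAlgebra K V) (u v : StretchedVertex V A) :
    pathRep (theta hA x) u v = oldIdem K u * x * oldIdem K v := by
  classical
  induction x using induction_on with
  | zero => simp
  | add x y hx hy => rw [map_add, map_add, Matrix.add_apply, hx, hy, mul_add, add_mul]
  | smul k a b p =>
    rw [map_smul, map_smul, Matrix.smul_apply, PathAlgebra.mul_smul, PathAlgebra.smul_mul,
      theta_ofPath, pathRep_ofPath, collapse_stretchPath]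
    congr 1
    rcases u with c | c
    · by_cases hc : a = c
      · subst hc
        rcases v with d | d
        · by_cases hd : b = d
          · subst hd
            change Matrix.single (old a) (old b) _ (old a) (old b) = vert K a * ofPath K p * vert K b
            rw [Matrix.single_apply_same, vert_mul_ofPath, ofPath_mul_vert]
          · change Matrix.single (old a) (old b) _ (old a) (old d) = vert K a * ofPath K p * vert K d
            rw [vert_mul_ofPath, ofPath_mul_vert_of_ne _ (Ne.symm hd), Matrix.single_apply_of_ne]
            rintro ⟨-, h⟩
            exact hd (Sum.inl.inj h)
        · change _ = _ * _ * 0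
          rw [mul_zero]
          exact Matrix.single_apply_of_ne (old a) (old b) _ (Sum.inl a) (Sum.inr d)
            fun h => Sum.inl_ne_inr h.2
      · change _ = vert K c * _ * _
        rw [vert_mul_ofPath_of_ne _ (Ne.symm hc), zero_mul]
        exact Matrix.single_apply_of_ne (old a) (old b) _ (Sum.inl c) v
          fun h => hc (Sum.inl.inj h.1)
    · change _ = 0 * _ * _
      rw [zero_mul, zero_mul]
      exact Matrix.single_apply_of_ne (old a) (old b) _ (Sum.inr c) v
        fun h => Sum.inl_ne_inr h.1

open Classical in
theorem pathRep_tail (v u w : StretchedVertex V A) : pathRep (tail K v) u w =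
    Matrix.single (old (base v) : StretchedVertex V A) v (vert K (base v)) u w := by
  classical
  rcases v with a | ⟨a, b, α, i⟩
  · exact congrFun (congrFun (pathRep_ofPath (K := K) (Quiver.Path.nil : Quiver.Path
      (old a : StretchedVertex V A) (old a))) u) w
  · have h : i.1 + 1 < A := by have := i.2; omega
    have e := on_succ (A := A) α i.2
    have := pathRep_ofPath (K := K) (initialPath α (i.1 + 1) h.le)
    rw [collapse_initialPath_of_lt α _ h, ← tail_on α h] at this
    rw [e] at this
    exact congrFun (congrFun this u) w

variable [Fintype V] [∀ a b : V, Fintype (a ⟶ b)]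

theorem pathRep_mul (hA : 1 ≤ A) (x y : PathAlgebra K (StretchedVertex V A)) :
    pathRep (x * y) = pathRep x * pathRep y := by
  classical
  induction x using induction_on with
  | zero => simp
  | add x x' hx hx' => rw [add_mul, map_add, hx, hx', map_add, add_mul]
  | smul k a b p =>
    rw [PathAlgebra.smul_mul, map_smul, map_smul, Matrix.smul_mul]
    congr 1
    induction y using induction_on with
    | zero => simp
    | add y y' hy hy' => rw [mul_add, map_add, hy, hy', map_add, mul_add]
    | smul k c d q =>
      rw [PathAlgebra.mul_smul, map_smul, map_smul, Matrix.mul_smul]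
      congr 1
      by_cases h : c = b
      · subst h
        rw [ofPath_mul_comp, pathRep_ofPath, pathRep_ofPath, pathRep_ofPath,
          Matrix.single_mul_single_same, collapse_comp hA]
      · rw [ofPath_mul_of_ne _ _ h, map_zero, pathRep_ofPath, pathRep_ofPath,
          Matrix.single_mul_single_of_ne _ _ _ _ (Ne.symm h)]

open Classical in
theorem pathRep_one (u v : StretchedVertex V A) :
    pathRep (1 : PathAlgebra K (StretchedVertex V A)) u v =
      if u = v then vert K (base v) else 0 := by
  rw [one_eq_sum_vert, map_sum, Matrix.sum_apply]
  have : ∀ z : StretchedVertex V A,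
      pathRep (vert K z) = Matrix.single z z (vert K (base z)) := fun z => by
    rw [vert, pathRep_ofPath, collapse]
  simp only [this]
  split_ifs with h
  · subst h
    rw [Finset.sum_eq_single u]
    · exact Matrix.single_apply_same _ _ _
    · intro z _ hz
      exact Matrix.single_apply_of_ne _ _ _ _ _ (fun h => hz h.1)
    · intro h; exact absurd (Finset.mem_univ _) h
  · refine Finset.sum_eq_zero fun z _ => Matrix.single_apply_of_ne _ _ _ _ _ ?_
    rintro ⟨rfl, h'⟩
    exact h h'

/-- The linear extension of `theta_collapse_mul`: the matrix `pathRep x` describes right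
multiplication by x on the tails. -/
theorem sum_theta_pathRep_mul (hA : 1 ≤ A) (x : PathAlgebra K (StretchedVertex V A))
    (u : StretchedVertex V A) :
    ∑ v, theta hA (pathRep x u v) * tail K v = tail K u * x := by
  classical
  induction x using induction_on with
  | zero => simp
  | add x y hx hy =>
    rw [mul_add, ← hx, ← hy, ← Finset.sum_add_distrib]
    simp only [map_add, Matrix.add_apply, add_mul]
  | smul k c d p =>
    simp only [map_smul, Matrix.smul_apply, PathAlgebra.smul_mul, PathAlgebra.mul_smul]
    rw [← Finset.smul_sum]
    congr 1
    rw [pathRep_ofPath]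
    by_cases h : c = u
    · subst h
      rw [Finset.sum_eq_single d]
      · rw [Matrix.single_apply_same, theta_collapse_mul]
      · intro z _ hz
        rw [Matrix.single_apply_of_ne _ _ _ _ _ (fun h => hz h.2.symm), map_zero, zero_mul]
      · intro h; exact absurd (Finset.mem_univ _) h
    · rw [← tail_mul_vert, mul_assoc, vert_mul_ofPath_of_ne _ (Ne.symm h), mul_zero]
      refine Finset.sum_eq_zero fun z _ => ?_
      rw [Matrix.single_apply_of_ne _ _ _ _ _ (fun h' => h h'.1), map_zero, zero_mul]

theorem sum_oldIdem_mul (f : StretchedVertex V A → PathAlgebra K V) :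
    ∑ u, oldIdem K u * f u = ∑ a, vert K a * f (old a) := by
  refine (Fintype.sum_sum_type _).trans ?_
  have : ∀ x : (Σ (a b : V) (_ : a ⟶ b), Fin (A - 1)),
      oldIdem K (Sum.inr x : StretchedVertex V A) * f (Sum.inr x) = 0 := fun x => zero_mul _
  rw [Finset.sum_eq_zero (fun x _ => this x), add_zero]
  rfl

theorem pathRep_mem (hA : 1 ≤ A) {j : ℕ} {y : PathAlgebra K (StretchedVertex V A)}
    (hy : y ∈ lengthPart K (StretchedVertex V A) j) (u v : StretchedVertex V A) :
    (∃ k, A * k + level v = level u + j ∧ pathRep y u v ∈ lengthPart K V k) ∨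
      pathRep y u v = 0 := by
  classical
  -- The disjunction is not visibly closed under sums. As k is determined by u, v and j, it amounts
  -- to membership in one subspace T, to which span induction applies.
  obtain ⟨T, hT, hT'⟩ : ∃ T : Submodule K (PathAlgebra K V),
      (∀ x ∈ T, (∃ k, A * k + level v = level u + j ∧ x ∈ lengthPart K V k) ∨ x = 0) ∧
      ∀ k, A * k + level v = level u + j → lengthPart K V k ≤ T := by
    by_cases h : ∃ k, A * k + level v = level u + j
    · obtain ⟨k, hk⟩ := h
      refine ⟨lengthPart K V k, fun x hx => Or.inl ⟨k, hk, hx⟩, fun l hl => ?_⟩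
      have : k = l := Nat.eq_of_mul_eq_mul_left (by omega : 0 < A) (by omega)
      rw [this]
    · exact ⟨⊥, fun x hx => Or.inr ((Submodule.mem_bot K).1 hx), fun k hk => absurd ⟨k, hk⟩ h⟩
  apply hT
  induction hy using Submodule.span_induction with
  | mem x hx =>
    obtain ⟨a, b, p, rfl, rfl⟩ := hx
    rw [pathRep_ofPath]
    by_cases h : a = u ∧ b = v
    · obtain ⟨rfl, rfl⟩ := h
      rw [Matrix.single_apply_same]
      obtain ⟨k, hk, hp⟩ := collapse_mem (K := K) hA p
      exact hT' k hk hp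
    · rw [Matrix.single_apply_of_ne _ _ _ _ _ h]
      exact zero_mem _
  | zero => rw [map_zero]; exact zero_mem _
  | add x y _ _ hx hy => rw [map_add]; exact add_mem hx hy
  | smul k x _ hx => rw [map_smul]; exact Submodule.smul_mem _ _ hx

end StretchedVertex

namespace StretchedVertex

variable {V : Type u} [Quiver.{v} V] {A : ℕ} {K : Type w} [Field K]
  [Fintype V] [∀ a b : V, Fintype (a ⟶ b)]

theorem old_injective : Function.Injective (old : V → StretchedVertex V A) :=
  fun _ _ h => Sum.inl.inj h

/-! ### Arrows of the stretched quiver -/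

/-- The arrow of the original quiver on which an arrow of the stretched quiver lies, and its
position. -/
def arrowCode : (Σ u v : StretchedVertex V A, u ⟶ v) → (Σ a b : V, a ⟶ b) × ℕ
  | ⟨_, _, Arrow.mk α j _⟩ => (⟨_, _, α⟩, j)

/-- The arrow `α_{j+1}`. -/
def stretchedArrow (s : Σ a b : V, a ⟶ b) (j : ℕ) (h : j < A) :
    Σ u v : StretchedVertex V A, u ⟶ v :=
  ⟨on s.2.2 j, on s.2.2 (j + 1), Arrow.mk s.2.2 j h⟩

theorem finite_stretchedArrow : Finite (Σ u v : StretchedVertex V A, u ⟶ v) := by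
  refine Finite.of_surjective
    (fun x : (Σ a b : V, a ⟶ b) × Fin A => stretchedArrow x.1 x.2.1 x.2.2) ?_
  rintro ⟨_, _, ⟨α, j, h⟩⟩
  exact ⟨(⟨_, _, α⟩, ⟨j, h⟩), rfl⟩

/-- With finitely many arrows, the construction of the arrow module applies to the stretched quiver
as well. -/
noncomputable instance (u v : StretchedVertex V A) : Fintype (u ⟶ v) := by
  have := finite_stretchedArrow (V := V) (A := A)
  have : Finite (u ⟶ v) := Finite.of_injective
    (fun α => (⟨u, v, α⟩ : Σ u v : StretchedVertex V A, u ⟶ v)) (fun α β h => by simpa using h)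
  exact Fintype.ofFinite _

/-! ### The stretched ideal -/

/-- The stretched ideal as a function of the ideal. -/
noncomputable abbrev idealOf (hA : 1 ≤ A) (I : TwoSidedIdeal (PathAlgebra K V)) :
    TwoSidedIdeal (PathAlgebra K (StretchedVertex V A)) := stretchedIdeal hA (I : Set (PathAlgebra K V))

variable {I : TwoSidedIdeal (PathAlgebra K V)}

/-- As `theta` is multiplicative, θ*(a·s·b) lies in the ideal generated by θ*(s). So the stretched
ideal depends on I only, and all of I may serve as the generating set. -/
theorem stretchedIdeal_eq (hA : 1 ≤ A) {g : Set (PathAlgebra K V)}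
    (hg : TwoSidedIdeal.span g = I) : stretchedIdeal (A := A) hA g = idealOf hA I := by
  subst hg
  apply le_antisymm
  · exact TwoSidedIdeal.span_mono (Set.image_mono TwoSidedIdeal.subset_span)
  · refine TwoSidedIdeal.span_le.2 ?_
    rintro _ ⟨x, hx, rfl⟩
    change x ∈ TwoSidedIdeal.span g at hx
    change theta hA x ∈ stretchedIdeal hA g
    rw [TwoSidedIdeal.mem_span_iff_mem_addSubgroup_closure] at hx
    induction hx using AddSubgroup.closure_induction with
    | mem z hz =>
      obtain ⟨z, ⟨a, -, s, hs, rfl⟩, b, -, rfl⟩ := hz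
      change theta hA (a * s * b) ∈ _
      rw [map_mul, map_mul]
      exact TwoSidedIdeal.mul_mem_right _ _ _ (TwoSidedIdeal.mul_mem_left _ _ _
        (TwoSidedIdeal.subset_span ⟨s, hs, rfl⟩))
    | zero => rw [map_zero]; exact zero_mem _
    | add x y _ _ hx hy => rw [map_add]; exact add_mem hx hy
    | neg x _ hx => rw [map_neg]; exact neg_mem hx

theorem theta_mem (hA : 1 ≤ A) {x : PathAlgebra K V} (hx : x ∈ I) : theta hA x ∈ idealOf hA I :=
  TwoSidedIdeal.subset_span ⟨x, hx, rfl⟩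

theorem idealOf_induction (hA : 1 ≤ A) {p : PathAlgebra K (StretchedVertex V A) → Prop}
    (h : ∀ a b, ∀ x ∈ I, p (a * theta hA x * b)) (h0 : p 0) (hadd : ∀ x y, p x → p y → p (x + y))
    (hneg : ∀ x, p x → p (-x)) {y : PathAlgebra K (StretchedVertex V A)}
    (hy : y ∈ idealOf hA I) : p y := by
  rw [idealOf, stretchedIdeal, TwoSidedIdeal.mem_span_iff_mem_addSubgroup_closure] at hy
  induction hy using AddSubgroup.closure_induction with
  | mem z hz =>
    obtain ⟨z, ⟨a, -, s, ⟨x, hx, rfl⟩, rfl⟩, b, -, rfl⟩ := hz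
    exact h a b x hx
  | zero => exact h0
  | add x y _ _ hx hy => exact hadd x y hx hy
  | neg x _ hx => exact hneg x hx

/-- On θ*(x) with x in I the entries are multiples of x, and the representation is multiplicative.
So it descends to the quotients. -/
theorem pathRep_mem_ideal (hA : 1 ≤ A) {y : PathAlgebra K (StretchedVertex V A)}
    (hy : y ∈ idealOf hA I) (u v : StretchedVertex V A) : pathRep y u v ∈ I := by
  refine idealOf_induction hA (p := fun y => pathRep y u v ∈ I) ?_ ?_ ?_ ?_ hy
  · intro a b x hx
    rw [pathRep_mul hA, pathRep_mul hA, Matrix.mul_apply]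
    refine sum_mem_ideal _ _ fun t _ => I.mul_mem_right _ _ ?_
    rw [Matrix.mul_apply]
    refine sum_mem_ideal _ _ fun s _ => I.mul_mem_left _ _ ?_
    rw [pathRep_theta]
    exact I.mul_mem_right _ _ (I.mul_mem_left _ _ hx)
  · rw [map_zero]; exact zero_mem _
  · intro x y hx hy
    rw [map_add]; exact add_mem hx hy
  · intro x hx
    rw [map_neg]; exact neg_mem hx

/-- In a product a·θ*(x)·b with a path a, either a is nontrivial and the division acts on a alone,
or a is a vertex. In the latter case an arrow starting at a new vertex does not divide anything,
since θ*(x) starts at old vertices. -/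
theorem leftDiv_mem_ideal (hA : 1 ≤ A) (s : Σ u v : StretchedVertex V A, u ⟶ v)
    (hs : level s.1 ≠ 0) {y : PathAlgebra K (StretchedVertex V A)} (hy : y ∈ idealOf hA I) :
    leftDiv s y ∈ idealOf hA I := by
  refine idealOf_induction hA (p := fun y => leftDiv s y ∈ idealOf hA I) ?_ ?_ ?_ ?_ hy
  · intro a b x hx
    induction a using induction_on with
    | zero => rw [zero_mul, zero_mul, map_zero]; exact zero_mem _
    | add a a' ha ha' => rw [add_mul, add_mul, map_add]; exact add_mem ha ha'
    | smul k c d p =>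
      rw [PathAlgebra.smul_mul, PathAlgebra.smul_mul, map_smul]
      refine smul_mem_ideal k ?_
      rcases Nat.eq_zero_or_pos p.length with h | h
      · have e := Quiver.Path.eq_of_length_zero p h
        subst e
        have := Quiver.Path.eq_nil_of_length_zero p h
        subst this
        change leftDiv s (vert K c * _ * _) ∈ _
        by_cases hc : c = s.1
        · rw [hc, vert_mul_theta_of_level hA hs, zero_mul, map_zero]
          exact zero_mem _
        · rw [mul_assoc, leftDiv_vert_mul_of_ne s hc]
          exact zero_mem _
      · rw [mul_assoc, leftDiv_mul s (ofPath_mem_lengthGE p h), ← mul_assoc]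
        exact TwoSidedIdeal.mul_mem_right _ _ _ (TwoSidedIdeal.mul_mem_left _ _ _ (theta_mem hA hx))
  · rw [map_zero]; exact zero_mem _
  · intro x y hx hy
    rw [map_add]; exact add_mem hx hy
  · intro x hx
    rw [map_neg]; exact neg_mem hx

/-- A path either stays within one stretched arrow without completing it, or reaches an old vertex
after at most A steps. -/
theorem exists_split (hA : 1 ≤ A) {u v : StretchedVertex V A} (p : Quiver.Path u v) :
    level v = level u + p.length ∨ ∃ (x : PathAlgebra K (StretchedVertex V A)) (a : V)
      (q : Quiver.Path (old a) v), ofPath K p = x * ofPath K q ∧ p.length ≤ q.length + A := by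
  induction p with
  | nil => exact Or.inl rfl
  | cons p β ih =>
    rename_i v z
    obtain h | ⟨x, a, q, e, hl⟩ := ih
    · by_cases h1 : level v + 1 < A
      · left
        rcases β with ⟨β, j, hj⟩
        rw [level_on β hj] at h h1
        rw [level_on β h1, Quiver.Path.length_cons]
        omega
      · right
        have h2 : ∃ b : V, z = old b := by
          rcases β with ⟨β, j, hj⟩
          rw [level_on β hj] at h1
          exact ⟨_, eq_on_last hA β hj h1⟩
        obtain ⟨b, rfl⟩ := h2
        refine ⟨ofPath K (p.cons β), b, Quiver.Path.nil, (ofPath_mul_vert _).symm, ?_⟩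
        have := level_lt hA v
        rw [Quiver.Path.length_cons, Quiver.Path.length_nil]
        omega
    · right
      refine ⟨x, a, q.cons β, ?_, ?_⟩
      · rw [ofPath_cons, e, ofPath_cons, mul_assoc]
      · rw [Quiver.Path.length_cons, Quiver.Path.length_cons]
        omega

theorem isAdmissible_idealOf (hA : 1 ≤ A) (hI : IsAdmissible I) :
    IsAdmissible (idealOf hA I) := by
  constructor
  · intro y hy
    rw [← mem_lengthGE_iff]
    refine idealOf_induction hA (p := fun y => y ∈ lengthGE K (StretchedVertex V A) 2)
      (fun a b x hx => lengthGE_mul_right (lengthGE_mul_left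
        (theta_mem_lengthGE hA (hI.le_lengthGE hx)) _) _)
      (zero_mem _) (fun _ _ => add_mem) (fun _ => neg_mem) hy
  · obtain ⟨m, hm, h⟩ := hI.exists_lengthGE_le
    -- A path from an old vertex is θ* of its collapse times a tail of length less than A. So length
    -- A·m + A forces the collapse to have length at least m, hence to lie in I. A path from an
    -- arbitrary vertex needs up to A further arrows to reach an old vertex.
    have key : ∀ (a : V) (v : StretchedVertex V A) (q : Quiver.Path (old a) v),
        A * m + A ≤ q.length → ofPath K q ∈ idealOf hA I := by
      intro a v q hq
      have e := theta_collapse_mul (K := K) hA q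
      have e2 : tail K (old a : StretchedVertex V A) * ofPath K q = ofPath K q :=
        vert_mul_ofPath q
      rw [e2] at e
      rw [← e]
      refine TwoSidedIdeal.mul_mem_right _ _ _ (theta_mem hA (h _ ?_))
      obtain ⟨k, hk, hk'⟩ := collapse_mem (K := K) hA q
      refine lengthPart_le_lengthGE ?_ hk'
      have hv := level_lt hA v
      have : level (old a : StretchedVertex V A) = 0 := rfl
      by_contra hlt
      have := Nat.mul_le_mul_left A (show k + 1 ≤ m by omega)
      rw [mul_add, mul_one] at this
      omega
    refine ⟨A * m + A + A, ?_, fun u v p hp => ?_⟩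
    · have := Nat.le_mul_of_pos_left m hA
      omega
    · obtain h1 | ⟨x, a, q, e, hl⟩ := exists_split (K := K) hA p
      · have := level_lt hA v
        omega
      · rw [e]
        exact TwoSidedIdeal.mul_mem_left _ _ _ (key a v q (by omega))

theorem isLengthHomogeneous_idealOf (hA : 1 ≤ A) (hI : IsLengthHomogeneous I) :
    IsLengthHomogeneous (idealOf hA I) := by
  obtain ⟨S, hS, e⟩ := hI
  refine ⟨theta hA '' S, ?_, stretchedIdeal_eq hA e⟩
  rintro _ ⟨x, hx, rfl⟩
  obtain ⟨n, hn⟩ := hS x hx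
  exact ⟨_, theta_mem_lengthPart hA hn⟩

/-! ### The corner data of the stretched algebra -/

/-- The composite of `θ*` with the quotient map, as an additive map. -/
noncomputable def quotThetaAux (hA : 1 ≤ A) (I : TwoSidedIdeal (PathAlgebra K V)) :
    PathAlgebra K V →+ QuotientAlgebra (idealOf hA I) where
  toFun x := toQuot (idealOf hA I) (theta hA x)
  map_zero' := by rw [map_zero, map_zero]
  map_add' x y := by rw [map_add, map_add]

theorem quotThetaAux_eq_zero (hA : 1 ≤ A) (x : PathAlgebra K V) (hx : x ∈ I) :
    quotThetaAux hA I x = 0 :=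
  toQuot_eq_zero.2 (theta_mem hA hx)

/-- The map `θ*` on quotients. -/
noncomputable def quotTheta (hA : 1 ≤ A) (I : TwoSidedIdeal (PathAlgebra K V)) :
    QuotientAlgebra I →ₙ+* QuotientAlgebra (idealOf hA I) where
  __ := descend I (quotThetaAux hA I) (quotThetaAux_eq_zero hA)
  map_mul' x y := by
    obtain ⟨x, rfl⟩ := toQuot_surjective I x
    obtain ⟨y, rfl⟩ := toQuot_surjective I y
    rw [← map_mul]
    refine (descend_toQuot I _ _ _).trans ?_
    refine Eq.trans ?_ (congrArg₂ (· * ·) (descend_toQuot I _ _ _) (descend_toQuot I _ _ _)).symm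
    change toQuot _ (theta hA (x * y)) = toQuot _ (theta hA x) * toQuot _ (theta hA y)
    rw [map_mul, map_mul]
  map_zero' := map_zero (descend I _ _)
  map_add' := map_add (descend I _ _)

theorem quotTheta_toQuot (hA : 1 ≤ A) (x : PathAlgebra K V) :
    quotTheta hA I (toQuot I x) = toQuot (idealOf hA I) (theta hA x) :=
  descend_toQuot I (quotThetaAux hA I) (quotThetaAux_eq_zero hA) x

/-- The entrywise quotient of the matrix representation, as an additive map. -/
noncomputable def quotRepAux (I : TwoSidedIdeal (PathAlgebra K V)) :
    PathAlgebra K (StretchedVertex V A) →+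
      Matrix (StretchedVertex V A) (StretchedVertex V A) (QuotientAlgebra I) where
  toFun x := (pathRep x).map (toQuot I)
  map_zero' := by rw [map_zero]; exact Matrix.map_zero _ (map_zero _)
  map_add' x y := by rw [map_add]; exact Matrix.map_add _ (map_add _) _ _

theorem quotRepAux_mul (hA : 1 ≤ A) (x y : PathAlgebra K (StretchedVertex V A)) :
    quotRepAux I (x * y) = quotRepAux I x * quotRepAux I y := by
  change (pathRep (x * y)).map (toQuot I) = (pathRep x).map (toQuot I) * (pathRep y).map (toQuot I)
  rw [pathRep_mul hA, Matrix.map_mul]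

theorem quotRepAux_eq_zero (hA : 1 ≤ A) (x : PathAlgebra K (StretchedVertex V A))
    (hx : x ∈ idealOf hA I) : quotRepAux I x = 0 := by
  ext u v
  exact toQuot_eq_zero.2 (pathRep_mem_ideal hA hx u v)

/-- The matrix representation of the stretched algebra. -/
noncomputable def quotRep (hA : 1 ≤ A) (I : TwoSidedIdeal (PathAlgebra K V)) :
    QuotientAlgebra (idealOf hA I) →ₙ+*
      Matrix (StretchedVertex V A) (StretchedVertex V A) (QuotientAlgebra I) where
  __ := descend (idealOf hA I) (quotRepAux I) (quotRepAux_eq_zero hA)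
  map_mul' x y := by
    obtain ⟨x, rfl⟩ := toQuot_surjective _ x
    obtain ⟨y, rfl⟩ := toQuot_surjective _ y
    rw [← map_mul]
    refine (descend_toQuot _ _ _ _).trans ?_
    refine Eq.trans ?_ (congrArg₂ (· * ·) (descend_toQuot _ _ _ _) (descend_toQuot _ _ _ _)).symm
    exact quotRepAux_mul hA x y
  map_zero' := map_zero (descend _ _ _)
  map_add' := map_add (descend _ _ _)

theorem quotRep_toQuot (hA : 1 ≤ A) (x : PathAlgebra K (StretchedVertex V A))
    (u v : StretchedVertex V A) :
    quotRep hA I (toQuot (idealOf hA I) x) u v = toQuot I (pathRep x u v) :=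
  congrFun (congrFun (descend_toQuot (idealOf hA I) (quotRepAux I) (quotRepAux_eq_zero hA) x) u) v

/-- The stretched algebra as an extension of the original algebra. -/
noncomputable def cornerData (hA : 1 ≤ A) (I : TwoSidedIdeal (PathAlgebra K V)) :
    CornerData (QuotientAlgebra I) (QuotientAlgebra (idealOf hA I)) (StretchedVertex V A) where
  Φ := quotRep hA I
  θ := quotTheta hA I
  τ v := toQuot _ (tail K v)
  κ v := toQuot I (oldIdem K v)
  sum_theta_mul x u := by
    obtain ⟨x, rfl⟩ := toQuot_surjective _ x
    simp only [quotRep_toQuot, quotTheta_toQuot, ← map_mul, ← map_sum]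
    rw [sum_theta_pathRep_mul]
  rep_theta r u v := by
    obtain ⟨r, rfl⟩ := toQuot_surjective _ r
    rw [quotTheta_toQuot, quotRep_toQuot, pathRep_theta, map_mul, map_mul]
  sum_rep_tau v w := by
    classical
    rw [← map_one (toQuot _)]
    simp only [quotRep_toQuot, ← map_mul, ← map_sum]
    congr 1
    rw [sum_oldIdem_mul, pathRep_one]
    simp only [pathRep_tail]
    -- The tail at v starts at the old vertex `base v`, so only this row of its matrix is nonzero.
    rw [Finset.sum_eq_single (base v)]
    · split_ifs with h
      · subst h
        rw [Matrix.single_apply_same, vert_mul_vert]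
      · rw [Matrix.single_apply_of_ne _ _ _ _ _ (fun h' => h h'.2), mul_zero]
    · intro a _ ha
      rw [Matrix.single_apply_of_ne _ _ _ _ _ (fun h => ha (old_injective h.1).symm), mul_zero]
    · intro h; exact absurd (Finset.mem_univ _) h
  sum_sq := by
    simp only [← map_mul, ← map_sum]
    rw [sum_oldIdem_mul, ← map_one (toQuot I), one_eq_sum_vert]
    simp only [oldIdem_old, vert_mul_vert]
  rep_one v := by
    classical
    rw [← map_one (toQuot _)]
    simp only [quotRep_toQuot, ← map_mul, ← map_sum]
    congr 1
    simp only [pathRep_one]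
    rw [Finset.sum_eq_single v]
    · rw [if_pos rfl]
      rcases v with a | x
      · exact vert_mul_vert a
      · exact zero_mul _
    · intro u _ hu
      rw [if_neg hu, mul_zero]
    · intro h; exact absurd (Finset.mem_univ _) h

theorem isGradedCorner (hA : 1 ≤ A) (I : TwoSidedIdeal (PathAlgebra K V)) :
    IsGradedCorner (cornerData hA I) (quotientPart I) (quotientPart (idealOf hA I)) A level where
  len_lt := level_lt hA
  rep := by
    rintro j _ ⟨y, hy, rfl⟩ u v
    obtain ⟨k, hk, h⟩ | h := pathRep_mem hA hy u v
    · refine Or.inl ⟨k, hk, ?_⟩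
      change quotRep hA I (toQuot (idealOf hA I) y) u v ∈ _
      rw [quotRep_toQuot]
      exact toQuot_mem_quotientPart I h
    · right
      change quotRep hA I (toQuot (idealOf hA I) y) u v = 0
      rw [quotRep_toQuot, h, map_zero]
  theta := by
    rintro k _ ⟨y, hy, rfl⟩
    change quotTheta hA I (toQuot I y) ∈ _
    rw [quotTheta_toQuot]
    exact toQuot_mem_quotientPart _ (theta_mem_lengthPart hA hy)
  tau v := toQuot_mem_quotientPart _ (tail_mem_lengthPart v)
  kappa v := by
    refine toQuot_mem_quotientPart I ?_
    rcases v with a | x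
    · exact vert_mem_lengthPart a
    · exact zero_mem _
  kappa_ne v hv := by
    rcases v with a | x
    · exact absurd rfl hv
    · exact map_zero _

end StretchedVertex

/-- Left multiplication as a map of right modules. -/
def leftMulLinear {R : Type*} [Ring R] (c : R) : R →ₗ[Rᵐᵒᵖ] R where
  toFun x := c * x
  map_add' := mul_add c
  map_smul' r x := by
    obtain ⟨r, rfl⟩ := op_surjective r
    rw [op_smul_eq_mul, RingHom.id_apply, op_smul_eq_mul, mul_assoc]

theorem leftMulLinear_apply {R : Type*} [Ring R] (c x : R) : leftMulLinear c x = c * x := rfl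

namespace PathAlgebra

variable {K : Type w} [Field K] {V : Type u} [Quiver.{v} V] [Fintype V]

theorem leftDiv_vert_mul (s : Σ a b : V, a ⟶ b) (x : PathAlgebra K V) :
    leftDiv s (vert K s.1 * x) = leftDiv s x := by
  conv_rhs => rw [← one_mul x, one_eq_sum_vert, Finset.sum_mul, map_sum]
  rw [Finset.sum_eq_single s.1]
  · intro c _ hc
    exact leftDiv_vert_mul_of_ne s hc x
  · intro h; exact absurd (Finset.mem_univ _) h

theorem divVector_apply [∀ a b : V, Fintype (a ⟶ b)] (I : TwoSidedIdeal (PathAlgebra K V))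
    (x : PathAlgebra K V) (s : Σ a b : V, a ⟶ b) :
    (divVector I x).1 s = toQuot I (leftDiv s x) := rfl

end PathAlgebra

namespace StretchedVertex

variable {V : Type u} [Quiver.{v} V] {A : ℕ} {K : Type w} [Field K]
  [Fintype V] [∀ a b : V, Fintype (a ⟶ b)] {I : TwoSidedIdeal (PathAlgebra K V)}

/-! ### The arrow modules of an algebra and its stretched algebra -/

/-- The coordinate of the arrow module at an arrow. -/
noncomputable def arrowCoord (I : TwoSidedIdeal (PathAlgebra K V)) (α : Σ a b : V, a ⟶ b) :
    arrowModule I →ₗ[(QuotientAlgebra I)ᵐᵒᵖ] QuotientAlgebra I :=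
  LinearMap.proj α ∘ₗ (arrowModule I).subtype

/-- The element `x α` of the stretched algebra, for a row vector `x` over the arrow module. -/
noncomputable def rowCoord (hA : 1 ≤ A) (I : TwoSidedIdeal (PathAlgebra K V))
    (α : Σ a b : V, a ⟶ b) :
    RowModule (cornerData hA I).Φ (arrowModule I) →ₗ[(QuotientAlgebra (idealOf hA I))ᵐᵒᵖ]
      QuotientAlgebra (idealOf hA I) :=
  (cornerData hA I).toRing ∘ₗ RowModule.map (cornerData hA I).Φ (arrowCoord I α)

theorem rowCoord_apply (hA : 1 ≤ A) (α : Σ a b : V, a ⟶ b)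
    (h : RowModule (cornerData hA I).Φ (arrowModule I)) :
    rowCoord hA I α h = ∑ v, quotTheta hA I ((h.1 v).1 α) * toQuot _ (tail K v) := rfl

/-- The comparison between the arrow modules. -/
noncomputable def stretchArrow (hA : 1 ≤ A) (I : TwoSidedIdeal (PathAlgebra K V)) :
    RowModule (cornerData hA I).Φ (arrowModule I) →ₗ[(QuotientAlgebra (idealOf hA I))ᵐᵒᵖ]
      arrowModule (idealOf hA I) :=
  LinearMap.codRestrict (arrowModule (idealOf hA I)) (LinearMap.pi fun s =>
    -- The coordinate at s is the quotient by s of Σ θ*(α)·x_α, with x_α given by `rowCoord`.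
    ∑ α : Σ a b : V, a ⟶ b,
      leftMulLinear (toQuot (idealOf hA I) (leftDiv s (theta hA (arr K α)))) ∘ₗ rowCoord hA I α)
    fun h s => by
      rw [LinearMap.pi_apply, LinearMap.sum_apply, Finset.mul_sum]
      refine Finset.sum_congr rfl fun α _ => ?_
      rw [LinearMap.comp_apply, leftMulLinear_apply, ← mul_assoc, ← map_mul, vert_mul_leftDiv]

theorem stretchArrow_apply (hA : 1 ≤ A) (h : RowModule (cornerData hA I).Φ (arrowModule I))
    (s : Σ u v : StretchedVertex V A, u ⟶ v) : (stretchArrow hA I h).1 s =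
      ∑ α : Σ a b : V, a ⟶ b, toQuot _ (leftDiv s (theta hA (arr K α))) * rowCoord hA I α h := by
  change (LinearMap.pi _) h s = _
  rw [LinearMap.pi_apply, LinearMap.sum_apply]
  rfl

theorem theta_arr_mem (hA : 1 ≤ A) (α : Σ a b : V, a ⟶ b) :
    theta hA (arr K α) ∈ lengthGE K (StretchedVertex V A) 1 :=
  theta_mem_lengthGE hA (lengthPart_le_lengthGE le_rfl (arr_mem_lengthPart α))

/-- The square with F(`arrowMap I`) commutes: multiplying the quotients of θ*(α) back by the arrows
of the stretched quiver restores θ*(α), and θ* is multiplicative. -/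
theorem arrowMap_stretchArrow (hA : 1 ≤ A) (h : RowModule (cornerData hA I).Φ (arrowModule I)) :
    arrowMap (idealOf hA I) (stretchArrow hA I h) =
      (cornerData hA I).toRing (RowModule.map (cornerData hA I).Φ (arrowMap I) h) := by
  have h1 : arrowMap (idealOf hA I) (stretchArrow hA I h) =
      ∑ α : Σ a b : V, a ⟶ b, toQuot _ (theta hA (arr K α)) * rowCoord hA I α h := by
    rw [arrowMap_apply]
    simp only [stretchArrow_apply, Finset.mul_sum]
    rw [Finset.sum_comm]
    refine Finset.sum_congr rfl fun α _ => ?_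
    simp only [← mul_assoc, ← map_mul]
    rw [← Finset.sum_mul, ← map_sum, sum_arr_mul_leftDiv fun a =>
      vertCoeff_eq_zero_of_mem_lengthGE (theta_arr_mem hA α) a]
  rw [h1]
  simp only [rowCoord_apply, Finset.mul_sum]
  rw [Finset.sum_comm, CornerData.toRing_apply]
  refine Finset.sum_congr rfl fun v _ => ?_
  rw [RowModule.map_apply, arrowMap_apply]
  change _ = quotTheta hA I _ * _
  rw [map_sum, Finset.sum_mul]
  refine Finset.sum_congr rfl fun α _ => ?_
  rw [map_mul, quotTheta_toQuot, mul_assoc]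
  rfl

theorem pathRep_mul_vert (hA : 1 ≤ A) (x : PathAlgebra K (StretchedVertex V A))
    (u v : StretchedVertex V A) : pathRep x u v * vert K (base v) = pathRep x u v := by
  classical
  induction x using induction_on with
  | zero => rw [map_zero]; exact zero_mul _
  | add x y hx hy => rw [map_add, Matrix.add_apply, add_mul, hx, hy]
  | smul k a b p =>
    rw [map_smul, Matrix.smul_apply, PathAlgebra.smul_mul, pathRep_ofPath]
    congr 1
    by_cases h : a = u ∧ b = v
    · obtain ⟨rfl, rfl⟩ := h
      rw [Matrix.single_apply_same, collapse_mul_vert hA]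
    · rw [Matrix.single_apply_of_ne _ _ _ _ _ h, zero_mul]

/-- A relation among the arrows of the stretched algebra comes from an element y of its ideal.
Coordinates at arrows leaving new vertices vanish, so only e·y matters. Its coefficients z v with
respect to the tails lie in I, so dividing them by the arrows of the original quiver gives relations
there. -/
theorem exists_stretchArrow_eq (hA : 1 ≤ A) (hI : IsAdmissible I)
    (f : arrowModule (idealOf hA I)) (hf : arrowMap (idealOf hA I) f = 0) :
    ∃ h : RowModule (cornerData hA I).Φ (arrowModule I),
      (∀ v, arrowMap I (h.1 v) = 0) ∧ stretchArrow hA I h = f := by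
  classical
  obtain ⟨y, -, rfl, hy⟩ := exists_divVector f
  rw [hf, toQuot_eq_zero] at hy
  let z : StretchedVertex V A → PathAlgebra K V := fun v => ∑ a, pathRep y (old a) v
  have hz : ∀ v, z v ∈ I := fun v => sum_mem_ideal _ _ fun a _ => pathRep_mem_ideal hA hy _ _
  have hz1 : ∀ v, z v ∈ lengthGE K V 1 := fun v =>
    lengthGE_anti one_le_two (hI.le_lengthGE (hz v))
  have hzv : ∀ v, z v * vert K (base v) = z v := fun v => by
    rw [Finset.sum_mul]
    exact Finset.sum_congr rfl fun a _ => pathRep_mul_vert hA _ _ _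
  let h : RowModule (cornerData hA I).Φ (arrowModule I) := ⟨fun v => divVector I (z v), by
    change rowMul _ _ = _
    funext v
    rw [rowMul, Finset.sum_eq_single v]
    · apply Subtype.ext
      funext α
      rw [Submodule.coe_smul, Pi.smul_apply, op_smul_eq_mul]
      change _ * quotRep hA I 1 v v = _
      rw [← map_one (toQuot _), quotRep_toQuot, pathRep_one, if_pos rfl, divVector_apply,
        ← map_mul, ← leftDiv_mul α (hz1 v), hzv]
    · intro u _ hu
      change op (quotRep hA I 1 u v) • _ = _
      rw [← map_one (toQuot _), quotRep_toQuot, pathRep_one, if_neg hu, map_zero, op_zero, zero_smul]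
    · intro h; exact absurd (Finset.mem_univ _) h⟩
  refine ⟨h, fun v => ?_, ?_⟩
  · change arrowMap I (divVector I (z v)) = 0
    rw [arrowMap_divVector (hz1 v), toQuot_eq_zero]
    exact hz v
  · have key : ∀ s, (stretchArrow hA I h).1 s =
        toQuot _ (leftDiv s (∑ a, vert K (old a) * y)) := by
      intro s
      have e1 : ∑ a, vert K (old a : StretchedVertex V A) * y =
          ∑ v, theta hA (z v) * tail K v := by
        simp only [z, map_sum, Finset.sum_mul]
        rw [Finset.sum_comm]
        exact Finset.sum_congr rfl fun a _ => (sum_theta_pathRep_mul hA y (old a)).symm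
      have e2 : ∀ v, theta hA (z v) * tail K v = ∑ α : Σ a b : V, a ⟶ b,
          theta hA (arr K α) * (theta hA (leftDiv α (z v)) * tail K v) := by
        intro v
        conv_lhs => rw [← sum_arr_mul_leftDiv fun a => vertCoeff_eq_zero_of_mem_lengthGE (hz1 v) a]
        simp only [map_sum, map_mul, Finset.sum_mul, mul_assoc]
      rw [e1, stretchArrow_apply]
      simp only [e2, map_sum, leftDiv_mul s (theta_arr_mem hA _), map_mul]
      rw [Finset.sum_comm]
      refine Finset.sum_congr rfl fun α _ => ?_
      rw [rowCoord_apply, Finset.mul_sum]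
      refine Finset.sum_congr rfl fun v _ => ?_
      change _ * (quotTheta hA I (toQuot I (leftDiv α (z v))) * _) = _
      rw [quotTheta_toQuot]
    apply Subtype.ext
    funext s
    rw [key, divVector_apply, map_sum]
    -- At an old origin, division by s sees only the part of y starting there, which is part of e·y.
    -- At a new origin e·y contributes nothing, and the quotient of y vanishes modulo the ideal.
    by_cases hs : level s.1 = 0
    · have e := eq_old_of_level hs
      rw [Finset.sum_eq_single (base s.1), ← e, leftDiv_vert_mul]
      · intro a _ ha
        refine leftDiv_vert_mul_of_ne s (fun h' => ha ?_) y
        rw [← h']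
        rfl
      · intro h; exact absurd (Finset.mem_univ _) h
    · rw [Finset.sum_eq_zero, map_zero, eq_comm, toQuot_eq_zero]
      · exact leftDiv_mem_ideal hA s hs hy
      · intro a _
        refine leftDiv_vert_mul_of_ne s (fun h' => hs ?_) y
        rw [← h']
        rfl

theorem exists_initialPath_eq {a b : V} (α : a ⟶ b) (j : ℕ) (hj : j + 1 ≤ A) :
    ∃ x, ofPath K (initialPath (A := A) α (j + 1) hj) =
      arr K (stretchedArrow ⟨a, b, α⟩ 0 (by omega)) * x := by
  induction j with
  | zero => exact ⟨vert K _, (arr_mul_vert (stretchedArrow ⟨a, b, α⟩ 0 _)).symm⟩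
  | succ j ih =>
    obtain ⟨x, hx⟩ := ih (by omega)
    rw [initialPath, ofPath_cons, hx]
    exact ⟨_, mul_assoc _ _ _⟩

/-- The hypothesis concerns α_2⋯α_{j+1}·y. All these arrows start at new vertices, so
`leftDiv_mem_ideal` removes them one at a time, starting with the leftmost. -/
theorem cancel_initialPath (hA : 1 ≤ A) {a b : V} (α : a ⟶ b) (j : ℕ) (hj : j + 1 ≤ A)
    (y : PathAlgebra K (StretchedVertex V A))
    (hy : leftDiv (stretchedArrow ⟨a, b, α⟩ 0 hA) (ofPath K (initialPath (A := A) α (j + 1) hj)) * y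
      ∈ idealOf hA I) : vert K (on α (j + 1)) * y ∈ idealOf hA I := by
  classical
  induction j generalizing y with
  | zero =>
    have e : ofPath K (initialPath (A := A) α (0 + 1) hj) =
      arr K (stretchedArrow ⟨a, b, α⟩ 0 hA) * 1 := (mul_one _).symm
    rw [e, leftDiv_arr_mul, if_pos rfl, mul_one] at hy
    exact hy
  | succ j ih =>
    have e : ofPath K (initialPath (A := A) α (j + 1 + 1) hj) =
        ofPath K (initialPath (A := A) α (j + 1) (by omega)) *
          arr K (stretchedArrow ⟨a, b, α⟩ (j + 1) hj) := ofPath_cons _ _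
    rw [e, leftDiv_mul _ (ofPath_mem_lengthGE _ (by rw [length_initialPath]; omega)),
      mul_assoc] at hy
    have h1 := ih (by omega) _ hy
    have h3 := vert_mul_arr (K := K) (stretchedArrow ⟨a, b, α⟩ (j + 1) hj)
    change vert K (on α (j + 1)) * _ = _ at h3
    rw [← mul_assoc, h3] at h1
    -- The arrow α_{j+2} starts at w_{j+1}, which has level j + 1 and is therefore new.
    have h2 := leftDiv_mem_ideal hA (stretchedArrow ⟨a, b, α⟩ (j + 1) hj) (by
      change level (on α (j + 1)) ≠ 0
      rw [level_on α (by omega)]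
      omega) h1
    rwa [leftDiv_arr_mul, if_pos rfl] at h2

/-- The coordinate at the first arrow α_1 is α_2⋯α_A times the element `rowCoord` of h at α. The
factor can be cancelled, so all these elements vanish, and `toRing` is injective. -/
theorem stretchArrow_injective (hA : 1 ≤ A) : Function.Injective (stretchArrow hA I) := by
  classical
  rw [injective_iff_map_eq_zero]
  intro h hh
  have key : ∀ α, rowCoord hA I α h = 0 := by
    rintro ⟨a, b, α⟩
    have h1 : (stretchArrow hA I h).1 (stretchedArrow ⟨a, b, α⟩ 0 hA) = 0 := by rw [hh]; rfl
    rw [stretchArrow_apply, Finset.sum_eq_single ⟨a, b, α⟩] at h1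
    · obtain ⟨y, hy⟩ := toQuot_surjective _ (rowCoord hA I ⟨a, b, α⟩ h)
      rw [← hy, ← map_mul, toQuot_eq_zero, theta_arr] at h1
      have h2 : vert K (old b : StretchedVertex V A) * y ∈ idealOf hA I := by
        rw [← on_last hA α]
        obtain ⟨n, rfl⟩ := Nat.exists_eq_add_of_le' hA
        exact cancel_initialPath hA α n le_rfl y h1
      rw [← toQuot_eq_zero, map_mul, hy] at h2
      rw [← h2, rowCoord_apply, Finset.mul_sum]
      refine Finset.sum_congr rfl fun v _ => ?_
      -- The vertex at the end of α acts as the identity here, because the coordinate of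
      -- `arrowModule` at α lies in the right ideal generated by it.
      rw [← mul_assoc, ← theta_vert hA b, ← quotTheta_toQuot, ← map_mul, (h.1 v).2 ⟨a, b, α⟩]
    · rintro ⟨c, d, β⟩ _ hβ
      -- For β ≠ α the path replacing β starts with β_1 ≠ α_1, so its quotient by α_1 is 0.
      obtain ⟨n, rfl⟩ := Nat.exists_eq_add_of_le' hA
      rw [theta_arr]
      obtain ⟨x, hx⟩ := exists_initialPath_eq (K := K) β n le_rfl
      rw [hx, leftDiv_arr_mul, if_neg, map_zero, zero_mul]
      intro e
      exact hβ (congrArg Prod.fst (congrArg arrowCode e))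
    · intro h; exact absurd (Finset.mem_univ _) h
  apply Subtype.ext
  funext v
  apply Subtype.ext
  funext α
  have h1 := (cornerData hA I).toRing_smul_incl_one
    (RowModule.map (cornerData hA I).Φ (arrowCoord I α) h)
  have h2 : (cornerData hA I).toRing (RowModule.map (cornerData hA I).Φ (arrowCoord I α) h) = 0 :=
    key α
  rw [h2, op_zero, zero_smul] at h1
  exact (congrFun (congrArg Subtype.val h1) v).symm

theorem stretchArrow_mem (hA : 1 ≤ A) (i : ℕ) (h : RowModule (cornerData hA I).Φ (arrowModule I))
    (hh : h ∈ (cornerData hA I).rowGrading A level (arrowGrading I) i) :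
    stretchArrow hA I h ∈ arrowGrading (idealOf hA I) i := by
  intro s
  rw [stretchArrow_apply]
  refine AddSubgroup.sum_mem _ fun α _ => ?_
  rw [rowCoord_apply, Finset.mul_sum]
  refine AddSubgroup.sum_mem _ fun v _ => ?_
  have zero : (h.1 v).1 α = 0 → toQuot (idealOf hA I) (leftDiv s (theta hA (arr K α))) *
      (quotTheta hA I ((h.1 v).1 α) * toQuot (idealOf hA I) (tail K v)) = 0 := fun e => by
    rw [e, map_zero, zero_mul, mul_zero]
  have hv := hh v
  split_ifs at hv with e
  · have hα := hv α
    split_ifs at hα with e2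
    · rw [zero (AddSubgroup.mem_bot.1 hα)]
      exact zero_mem _
    · obtain ⟨k, hk⟩ := Nat.exists_eq_succ_of_ne_zero e2
      have hi := Nat.div_add_mod i A
      rw [hk, Nat.mul_succ, e] at hi
      -- The three factors have degrees A - 1, A·k and `level v`, where i = A·(k + 1) + `level v`.
      -- They add up to i - 1, and generators of the arrow module have degree 1.
      have h1 := toQuot_mem_quotientPart (idealOf hA I) (leftDiv_mem_lengthPart s
        (theta_mem_lengthPart hA (arr_mem_lengthPart (K := K) α)))
      have h2 := (isGradedCorner hA I).theta _ _ hα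
      have h3 := (isGradedCorner hA I).tau v
      have := quotientPart_mul h1 (quotientPart_mul h2 h3)
      rw [if_neg (by omega)]
      rw [hk, Nat.succ_sub_one, show A * 1 - 1 + (A * k + level v) = i - 1 by omega] at this
      exact this
  · rw [zero (by rw [AddSubgroup.mem_bot.1 hv]; rfl)]
    exact zero_mem _

end StretchedVertex

open StretchedVertex

/-! ### The resolution over the stretched algebra -/

section StretchedResolution

variable {K : Type w} [Field K] {V : Type u} [Quiver.{v} V] [Fintype V]
  [∀ a b : V, Fintype (a ⟶ b)] {I : TwoSidedIdeal (PathAlgebra K V)} {A : ℕ}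

/-- The terms of the resolution over the stretched algebra. -/
def stretchedTerm (hA : 1 ≤ A) (P : MinimalGradedResolution (QuotientAlgebra I) (quotientPart I)) :
    ℕ → Type (max u v w)
  | 0 => QuotientAlgebra (idealOf hA I)
  | 1 => arrowModule (idealOf hA I)
  | n + 2 => RowModule (cornerData hA I).Φ (P.P (n + 2))

noncomputable instance (hA : 1 ≤ A)
    (P : MinimalGradedResolution (QuotientAlgebra I) (quotientPart I)) :
    ∀ n, AddCommGroup (stretchedTerm hA P n)
  | 0 => inferInstanceAs (AddCommGroup (QuotientAlgebra (idealOf hA I)))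
  | 1 => inferInstanceAs (AddCommGroup (arrowModule (idealOf hA I)))
  | n + 2 => inferInstanceAs (AddCommGroup (RowModule (cornerData hA I).Φ (P.P (n + 2))))

noncomputable instance (hA : 1 ≤ A)
    (P : MinimalGradedResolution (QuotientAlgebra I) (quotientPart I)) :
    ∀ n, Module (QuotientAlgebra (idealOf hA I))ᵐᵒᵖ (stretchedTerm hA P n)
  | 0 => inferInstanceAs (Module (QuotientAlgebra (idealOf hA I))ᵐᵒᵖ
      (QuotientAlgebra (idealOf hA I)))
  | 1 => inferInstanceAs (Module (QuotientAlgebra (idealOf hA I))ᵐᵒᵖ (arrowModule (idealOf hA I)))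
  | n + 2 => inferInstanceAs (Module (QuotientAlgebra (idealOf hA I))ᵐᵒᵖ
      (RowModule (cornerData hA I).Φ (P.P (n + 2))))

/-- The gradings of the terms. -/
noncomputable def stretchedGrading (hA : 1 ≤ A)
    (P : MinimalGradedResolution (QuotientAlgebra I) (quotientPart I)) :
    ∀ n, ℕ → AddSubgroup (stretchedTerm hA P n)
  | 0 => quotientPart (idealOf hA I)
  | 1 => arrowGrading (idealOf hA I)
  | n + 2 => (cornerData hA I).rowGrading A level (P.grading (n + 2))

/-- The differentials of the resolution over the stretched algebra. -/
noncomputable def stretchedDiff (hA : 1 ≤ A)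
    (P : MinimalGradedResolution (QuotientAlgebra I) (quotientPart I))
    (D : P.P 2 →ₗ[(QuotientAlgebra I)ᵐᵒᵖ] arrowModule I) :
    ∀ n, stretchedTerm hA P (n + 1) →ₗ[(QuotientAlgebra (idealOf hA I))ᵐᵒᵖ] stretchedTerm hA P n
  | 0 => arrowMap (idealOf hA I)
  | 1 => stretchArrow hA I ∘ₗ RowModule.map (cornerData hA I).Φ D
  | n + 2 => RowModule.map (cornerData hA I).Φ (P.d (n + 2))

/-- The augmentation of the resolution over the stretched algebra. -/
noncomputable def stretchedAug (hA : 1 ≤ A)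
    (P : MinimalGradedResolution (QuotientAlgebra I) (quotientPart I)) :
    stretchedTerm hA P 0 →ₗ[(QuotientAlgebra (idealOf hA I))ᵐᵒᵖ]
      TopModule (QuotientAlgebra (idealOf hA I)) :=
  (Module.jacobson (QuotientAlgebra (idealOf hA I))ᵐᵒᵖ (QuotientAlgebra (idealOf hA I))).mkQ

variable (hA : 1 ≤ A) (P : MinimalGradedResolution (QuotientAlgebra I) (quotientPart I))

theorem isInternal_stretchedGrading (hh : IsLengthHomogeneous I) :
    ∀ n, DirectSum.IsInternal (stretchedGrading hA P n)
  | 0 => isInternal_quotientPart (isLengthHomogeneous_idealOf hA hh)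
  | 1 => isInternal_arrowGrading (isLengthHomogeneous_idealOf hA hh)
  | n + 2 => CornerData.isInternal_rowGrading (isGradedCorner hA I) (one_mem_quotientPart _)
      (P.smul_mem (n + 2)) (P.isInternal (n + 2))

theorem stretchedGrading_smul_mem : ∀ (n i j : ℕ) (x : stretchedTerm hA P n)
    (r : QuotientAlgebra (idealOf hA I)), x ∈ stretchedGrading hA P n i →
    r ∈ quotientPart (idealOf hA I) j → op r • x ∈ stretchedGrading hA P n (i + j)
  | 0 => fun _ _ _ _ hx hr => quotientPart_mul hx hr
  | 1 => fun i j f r hf hr => arrowGrading_smul_mem i j f r hf hr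
  | n + 2 => fun i j f r hf hr =>
      CornerData.op_smul_mem_rowGrading (isGradedCorner hA I) (P.smul_mem (n + 2)) i j f r hf hr

theorem stretchedDiff_mem {D : P.P 2 →ₗ[(QuotientAlgebra I)ᵐᵒᵖ] arrowModule I}
    (hD : ∀ i, ∀ y ∈ P.grading 2 i, D y ∈ arrowGrading I i) : ∀ (n i : ℕ)
    (x : stretchedTerm hA P (n + 1)), x ∈ stretchedGrading hA P (n + 1) i →
    stretchedDiff hA P D n x ∈ stretchedGrading hA P n i
  | 0 => fun i f hf => arrowMap_mem i f hf
  | 1 => fun i f hf => stretchArrow_mem hA i _ (CornerData.map_mem_rowGrading D hD i f hf)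
  | n + 2 => fun i f hf => CornerData.map_mem_rowGrading (P.d (n + 2)) (P.d_mem (n + 2)) i f hf

theorem finite_stretchedTerm :
    ∀ n, Module.Finite (QuotientAlgebra (idealOf hA I))ᵐᵒᵖ (stretchedTerm hA P n)
  | 0 => finite_right_self _
  | 1 => finite_arrowModule
  | _ + 2 => (cornerData hA I).finite_row

theorem projective_stretchedTerm :
    ∀ n, Module.Projective (QuotientAlgebra (idealOf hA I))ᵐᵒᵖ (stretchedTerm hA P n)
  | 0 => projective_right_self _
  | 1 => projective_arrowModule
  | _ + 2 => (cornerData hA I).projective_row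

/-- Exactness of F handles all high degrees. At the arrow module it is the lifting of relations,
`exists_stretchArrow_eq`; at F(P 2) it is the injectivity of `stretchArrow`. -/
theorem stretchedDiff_exact (hI : IsAdmissible I)
    {D : P.P 2 →ₗ[(QuotientAlgebra I)ᵐᵒᵖ] arrowModule I}
    (ex1 : Function.Exact (P.d 2) D) (ex2 : Function.Exact D (arrowMap I)) :
    ∀ n, Function.Exact (stretchedDiff hA P D (n + 1)) (stretchedDiff hA P D n)
  | 0 => by
    intro f
    constructor
    · intro hf
      obtain ⟨h, hh, rfl⟩ := exists_stretchArrow_eq hA hI f hf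
      obtain ⟨m, rfl⟩ := RowModule.exists_map_eq h fun v => (ex2 _).1 (hh v)
      exact ⟨m, rfl⟩
    · rintro ⟨m, rfl⟩
      refine (arrowMap_stretchArrow hA _).trans ?_
      exact (congrArg (cornerData hA I).toRing
        ((RowModule.map_exact ex2).apply_apply_eq_zero _)).trans (map_zero _)
  | 1 => by
    intro f
    refine Iff.trans ?_ (RowModule.map_exact (Φ := (cornerData hA I).Φ) ex1 f)
    exact map_eq_zero_iff _ (stretchArrow_injective hA)
  | n + 2 => RowModule.map_exact (P.exact_succ (n + 2))

/-- The functor multiplies generating degrees by A, which for n ≥ 2 turns the Koszul degree into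
δ(n) with D = dA. For n = 1 this product would be A instead of 1; there the term is the arrow module
of the stretched algebra itself. -/
theorem span_stretchedGrading {d : ℕ} (hP : ∀ n, P.GeneratedInDegree n (koszulDegree d n)) :
    ∀ n, Submodule.span (QuotientAlgebra (idealOf hA I))ᵐᵒᵖ
      (stretchedGrading hA P n (stackedDegree (d * A) A n) : Set (stretchedTerm hA P n)) = ⊤
  | 0 => span_quotientPart_zero _
  | 1 => span_arrowGrading _
  | n + 2 => by
    have e : stackedDegree (d * A) A (n + 2) = A * koszulDegree d (n + 2) := by
      unfold stackedDegree koszulDegree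
      rw [if_neg (by omega), if_neg (by omega)]
      split_ifs <;> ring
    rw [e]
    exact CornerData.span_rowGrading (isGradedCorner hA I) (P.smul_mem (n + 2)) (hP (n + 2))

end StretchedResolution

/-- For minimality. The successive differences are 1, dA - 1, and then alternately A and dA - A, all
positive since d ≥ 2. -/
theorem stackedDegree_mul_lt {d A : ℕ} (hd : 2 ≤ d) (hA : 1 ≤ A) (n : ℕ) :
    stackedDegree (d * A) A n < stackedDegree (d * A) A (n + 1) := by
  have h1 : A < d * A := by nlinarith
  rcases Nat.even_or_odd' n with ⟨k, rfl | rfl⟩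
  · rcases Nat.eq_zero_or_pos k with rfl | hk
    · simp [stackedDegree]
    · have e1 : stackedDegree (d * A) A (2 * k) = k * (d * A) := by
        rw [stackedDegree, if_neg (by omega), if_neg (by omega), if_pos (even_two_mul k),
          Nat.mul_div_cancel_left k two_pos]
      have e2 : stackedDegree (d * A) A (2 * k + 1) = k * (d * A) + A := by
        rw [stackedDegree, if_neg (by omega), if_neg (by omega),
          if_neg (Nat.not_even_two_mul_add_one k), Nat.add_sub_cancel,
          Nat.mul_div_cancel_left k two_pos]
      omega
  · have e2 : stackedDegree (d * A) A (2 * k + 1 + 1) = (k + 1) * (d * A) := by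
      rw [stackedDegree, if_neg (by omega), if_neg (by omega),
        if_pos ⟨k + 1, by omega⟩, show 2 * k + 1 + 1 = 2 * (k + 1) by omega,
        Nat.mul_div_cancel_left _ two_pos]
    rw [e2, add_mul, one_mul]
    rcases Nat.eq_zero_or_pos k with rfl | hk
    · simp only [stackedDegree]
      simp
      omega
    · have e1 : stackedDegree (d * A) A (2 * k + 1) = k * (d * A) + A := by
        rw [stackedDegree, if_neg (by omega), if_neg (by omega),
          if_neg (Nat.not_even_two_mul_add_one k), Nat.add_sub_cancel,
          Nat.mul_div_cancel_left k two_pos]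
      omega

/-! ### Minimality of the resolution and conclusion -/

section Main

variable {K : Type w} [Field K] {V : Type u} [Quiver.{v} V] [Fintype V]
  [∀ a b : V, Fintype (a ⟶ b)] {I : TwoSidedIdeal (PathAlgebra K V)} {A : ℕ}

/-- The minimal graded resolution over the stretched algebra of a Koszul algebra. -/
noncomputable def stretchedResolution (hA : 1 ≤ A) (hI : IsAdmissible I)
    (hh : IsLengthHomogeneous I)
    (P : MinimalGradedResolution (QuotientAlgebra I) (quotientPart I))
    {d : ℕ} (hd : 2 ≤ d) (hP : ∀ n, P.GeneratedInDegree n (koszulDegree d n))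
    {D : P.P 2 →ₗ[(QuotientAlgebra I)ᵐᵒᵖ] arrowModule I}
    (hD : ∀ i, ∀ y ∈ P.grading 2 i, D y ∈ arrowGrading I i)
    (ex1 : Function.Exact (P.d 2) D) (ex2 : Function.Exact D (arrowMap I)) :
    MinimalGradedResolution (QuotientAlgebra (idealOf hA I)) (quotientPart (idealOf hA I)) where
  P := stretchedTerm hA P
  d := stretchedDiff hA P D
  aug := stretchedAug hA P
  grading := stretchedGrading hA P
  finite := finite_stretchedTerm hA P
  projective := projective_stretchedTerm hA P
  isInternal := isInternal_stretchedGrading hA P hh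
  smul_mem := stretchedGrading_smul_mem hA P
  d_mem := stretchedDiff_mem hA P hD
  aug_mem _ x hx := ⟨x, hx, rfl⟩
  aug_surjective := Submodule.mkQ_surjective
    (Module.jacobson (QuotientAlgebra (idealOf hA I))ᵐᵒᵖ (QuotientAlgebra (idealOf hA I)))
  exact_zero x := (Submodule.Quotient.mk_eq_zero
    (Module.jacobson (QuotientAlgebra (idealOf hA I))ᵐᵒᵖ (QuotientAlgebra (idealOf hA I)))).trans
      (range_arrowMap (isAdmissible_idealOf hA hI) x)
  exact_succ := stretchedDiff_exact hA P hI ex1 ex2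
  minimal n x := by
    -- Generators of term n + 1 have degree δ(n + 1) > δ(n), and elements of that degree in term n,
    -- which is generated in degree δ(n), are radical.
    have h := fun y hy => mem_jacobson_of_generated (isInternal_stretchedGrading hA P hh n)
      (isInternal_quotientPart (isLengthHomogeneous_idealOf hA hh))
      (stretchedGrading_smul_mem hA P n)
      (quotientPart_le_jacobson (isAdmissible_idealOf hA hI))
      (span_stretchedGrading hA P hP n) (stackedDegree_mul_lt hd hA n) (x := y) hy
    have hx : x ∈ Submodule.span (QuotientAlgebra (idealOf hA I))ᵐᵒᵖ
        (stretchedGrading hA P (n + 1) (stackedDegree (d * A) A (n + 1)) :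
          Set (stretchedTerm hA P (n + 1))) := by
      rw [span_stretchedGrading hA P hP (n + 1)]
      exact Submodule.mem_top
    induction hx using Submodule.span_induction with
    | mem y hy => exact h _ (stretchedDiff_mem hA P hD n _ y hy)
    | zero => rw [map_zero]; exact zero_mem _
    | add y z _ _ hy hz => rw [map_add]; exact add_mem hy hz
    | smul r y _ hy => rw [map_smul]; exact Submodule.smul_mem _ r hy

end Main

theorem mainTheorem6 {K : Type w} [Field K] {V : Type u} [Quiver.{v} V] [Fintype V]
    [∀ a b : V, Fintype (a ⟶ b)] (I : TwoSidedIdeal (PathAlgebra K V))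
    (g : Set (PathAlgebra K V)) (hg : PathAlgebra.IsMinimalUniformGenerating g I)
    (d : ℕ) (hd : 2 ≤ d) (hI : IsKoszul I d) (A : ℕ) (hA : 1 ≤ A) :
    IsStacked (stretchedIdeal hA g) (d * A) A := by
  rw [stretchedIdeal_eq hA hg.span_eq]
  obtain ⟨P, hP⟩ := hI.resolution
  obtain ⟨D, hD, ex1, ex2⟩ := P.exists_presentation hI.admissible hI.homogeneous
  refine ⟨by nlinarith, hA, isAdmissible_idealOf hA hI.admissible,
    (isAdmissible_idealOf hA hI.admissible).finiteDimensional,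
    isLengthHomogeneous_idealOf hA hI.homogeneous,
    stretchedResolution hA hI.admissible hI.homogeneous P hd hP hD ex1 ex2, fun n => ?_⟩
  exact span_stretchedGrading hA P hP n
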